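/- Setting. Let $\mathcal S,\mathcal A$ be finite sets with $S=|\mathcal S|$, $A=|\mathcal A|$, and let $\{\mathcal M(\theta)\}_{\theta\in\Theta}$ be a measurable family of tabular MDPs on $\mathcal S,\mathcal A$ with transition kernels $P_\theta(s'|s,a)$, a common known reward $r:\mathcal S\times\mathcal A\to[0,1]$ and a common initial distribution $\nu$. Assume every $\mathcal M(\theta)$ is communicating (for any $s,s'$ some stationary Markov policy reaches $s'$ from $s$ with positive probability in some number of steps). Let $V_\gamma^*(\cdot;\theta)$ be the optimal $\gamma$-discounted value function, fix a reference state $\hat s$, and put $\bar r^*(\theta)=\lim_{\gamma\uparrow1}(1-\gamma)V^*_\gamma(\hat s;\theta)$, $v(s;\theta)=\lim_{\gamma\uparrow1}[V^*_\gamma(s;\theta)-V^*_\gamma(\hat s;\theta)]$, $q(s,a;\theta)=r(s,a)+\sum_{s'}P_\theta(s'|s,a)v(s';\theta)$. Assume there is $\bar v\ge 0$ with $\max_s v(s;\theta)-\min_s v(s;\theta)\le\bar v$ for all $\theta\in\Theta$. The true parameter $\theta^*$ has law $\mu_0$, a probability measure on $\Theta$. An offline trajectory $\mathcal D_0=(\bar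 s_0,\bar a_0,\dots,\bar s_{N-1},\bar a_{N-1},\bar s_N)$ with fixed $\bar s_0$ is generated in $\mathcal M(\theta^*)$ by the expert policy $\pi^\beta(a|s)\propto\exp(\beta q(s,a;\theta^*))$, with $\beta>0$ known to the agent. Let $\mathtt{MDPSolve}$ be a measurable map from $\Theta$ to deterministic stationary policies such that $\pi=\mathtt{MDPSolve}(\theta)$ satisfies $\pi(s)\in\arg\max_a q(s,a;\theta)$ for all $s$. Algorithm inf-iPSRL with episode lengths $T_1,T_2,\dots$: set $t_1=0$, $t_{k+1}=t_k+T_k$; the online initial state is $s_0\sim\nu$. Let $\mu_1$ be the posterior of $\theta^*$ given $\mathcal D_0$, that is, $d\mu_1\propto\prod_{i<N}P_\theta(\bar s_{i+1}|\bar s_i,\bar a_i)\,\pi^\beta_\theta(\bar a_i|\bar s_i)\,d\mu_0(\theta)$, where $\pi^\beta_\theta(a|s)\propto\exp(\beta q(s,a;\theta))$. In episode $k$ sample $\tilde\theta^k\sim\mu_k$, play $a_t=\tilde\pi^k(s_t)$ with $\tilde\pi^k=\mathtt{MDPSolve}(\tilde\theta^k)$ for $t_k\le t<t_{k+1}$,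 and then update $d\mu_{k+1}\propto\prod_{t=t_k}^{t_{k+1}-1}P_\theta(s_{t+1}|s_t,a_t)\,d\mu_k(\theta)$. Let $\varepsilon=\Pr(\tilde\pi^1\ne\mathtt{MDPSolve}(\theta^*))$, and let $\mathfrak{BR}_T=\mathbb E_{\theta^*\sim\mu_0}\big[T\bar r^*(\theta^*)-\mathbb E_{\theta^*}[\sum_{t=0}^{T-1}r(s_t,a_t)]\big]$ be the Bayesian regret, where $\mathbb E_{\theta}$ is the expectation over the offline data and the online interaction in $\mathcal M(\theta)$. Corollary. Let $\hat\varepsilon\ge\varepsilon$ with $\hat\varepsilon>0$, and use the episode schedule $T_k=\lceil\hat\varepsilon k\rceil$, $k\ge1$. Then $\mathfrak{BR}_T\le 3\bar v+\tilde O(\bar v SA\sqrt{\hat\varepsilon T})$. That is, there are absolute constants $C$ and $p$ such that in every such setting and for every $T\ge1$ the regret is $\mu_0$-integrable in $\theta^*$ and $$\mathfrak{BR}_T\le 3\bar v+C\,\bar v\,S A\sqrt{\hat\varepsilon T}\,\big(1+\log(SAT)\big)^p .$$ -/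

import Mathlib

open Filter Topology MeasureTheory

noncomputable section

namespace InfIPSRL

/-- A parametrized family of tabular environments `M(θ) = (S, A, P_θ, r, ν)`. The reward function
and the initial distribution are known; only the transition kernel depends on `θ`. -/
structure MDPFamily (S A Θ : Type*) [Fintype S] [MeasurableSpace Θ] where
  /-- `P θ s a s'` is the probability of moving to `s'` from `s` under action `a`. -/
  P : Θ → S → A → S → ℝ
  P_mem : ∀ θ s a, P θ s a ∈ stdSimplex ℝ S
  P_measurable : ∀ s a s', Measurable fun θ => P θ s a s'
  /-- the instantaneous reward -/
  r : S → A → ℝ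
  r_mem : ∀ s a, r s a ∈ Set.Icc (0 : ℝ) 1
  /-- the distribution of the initial state of the online phase -/
  ν : S → ℝ
  ν_mem : ν ∈ stdSimplex ℝ S

section MDP

variable {S A : Type*} [Fintype S] [Fintype A]

/-- Communicating MDP: every state can be reached from every other one with positive probability
under some (randomized) stationary Markov policy. -/
def Communicating [DecidableEq S] (P : S → A → S → ℝ) : Prop :=
  ∀ s s' : S, ∃ π : S → A → ℝ, (∀ x, π x ∈ stdSimplex ℝ A) ∧
    ∃ k : ℕ, 0 < ((Matrix.of fun x y => ∑ a, π x a * P x a y) ^ k) s s'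

variable (S A) in
/-- Randomized history-dependent policies: the law of the next action given the list of past
state-action pairs and the current state. -/
def Policy : Type _ :=
  {π : List (S × A) → S → A → ℝ // ∀ h s, π h s ∈ stdSimplex ℝ A}

/-- Expectation of the reward collected `t` steps from now, under the policy `π`, when the past
state-action pairs are `h` and the current state is `s`. -/
def rewardAfter (P : S → A → S → ℝ) (r : S → A → ℝ) (π : Policy S A) :
    ℕ → List (S × A) → S → ℝ
  | 0, h, s => ∑ a, π.1 h s a * r s a
  | t + 1, h, s => ∑ a, π.1 h s a * ∑ s', P s a s' * rewardAfter P r π t (h ++ [(s, a)]) s'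

/-- `V_γ^*(s)`, the optimal total discounted reward from the state `s`. -/
def discountedValue (P : S → A → S → ℝ) (r : S → A → ℝ) (γ : ℝ) (s : S) : ℝ :=
  ⨆ π : Policy S A, ∑' t : ℕ, γ ^ t * rewardAfter P r π t [] s

/-- The optimal average reward `lim_{γ → 1} (1 - γ) V_γ^*(ŝ)`. -/
def optGain (P : S → A → S → ℝ) (r : S → A → ℝ) (ŝ : S) : ℝ :=
  limUnder (𝓝[<] (1 : ℝ)) fun γ => (1 - γ) * discountedValue P r γ ŝ

/-- The relative state value function `v(s) = lim_{γ → 1} (V_γ^*(s) - V_γ^*(ŝ))`. -/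
def relValue (P : S → A → S → ℝ) (r : S → A → ℝ) (ŝ s : S) : ℝ :=
  limUnder (𝓝[<] (1 : ℝ)) fun γ => discountedValue P r γ s - discountedValue P r γ ŝ

/-- The relative state-action value function `q(s, a)`. -/
def qValue (P : S → A → S → ℝ) (r : S → A → ℝ) (ŝ s : S) (a : A) : ℝ :=
  r s a + ∑ s', P s a s' * relValue P r ŝ s'

/-- The expert's policy: soft-max of `β q`. -/
def expertPolicy (P : S → A → S → ℝ) (r : S → A → ℝ) (ŝ : S) (β : ℝ) (s : S) (a : A) : ℝ :=
  Real.exp (β * qValue P r ŝ s a) / ∑ a', Real.exp (β * qValue P r ŝ s a')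

end MDP

/-- The planning oracle: a (measurable) map from parameters to deterministic stationary policies
which are greedy for the `q`-function of the parameter. -/
structure IsPlanningOracle {S A Θ : Type*} [Fintype S] [Fintype A] [MeasurableSpace Θ]
    (M : MDPFamily S A Θ) (ŝ : S) (solve : Θ → S → A) : Prop where
  measurable : ∀ π : S → A, MeasurableSet {θ | solve θ = π}
  greedy : ∀ θ s a, qValue (M.P θ) M.r ŝ s a ≤ qValue (M.P θ) M.r ŝ s (solve θ s)

/-- Bayes' rule: the probability measure proportional to `L dμ`. (The case of a vanishing
normalizing constant corresponds to an observation of probability zero.) -/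
def bayesUpdate {Θ : Type*} [MeasurableSpace Θ] (μ : Measure Θ) (L : Θ → ℝ) : Measure Θ :=
  open Classical in
  if ∫⁻ θ, ENNReal.ofReal (L θ) ∂μ = 0 then μ
  else (∫⁻ θ, ENNReal.ofReal (L θ) ∂μ)⁻¹ • μ.withDensity fun θ => ENNReal.ofReal (L θ)

/-- Starting time `t_k = T_1 + ... + T_{k-1}` of episode `k` (episodes are numbered from `1`). -/
def episodeStart (sched : ℕ → ℕ) (k : ℕ) : ℕ := ∑ j ∈ Finset.Ico 1 k, sched j

/-- The episode `k` with `t_k ≤ t < t_{k+1}` (for schedules of positive episode lengths). -/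
def episodeAt (sched : ℕ → ℕ) (t : ℕ) : ℕ :=
  Nat.findGreatest (fun k => episodeStart sched k ≤ t) (t + 1)

/-- The offline dataset: states `s̄_0, ..., s̄_N` and actions `ā_0, ..., ā_{N-1}`. -/
abbrev Offline (S A : Type*) (N : ℕ) : Type _ := (Fin (N + 1) → S) × (Fin N → A)

/-- What is recorded at one time of the online phase: the state `s_t` and the deterministic
stationary policy in use, so that the action is `a_t = x.2 x.1`. -/
abbrev Rec (S A : Type*) : Type _ := S × (S → A)

section Algorithm

variable {S A Θ : Type*} [Fintype S] [DecidableEq S] [Fintype A] [DecidableEq A]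
  [MeasurableSpace Θ]

/-- Likelihood of the offline data under the parameter `θ`. -/
def offlineLik (M : MDPFamily S A Θ) (ŝ : S) (β : ℝ) {N : ℕ} (D : Offline S A N) (θ : Θ) : ℝ :=
  ∏ i : Fin N, M.P θ (D.1 i.castSucc) (D.2 i) (D.1 i.succ) *
    expertPolicy (M.P θ) M.r ŝ β (D.1 i.castSucc) (D.2 i)

/-- Probability of the offline data in the environment `θ`; its first state is the fixed `s̄₀`. -/
def offlineProb (M : MDPFamily S A Θ) (ŝ : S) (β : ℝ) {N : ℕ} (s₀ : S) (θ : Θ)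
    (D : Offline S A N) : ℝ :=
  if D.1 0 = s₀ then offlineLik M ŝ β D θ else 0

/-- Likelihood of the transitions observed during episode `k`, from the records at times
`0, ..., n`. -/
def episodeLik (M : MDPFamily S A Θ) (sched : ℕ → ℕ) {n : ℕ} (h : Fin (n + 1) → Rec S A)
    (k : ℕ) (θ : Θ) : ℝ :=
  ∏ i : Fin n with episodeStart sched k ≤ i.1 ∧ i.1 < episodeStart sched (k + 1),
    M.P θ (h i.castSucc).1 ((h i.castSucc).2 (h i.castSucc).1) (h i.succ).1

/-- The agent's beliefs `μ_0` (prior), `μ_1` (after the offline data), and `μ_{k+1}`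
(after episode `k`). -/
def posterior (M : MDPFamily S A Θ) (ŝ : S) (β : ℝ) (μ₀ : Measure Θ) (sched : ℕ → ℕ) {N : ℕ}
    (D : Offline S A N) {n : ℕ} (h : Fin (n + 1) → Rec S A) : ℕ → Measure Θ
  | 0 => μ₀
  | 1 => bayesUpdate μ₀ (offlineLik M ŝ β D)
  | k + 2 => bayesUpdate (posterior M ŝ β μ₀ sched D h (k + 1)) (episodeLik M sched h (k + 1))

/-- Probability that the sampled policy `solve θ̃`, `θ̃ ∼ μ_k`, at the start `n = t_k` of an episode
is the one recorded at time `n`. -/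
def sampleProb (M : MDPFamily S A Θ) (ŝ : S) (β : ℝ) (μ₀ : Measure Θ) (solve : Θ → S → A)
    (sched : ℕ → ℕ) {N : ℕ} (D : Offline S A N) {n : ℕ} (h : Fin (n + 1) → Rec S A) : ℝ :=
  (posterior M ŝ β μ₀ sched D h (episodeAt sched n)).real
    {θ' | solve θ' = (h (Fin.last n)).2}

/-- Probability of the records `h` at times `0, ..., n` when the agent runs inf-iPSRL with
offline data `D` in the environment `θ`: the policy is resampled at the start of each episode
and kept otherwise. -/
def trajProb (M : MDPFamily S A Θ) (ŝ : S) (β : ℝ) (μ₀ : Measure Θ) (solve : Θ → S → A)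
    (sched : ℕ → ℕ) {N : ℕ} (D : Offline S A N) (θ : Θ) :
    (n : ℕ) → (Fin (n + 1) → Rec S A) → ℝ
  | 0, h => M.ν (h 0).1 * sampleProb M ŝ β μ₀ solve sched D h
  | n + 1, h =>
    let x := h (Fin.last n).castSucc
    let y := h (Fin.last (n + 1))
    trajProb M ŝ β μ₀ solve sched D θ n (fun i => h i.castSucc) * M.P θ x.1 (x.2 x.1) y.1 *
      if episodeStart sched (episodeAt sched (n + 1)) = n + 1 then
        sampleProb M ŝ β μ₀ solve sched D h
      else if y.2 = x.2 then 1 else 0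

/-- `E_θ[r(s_t, a_t)]`, over the offline data and the online interaction. -/
def expectedReward (M : MDPFamily S A Θ) (ŝ : S) (β : ℝ) (μ₀ : Measure Θ) (solve : Θ → S → A)
    (sched : ℕ → ℕ) (N : ℕ) (s₀ : S) (θ : Θ) (t : ℕ) : ℝ :=
  ∑ D : Offline S A N, offlineProb M ŝ β s₀ θ D *
    ∑ h : Fin (t + 1) → Rec S A, trajProb M ŝ β μ₀ solve sched D θ t h *
      M.r (h (Fin.last t)).1 ((h (Fin.last t)).2 (h (Fin.last t)).1)

/-- The regret of inf-iPSRL over `T` steps in the environment `θ`. -/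
def regret (M : MDPFamily S A Θ) (ŝ : S) (β : ℝ) (μ₀ : Measure Θ) (solve : Θ → S → A)
    (sched : ℕ → ℕ) (N : ℕ) (s₀ : S) (T : ℕ) (θ : Θ) : ℝ :=
  T * optGain (M.P θ) M.r ŝ -
    ∑ t ∈ Finset.range T, expectedReward M ŝ β μ₀ solve sched N s₀ θ t

/-- The Bayesian regret of inf-iPSRL over `T` steps. -/
def bayesRegret (M : MDPFamily S A Θ) (ŝ : S) (β : ℝ) (μ₀ : Measure Θ) (solve : Θ → S → A)
    (sched : ℕ → ℕ) (N : ℕ) (s₀ : S) (T : ℕ) : ℝ :=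
  ∫ θ, regret M ŝ β μ₀ solve sched N s₀ T θ ∂μ₀

/-- The initial mismatch probability `Pr(solve θ̃ ≠ solve θ*)`, where `θ* ∼ μ_0`, the offline data
are generated by the expert in the environment `θ*`, and `θ̃ ∼ μ_1`. -/
def initialMismatch (M : MDPFamily S A Θ) (ŝ : S) (β : ℝ) (μ₀ : Measure Θ) (solve : Θ → S → A)
    (N : ℕ) (s₀ : S) : ℝ :=
  ∫ θ, ∑ D : Offline S A N, offlineProb M ŝ β s₀ θ D *
    (bayesUpdate μ₀ (offlineLik M ŝ β D)).real {θ' | solve θ' ≠ solve θ} ∂μ₀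

end Algorithm

end InfIPSRL

end

set_option linter.unusedSectionVars false

/-! For a communicating MDP the gain and the relative values exist as genuine limits: near γ = 1 the
optimal discounted value is one rational function of γ, and the relevant combinations stay bounded.
The average-reward Bellman equation follows by passing to the limit.

Let θ be the true parameter, θ' the one sampled for the current episode, and `mis` the indicator
that their policies differ. The Bellman equation for the policy in use splits the regret of a step
into four terms (`gain_sub_reward`). (1) `mis` times the difference of the gains. At the start of an
episode θ and θ' are independent with the same law given the data (`E_start`), so this antisymmetric
term has mean zero. (2) The increment of the bias of θ, which telescopes over the whole horizon and
costs at most V. (3) `mis` times the increment of the difference of the two biases, which telescopes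
inside an episode and costs 2 V times the mismatch probability per episode. (4) `mis` times the
effect of the difference of the two kernels on the bias of θ'.

The mismatch probability never exceeds its initial value ε (`E_mis_le`): it is the mean of the
concave function 1 - ∑ p² of the posterior law p of the policy, and this law is a martingale. The
schedule ⌈ê k⌉ starts at most 1 + √(2T/ê) episodes before T, so (3) costs 2V + O(V √(ê T)); together
with (2) this yields the term 3V.

For (4), both parameters lie with high probability in a Hoeffding confidence set built at the start
of the episode, so their kernels differ by O(√(L/v)) in total variation at a pair visited v times.
Since (4) also carries the factor `mis`, the inequality 2√(L/v) ≤ η/2 + 2L/(ηv) bounds its sum by η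
T ε / 2 plus a harmonic sum over visits of order L S A log T / η (`error_le`). A suitable η gives S
A √(ê T) up to logarithms; pairs with few visits, whose counts may be stale, cost S A times the
maximal episode length, which has the same order. -/

namespace InfIPSRL

/-! ### Averages against a probability vector. -/

section Simplex

variable {ι : Type*} [Fintype ι] {p f : ι → ℝ} {c : ℝ}

lemma stdSimplex_sum_le (hp : p ∈ stdSimplex ℝ ι) (h : ∀ i, f i ≤ c) : ∑ i, p i * f i ≤ c := by
  calc ∑ i, p i * f i ≤ ∑ i, p i * c :=
        Finset.sum_le_sum fun i _ => mul_le_mul_of_nonneg_left (h i) (hp.1 i)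
    _ = c := by rw [← Finset.sum_mul, hp.2, one_mul]

lemma le_stdSimplex_sum (hp : p ∈ stdSimplex ℝ ι) (h : ∀ i, c ≤ f i) : c ≤ ∑ i, p i * f i := by
  calc c = ∑ i, p i * c := by rw [← Finset.sum_mul, hp.2, one_mul]
    _ ≤ ∑ i, p i * f i :=
        Finset.sum_le_sum fun i _ => mul_le_mul_of_nonneg_left (h i) (hp.1 i)

lemma stdSimplex_le_one (hp : p ∈ stdSimplex ℝ ι) (i : ι) : p i ≤ 1 :=
  hp.2 ▸ Finset.single_le_sum (fun j _ => hp.1 j) (Finset.mem_univ i)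

lemma stdSimplex_sum_add_const (hp : p ∈ stdSimplex ℝ ι) :
    ∑ i, p i * (f i + c) = ∑ i, p i * f i + c := by
  simp only [mul_add, Finset.sum_add_distrib, ← Finset.sum_mul, hp.2, one_mul]

end Simplex

/-! ### Discounted dynamic programming. -/

section MDP

variable {S A : Type*} [Fintype S] [Fintype A]

/-- The discounted Bellman optimality operator. -/
noncomputable def bellman [Nonempty A] (P : S → A → S → ℝ) (r : S → A → ℝ) (γ : ℝ) (U : S → ℝ)
    (s : S) : ℝ :=
  Finset.univ.sup' Finset.univ_nonempty fun a => r s a + γ * ∑ s', P s a s' * U s'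

variable {P : S → A → S → ℝ} {r : S → A → ℝ} {γ : ℝ}

lemma le_bellman [Nonempty A] (U : S → ℝ) (s : S) (a : A) :
    r s a + γ * ∑ s', P s a s' * U s' ≤ bellman P r γ U s :=
  Finset.le_sup' (fun a => r s a + γ * ∑ s', P s a s' * U s') (Finset.mem_univ a)

lemma exists_bellman_eq [Nonempty A] (U : S → ℝ) (s : S) :
    ∃ a, bellman P r γ U s = r s a + γ * ∑ s', P s a s' * U s' := by
  obtain ⟨a, -, ha⟩ := Finset.exists_mem_eq_sup' (Finset.univ_nonempty (α := A))
    (fun a => r s a + γ * ∑ s', P s a s' * U s')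
  exact ⟨a, ha⟩

/-- An action maximizing for U is a candidate for U', and changing U into U' moves its value by at
most γ times the sup distance. -/
lemma bellman_le_add_dist [Nonempty A] (hP : ∀ s a, P s a ∈ stdSimplex ℝ S) (h0 : 0 ≤ γ)
    (U U' : S → ℝ) (s : S) : bellman P r γ U s ≤ bellman P r γ U' s + γ * dist U U' := by
  obtain ⟨a, ha⟩ := exists_bellman_eq (P := P) (r := r) (γ := γ) U s
  have h1 : ∑ s', P s a s' * U s' ≤ ∑ s', P s a s' * U' s' + dist U U' := by
    rw [← stdSimplex_sum_add_const (hP s a)]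
    refine Finset.sum_le_sum fun i _ => mul_le_mul_of_nonneg_left ?_ ((hP s a).1 i)
    have := dist_le_pi_dist U U' i
    rw [Real.dist_eq] at this
    linarith [le_abs_self (U i - U' i)]
  have h2 := le_bellman (P := P) (r := r) (γ := γ) U' s a
  nlinarith [mul_le_mul_of_nonneg_left h1 h0]

lemma contractingWith_bellman [Nonempty A] (hP : ∀ s a, P s a ∈ stdSimplex ℝ S) (h0 : 0 ≤ γ)
    (h1 : γ < 1) : ContractingWith ⟨γ, h0⟩ (bellman P r γ) := by
  refine ⟨by exact_mod_cast h1, LipschitzWith.of_dist_le_mul fun U U' => ?_⟩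
  change _ ≤ γ * _
  refine (dist_pi_le_iff (by positivity)).2 fun s => ?_
  rw [Real.dist_eq, abs_sub_le_iff]
  constructor
  · linarith [bellman_le_add_dist (r := r) hP h0 U U' s]
  · rw [dist_comm]
    linarith [bellman_le_add_dist (r := r) hP h0 U' U s]

/-- The discounted reward of the next `n` steps. -/
noncomputable def partialReward (P : S → A → S → ℝ) (r : S → A → ℝ) (γ : ℝ) (π : Policy S A)
    (n : ℕ) (h : List (S × A)) (s : S) : ℝ :=
  ∑ t ∈ Finset.range n, γ ^ t * rewardAfter P r π t h s

lemma partialReward_succ (π : Policy S A) (n : ℕ) (h : List (S × A)) (s : S) :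
    partialReward P r γ π (n + 1) h s = ∑ a, π.1 h s a *
      (r s a + γ * ∑ s', P s a s' * partialReward P r γ π n (h ++ [(s, a)]) s') := by
  rw [partialReward, Finset.sum_range_succ']
  simp only [rewardAfter, pow_zero, one_mul, mul_add, Finset.sum_add_distrib, partialReward]
  rw [add_comm]
  congr 1
  simp only [Finset.mul_sum]
  rw [Finset.sum_comm]
  refine Finset.sum_congr rfl fun a _ => ?_
  rw [Finset.sum_comm]
  refine Finset.sum_congr rfl fun s' _ => Finset.sum_congr rfl fun t _ => ?_
  ring

lemma rewardAfter_mem (hP : ∀ s a, P s a ∈ stdSimplex ℝ S) (hr : ∀ s a, r s a ∈ Set.Icc (0 : ℝ) 1)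
    (π : Policy S A) (t : ℕ) (h : List (S × A)) (s : S) :
    rewardAfter P r π t h s ∈ Set.Icc (0 : ℝ) 1 := by
  induction t generalizing h s with
  | zero => exact ⟨le_stdSimplex_sum (π.2 h s) fun a => (hr s a).1,
      stdSimplex_sum_le (π.2 h s) fun a => (hr s a).2⟩
  | succ t ih => exact ⟨le_stdSimplex_sum (π.2 h s) fun a => le_stdSimplex_sum (hP s a)
        fun s' => (ih _ s').1,
      stdSimplex_sum_le (π.2 h s) fun a => stdSimplex_sum_le (hP s a) fun s' => (ih _ s').2⟩

lemma summable_discounted (hP : ∀ s a, P s a ∈ stdSimplex ℝ S)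
    (hr : ∀ s a, r s a ∈ Set.Icc (0 : ℝ) 1) (h0 : 0 ≤ γ) (h1 : γ < 1) (π : Policy S A) (s : S) :
    Summable fun t : ℕ => γ ^ t * rewardAfter P r π t [] s := by
  refine Summable.of_nonneg_of_le
    (fun t => mul_nonneg (pow_nonneg h0 t) (rewardAfter_mem hP hr π t [] s).1) (fun t => ?_)
    (summable_geometric_of_lt_one h0 h1)
  exact mul_le_of_le_one_right (pow_nonneg h0 t) (rewardAfter_mem hP hr π t [] s).2

variable [Nonempty A] {U : S → ℝ}

/-- At a minimizer m of U, nonnegative rewards give U m ≥ γ U m. -/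
lemma bellman_fixedPoint_nonneg (hP : ∀ s a, P s a ∈ stdSimplex ℝ S)
    (hr : ∀ s a, r s a ∈ Set.Icc (0 : ℝ) 1) (h0 : 0 ≤ γ) (h1 : γ < 1)
    (hU : bellman P r γ U = U) (s : S) : 0 ≤ U s := by
  obtain ⟨m, -, hm⟩ := Finset.exists_min_image Finset.univ U ⟨s, Finset.mem_univ s⟩
  obtain ⟨a⟩ := ‹Nonempty A›
  have hs := hm s (Finset.mem_univ s)
  have h2 := le_bellman (P := P) (r := r) (γ := γ) U m a
  rw [hU] at h2
  have h3 := le_stdSimplex_sum (hP m a) (fun i => hm i (Finset.mem_univ i))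
  have h4 := (hr m a).1
  nlinarith [mul_le_mul_of_nonneg_left h3 h0]

/-- At a maximizer m of U, rewards at most one give U m ≤ 1 + γ U m. -/
lemma bellman_fixedPoint_le (hP : ∀ s a, P s a ∈ stdSimplex ℝ S)
    (hr : ∀ s a, r s a ∈ Set.Icc (0 : ℝ) 1) (h0 : 0 ≤ γ) (h1 : γ < 1)
    (hU : bellman P r γ U = U) (s : S) : (1 - γ) * U s ≤ 1 := by
  obtain ⟨m, -, hm⟩ := Finset.exists_max_image Finset.univ U ⟨s, Finset.mem_univ s⟩
  have hs := hm s (Finset.mem_univ s)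
  obtain ⟨a, ha⟩ := exists_bellman_eq (P := P) (r := r) (γ := γ) U m
  rw [hU] at ha
  have h3 := stdSimplex_sum_le (hP m a) (fun i => hm i (Finset.mem_univ i))
  have h4 := (hr m a).2
  nlinarith [mul_le_mul_of_nonneg_left h3 h0]

lemma partialReward_le (hP : ∀ s a, P s a ∈ stdSimplex ℝ S)
    (hr : ∀ s a, r s a ∈ Set.Icc (0 : ℝ) 1) (h0 : 0 ≤ γ) (h1 : γ < 1)
    (hU : bellman P r γ U = U) (π : Policy S A) (n : ℕ) (h : List (S × A)) (s : S) :
    partialReward P r γ π n h s ≤ U s := by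
  induction n generalizing h s with
  | zero => simpa [partialReward] using bellman_fixedPoint_nonneg hP hr h0 h1 hU s
  | succ n ih =>
    rw [partialReward_succ]
    refine stdSimplex_sum_le (π.2 h s) fun a => ?_
    have h2 := le_bellman (P := P) (r := r) (γ := γ) U s a
    rw [hU] at h2
    refine le_trans ?_ h2
    gcongr with s' _
    · exact (hP s a).1 s'
    · exact ih _ s'

/-- A deterministic stationary policy as a history-dependent randomized policy. -/
noncomputable def stationary (π : S → A) : Policy S A :=
  ⟨fun _ s => by classical exact Pi.single (π s) 1, fun _ s => by
    classical exact single_mem_stdSimplex ℝ (π s)⟩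

lemma sum_stationary (π : S → A) (h : List (S × A)) (s : S) (f : A → ℝ) :
    ∑ a, (stationary π).1 h s a * f a = f (π s) := by
  classical
  simp [stationary, Pi.single_apply]

/-- Unrolling the evaluation equation of π for n steps leaves the remainder γ ^ n B. -/
lemma le_partialReward_stationary (hP : ∀ s a, P s a ∈ stdSimplex ℝ S) (h0 : 0 ≤ γ) {π : S → A}
    (hπ : ∀ s, U s = r s (π s) + γ * ∑ s', P s (π s) s' * U s') {B : ℝ} (hB : ∀ s, U s ≤ B)
    (n : ℕ) (h : List (S × A)) (s : S) :
    U s ≤ partialReward P r γ (stationary π) n h s + γ ^ n * B := by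
  induction n generalizing h s with
  | zero => simpa [partialReward] using hB s
  | succ n ih =>
    rw [partialReward_succ, sum_stationary]
    have h2 := Finset.sum_le_sum fun s' (_ : s' ∈ Finset.univ) =>
      mul_le_mul_of_nonneg_left (ih (h ++ [(s, π s)]) s') ((hP s (π s)).1 s')
    rw [stdSimplex_sum_add_const (hP s (π s))] at h2
    have h3 := mul_le_mul_of_nonneg_left h2 h0
    rw [hπ s, pow_succ]
    linarith

/-- The optimal discounted value is the fixed point of the Bellman operator. -/
lemma discountedValue_eq (hP : ∀ s a, P s a ∈ stdSimplex ℝ S)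
    (hr : ∀ s a, r s a ∈ Set.Icc (0 : ℝ) 1) (h0 : 0 ≤ γ) (h1 : γ < 1)
    (hU : bellman P r γ U = U) (s : S) : discountedValue P r γ s = U s := by
  have hle : ∀ π : Policy S A, ∑' t : ℕ, γ ^ t * rewardAfter P r π t [] s ≤ U s := fun π =>
    le_of_tendsto' (summable_discounted hP hr h0 h1 π s).hasSum.tendsto_sum_nat
      fun n => partialReward_le hP hr h0 h1 hU π n [] s
  have : Nonempty (Policy S A) := ⟨stationary fun _ => Classical.arbitrary A⟩
  refine le_antisymm (ciSup_le hle) ?_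
  -- A stationary policy greedy for the fixed point attains it in the limit, because the remainder γ
  -- ^ n / (1 - γ) vanishes.
  choose π hπ using fun s => exists_bellman_eq (P := P) (r := r) (γ := γ) U s
  rw [hU] at hπ
  have hB : ∀ s, U s ≤ 1 / (1 - γ) := fun s => by
    rw [le_div_iff₀ (by linarith), mul_comm]
    exact bellman_fixedPoint_le hP hr h0 h1 hU s
  refine le_trans ?_ (le_ciSup (f := fun π : Policy S A =>
    ∑' t : ℕ, γ ^ t * rewardAfter P r π t [] s) ⟨U s, by rintro _ ⟨π, rfl⟩; exact hle π⟩
      (stationary π))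
  have hlim := (summable_discounted hP hr h0 h1 (stationary π) s).hasSum.tendsto_sum_nat.add
    ((tendsto_pow_atTop_nhds_zero_of_lt_one h0 h1).mul_const (1 / (1 - γ)))
  rw [zero_mul, add_zero] at hlim
  exact ge_of_tendsto' hlim fun n => le_partialReward_stationary hP h0 hπ hB n [] s

lemma tendsto_bellman_iterate (hP : ∀ s a, P s a ∈ stdSimplex ℝ S)
    (hr : ∀ s a, r s a ∈ Set.Icc (0 : ℝ) 1) (h0 : 0 ≤ γ) (h1 : γ < 1) (s : S) :
    Tendsto (fun n => ((bellman P r γ)^[n] 0) s) atTop (𝓝 (discountedValue P r γ s)) := by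
  have hc := contractingWith_bellman (r := r) hP h0 h1
  rw [discountedValue_eq hP hr h0 h1 hc.fixedPoint_isFixedPt s]
  exact (tendsto_pi_nhds.1 (hc.tendsto_iterate_fixedPoint 0)) s

lemma bellman_discountedValue (hP : ∀ s a, P s a ∈ stdSimplex ℝ S)
    (hr : ∀ s a, r s a ∈ Set.Icc (0 : ℝ) 1) (h0 : 0 ≤ γ) (h1 : γ < 1) :
    bellman P r γ (discountedValue P r γ) = discountedValue P r γ := by
  have hc := contractingWith_bellman (r := r) hP h0 h1
  rw [funext fun s => discountedValue_eq hP hr h0 h1 hc.fixedPoint_isFixedPt s]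
  exact hc.fixedPoint_isFixedPt

end MDP

/-! ### One-sided limits of meromorphic functions and signs of polynomials. -/

section Limits

/-- At a pole the absolute value tends to infinity from every side, so boundedness on the left alone
excludes a negative order; a meromorphic function of nonnegative order converges. -/
lemma exists_tendsto_of_meromorphicAt {f : ℝ → ℝ} {x C : ℝ} (hf : MeromorphicAt f x)
    (hb : ∀ᶠ y in 𝓝[<] x, |f y| ≤ C) : ∃ c, Tendsto f (𝓝[<] x) (𝓝 c) := by
  have hle : 𝓝[<] x ≤ 𝓝[≠] x := nhdsWithin_mono x fun y hy => ne_of_lt hy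
  rcases lt_or_ge (meromorphicOrderAt f x) 0 with h | h
  · have h1 := ((tendsto_cobounded_iff_meromorphicOrderAt_neg hf).2 h).mono_left hle
    rw [← tendsto_norm_atTop_iff_cobounded] at h1
    obtain ⟨y, hy1, hy2⟩ := (hb.and (h1.eventually_gt_atTop C)).exists
    rw [Real.norm_eq_abs] at hy2
    exact absurd hy1 (not_le.2 hy2)
  · obtain ⟨c, hc⟩ := (tendsto_nhds_iff_meromorphicOrderAt_nonneg hf).2 h
    exact ⟨c, hc.mono_left hle⟩

/-- Factor p = (X - x) ^ m q with q(x) ≠ 0. Just to the left of x the sign of p is that of (-1) ^ m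
q(x), hence constant. -/
lemma eventually_eval_nonneg_of_frequently {p : Polynomial ℝ} {x : ℝ}
    (h : ∃ᶠ y in 𝓝[<] x, 0 ≤ p.eval y) : ∀ᶠ y in 𝓝[<] x, 0 ≤ p.eval y := by
  rcases eq_or_ne p 0 with rfl | hp
  · simp
  obtain ⟨q, hq, hnd⟩ := p.exists_eq_pow_rootMultiplicity_mul_and_not_dvd hp x
  have hqx : q.eval x ≠ 0 := fun h0 => hnd (Polynomial.dvd_iff_isRoot.2 h0)
  set m := p.rootMultiplicity x
  have hev : ∀ y, p.eval y = (x - y) ^ m * ((-1) ^ m * q.eval y) := fun y => by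
    rw [hq, Polynomial.eval_mul, Polynomial.eval_pow, ← mul_assoc, ← mul_pow]
    simp
  have hlt : ∀ᶠ y in 𝓝[<] x, y < x := self_mem_nhdsWithin
  have hcont : Tendsto (fun y => (-1) ^ m * q.eval y) (𝓝[<] x) (𝓝 ((-1) ^ m * q.eval x)) :=
    (Continuous.tendsto (by fun_prop) x).mono_left nhdsWithin_le_nhds
  rcases lt_or_gt_of_ne (mul_ne_zero (pow_ne_zero m (by norm_num : (-1 : ℝ) ≠ 0)) hqx)
    with h0 | h0
  · obtain ⟨y, hy, hy1, hy2⟩ :=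
      (h.and_eventually ((hcont.eventually_lt_const h0).and hlt)).exists
    rw [hev] at hy
    exact absurd hy (not_le.2 (mul_neg_of_pos_of_neg (pow_pos (sub_pos.2 hy2) m) hy1))
  · filter_upwards [hcont.eventually_const_lt h0, hlt] with y hy1 hy2
    rw [hev]
    exact mul_nonneg (pow_nonneg (sub_pos.2 hy2).le m) hy1.le

end Limits

/-! ### Blackwell optimality through Cramer's rule. -/

section Resolvent

open Polynomial Matrix

variable {S A : Type*} [Fintype S] [DecidableEq S] [Fintype A]
  {P : S → A → S → ℝ} {r : S → A → ℝ} {γ : ℝ} {U : S → ℝ} {π : S → A}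

/-- The matrix `1 - γ P_π` of a stationary policy as a matrix of polynomials in `γ`. -/
noncomputable def resolventMatrix (P : S → A → S → ℝ) (π : S → A) : Matrix S S ℝ[X] :=
  1 - Matrix.of fun s s' => X * C (P s (π s) s')

/-- Cramer's numerator of the value function of a stationary policy. -/
noncomputable def valueNum (P : S → A → S → ℝ) (r : S → A → ℝ) (π : S → A) (s : S) : ℝ[X] :=
  ((resolventMatrix P π).adjugate *ᵥ fun s => C (r s (π s))) s

/-- Cramer's denominator of the value function of a stationary policy. -/
noncomputable def valueDen (P : S → A → S → ℝ) (π : S → A) : ℝ[X] := (resolventMatrix P π).det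

lemma eval_resolventMatrix_mulVec (P : S → A → S → ℝ) (π : S → A) (γ : ℝ) (U : S → ℝ) (s : S) :
    ((evalRingHom γ).mapMatrix (resolventMatrix P π) *ᵥ U) s
      = U s - γ * ∑ s', P s (π s) s' * U s' := by
  have : (evalRingHom γ).mapMatrix (resolventMatrix P π)
      = 1 - Matrix.of fun s s' => γ * P s (π s) s' := by
    rw [resolventMatrix, map_sub, map_one]
    congr 1
    ext i j
    simp
    ring
  rw [this, Matrix.sub_mulVec, Matrix.one_mulVec, Pi.sub_apply, Finset.mul_sum]
  simp only [Matrix.mulVec, dotProduct, Matrix.of_apply, mul_assoc]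

lemma eval_valueDen (P : S → A → S → ℝ) (π : S → A) (γ : ℝ) :
    (valueDen P π).eval γ = ((evalRingHom γ).mapMatrix (resolventMatrix P π)).det := by
  rw [valueDen, ← RingHom.map_det, coe_evalRingHom]

lemma eval_valueNum (P : S → A → S → ℝ) (r : S → A → ℝ) (π : S → A) (γ : ℝ) (s : S) :
    (valueNum P r π s).eval γ
      = (((evalRingHom γ).mapMatrix (resolventMatrix P π)).adjugate *ᵥ fun s => r s (π s)) s := by
  rw [← RingHom.map_adjugate]
  simp [valueNum, Matrix.mulVec, dotProduct, eval_finsetSum]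

/-- A vector U in the kernel satisfies U = γ P_π U. As γ < 1, this forces its minimum to be
nonnegative and its maximum to be nonpositive. -/
lemma valueDen_ne_zero (hP : ∀ s a, P s a ∈ stdSimplex ℝ S) (h0 : 0 ≤ γ) (h1 : γ < 1)
    (π : S → A) : (valueDen P π).eval γ ≠ 0 := by
  rw [eval_valueDen]
  intro h
  obtain ⟨U, hU, hz⟩ := Matrix.exists_mulVec_eq_zero_iff.2 h
  have hz' : ∀ s, U s = γ * ∑ s', P s (π s) s' * U s' := fun s => by
    have := congrFun hz s
    rw [eval_resolventMatrix_mulVec] at this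
    simpa [sub_eq_zero] using this
  refine hU (funext fun s => ?_)
  obtain ⟨m, -, hm⟩ := Finset.exists_min_image Finset.univ U ⟨s, Finset.mem_univ s⟩
  obtain ⟨k, -, hk⟩ := Finset.exists_max_image Finset.univ U ⟨s, Finset.mem_univ s⟩
  have h2 := le_stdSimplex_sum (hP m (π m)) fun i => hm i (Finset.mem_univ i)
  have h3 := stdSimplex_sum_le (hP k (π k)) fun i => hk i (Finset.mem_univ i)
  have h4 := mul_le_mul_of_nonneg_left h2 h0
  have h5 := mul_le_mul_of_nonneg_left h3 h0
  rw [← hz'] at h4 h5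
  have := hm s (Finset.mem_univ s)
  have := hk s (Finset.mem_univ s)
  have h6 : 0 ≤ U m := by nlinarith
  have h7 : U k ≤ 0 := by nlinarith
  rw [Pi.zero_apply]
  linarith

lemma valueDen_mul (hU : ∀ s, U s = r s (π s) + γ * ∑ s', P s (π s) s' * U s') (s : S) :
    (valueDen P π).eval γ * U s = (valueNum P r π s).eval γ := by
  have h : (evalRingHom γ).mapMatrix (resolventMatrix P π) *ᵥ U = fun s => r s (π s) :=
    funext fun s => by rw [eval_resolventMatrix_mulVec, hU s]; ring
  rw [eval_valueNum, eval_valueDen, ← h, Matrix.mulVec_mulVec, Matrix.adjugate_mul,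
    Matrix.smul_mulVec, Matrix.one_mulVec, Pi.smul_apply, smul_eq_mul]

/-- The converse of `valueDen_mul`: Cramer's quotient solves the evaluation equation of π. -/
lemma value_eq_of_ne_zero (hD : (valueDen P π).eval γ ≠ 0) (s : S) :
    (valueNum P r π s).eval γ / (valueDen P π).eval γ = r s (π s) + γ * ∑ s', P s (π s) s' *
      ((valueNum P r π s').eval γ / (valueDen P π).eval γ) := by
  have h : (evalRingHom γ).mapMatrix (resolventMatrix P π) *ᵥ
      (fun s => (valueNum P r π s).eval γ) = (valueDen P π).eval γ • fun s => r s (π s) := by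
    rw [funext fun s => eval_valueNum P r π γ s, Matrix.mulVec_mulVec, Matrix.mul_adjugate,
      Matrix.smul_mulVec, Matrix.one_mulVec, eval_valueDen]
  have h1 := congrFun h s
  rw [eval_resolventMatrix_mulVec, Pi.smul_apply, smul_eq_mul] at h1
  simp only [← mul_div_assoc, ← Finset.sum_div]
  field_simp
  linarith

/-- Blackwell optimality: near `γ = 1` the optimal value is a fixed rational function of `γ`. -/
lemma exists_eventually_discountedValue_eq [Nonempty A] (hP : ∀ s a, P s a ∈ stdSimplex ℝ S)
    (hr : ∀ s a, r s a ∈ Set.Icc (0 : ℝ) 1) : ∃ π : S → A, ∀ᶠ γ in 𝓝[<] (1 : ℝ), ∀ s,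
      discountedValue P r γ s = (valueNum P r π s).eval γ / (valueDen P π).eval γ := by
  have hI : ∀ᶠ γ in 𝓝[<] (1 : ℝ), γ ∈ Set.Ioo (0 : ℝ) 1 := Ioo_mem_nhdsLT one_pos
  -- There are finitely many policies. If each were eventually suboptimal, then at some γ close to 1
  -- none would be greedy.
  have hex : ∃ π : S → A, ∃ᶠ γ in 𝓝[<] (1 : ℝ), ∀ s, discountedValue P r γ s =
      r s (π s) + γ * ∑ s', P s (π s) s' * discountedValue P r γ s' := by
    by_contra! hcon
    obtain ⟨γ, hγ, h0, h1⟩ := ((eventually_all.2 hcon).and hI).exists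
    choose π hπ using fun s =>
      exists_bellman_eq (P := P) (r := r) (γ := γ) (discountedValue P r γ) s
    rw [bellman_discountedValue hP hr h0.le h1] at hπ
    obtain ⟨s, hs⟩ := hγ π
    exact hs (hπ s)
  obtain ⟨π, hπ⟩ := hex
  refine ⟨π, ?_⟩
  -- This is the optimality of π against the action a, multiplied by the square of the denominator:
  -- a polynomial inequality in γ whatever the sign of the denominator. It holds frequently, hence
  -- eventually.
  have hpoly : ∀ s a, ∀ᶠ γ in 𝓝[<] (1 : ℝ), 0 ≤ (valueDen P π * (valueNum P r π s -
      valueDen P π * C (r s a) - X * ∑ s', C (P s a s') * valueNum P r π s')).eval γ := by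
    refine fun s a => eventually_eval_nonneg_of_frequently ?_
    refine (hπ.and_eventually hI).mono fun γ ⟨hγ, h0, h1⟩ => ?_
    have h2 := le_bellman (P := P) (r := r) (γ := γ) (discountedValue P r γ) s a
    rw [bellman_discountedValue hP hr h0.le h1] at h2
    have h3 := fun s => valueDen_mul hγ s
    simp only [eval_mul, eval_sub, eval_X, eval_C, eval_finsetSum, ← h3]
    have : ∑ x, P s a x * ((valueDen P π).eval γ * discountedValue P r γ x)
        = (valueDen P π).eval γ * ∑ x, P s a x * discountedValue P r γ x := by
      rw [Finset.mul_sum]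
      exact Finset.sum_congr rfl fun _ _ => by ring
    rw [this]
    nlinarith [mul_nonneg (sq_nonneg ((valueDen P π).eval γ)) (sub_nonneg.2 h2)]
  filter_upwards [hI, eventually_all.2 fun s => eventually_all.2 (hpoly s)] with γ ⟨h0, h1⟩ hγ
  have hD := valueDen_ne_zero hP h0.le h1 π
  have hV := fun s => value_eq_of_ne_zero (P := P) (r := r) hD s
  refine discountedValue_eq hP hr h0.le h1 (funext fun s => ?_)
  refine le_antisymm ?_ ((hV s).le.trans (le_bellman _ s (π s)))
  obtain ⟨a, ha⟩ := exists_bellman_eq (P := P) (r := r) (γ := γ)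
    (fun s => (valueNum P r π s).eval γ / (valueDen P π).eval γ) s
  rw [ha]
  have h2 := hγ s a
  simp only [eval_mul, eval_sub, eval_X, eval_C, eval_finsetSum] at h2
  simp only [← mul_div_assoc, ← Finset.sum_div]
  rw [← sub_nonneg]
  have h3 : (valueNum P r π s).eval γ / (valueDen P π).eval γ - (r s a +
      γ * (∑ x, P s a x * (valueNum P r π x).eval γ) / (valueDen P π).eval γ)
      = ((valueDen P π).eval γ * ((valueNum P r π s).eval γ - (valueDen P π).eval γ * r s a -
        γ * ∑ x, P s a x * (valueNum P r π x).eval γ)) / (valueDen P π).eval γ ^ 2 := by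
    field_simp
    ring
  rw [h3]
  positivity

lemma meromorphicAt_value (P : S → A → S → ℝ) (r : S → A → ℝ) (π : S → A) (s : S) (x : ℝ) :
    MeromorphicAt (fun γ => (valueNum P r π s).eval γ / (valueDen P π).eval γ) x :=
  ((AnalyticOnNhd.eval_polynomial _ x (Set.mem_univ x)).meromorphicAt).fun_div
    (AnalyticOnNhd.eval_polynomial _ x (Set.mem_univ x)).meromorphicAt

end Resolvent

/-! ### Communicating MDPs: existence of the limits and the average-reward Bellman equation. -/

section Communicating

variable {S A : Type*} [Fintype S] [DecidableEq S] [Fintype A]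
  {P : S → A → S → ℝ} {r : S → A → ℝ} {γ : ℝ}

lemma Communicating.nonempty_action (h : Communicating P) (s : S) : Nonempty A := by
  obtain ⟨π, hπ, -⟩ := h s s
  by_contra hA
  rw [not_nonempty_iff] at hA
  simpa using (hπ s).2

lemma pow_row_mem_stdSimplex {Q : Matrix S S ℝ} (hQ : ∀ s, Q s ∈ stdSimplex ℝ S) (k : ℕ) (s : S) :
    (Q ^ k) s ∈ stdSimplex ℝ S := by
  induction k generalizing s with
  | zero =>
    refine ⟨fun s' => ?_, ?_⟩
    · rw [pow_zero, Matrix.one_apply]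
      split_ifs <;> norm_num
    · simp [Matrix.one_apply]
  | succ k ih =>
    rw [pow_succ]
    refine ⟨fun s' => ?_, ?_⟩
    · rw [Matrix.mul_apply]
      exact Finset.sum_nonneg fun i _ => mul_nonneg ((ih s).1 i) ((hQ i).1 s')
    · simp only [Matrix.mul_apply]
      rw [Finset.sum_comm]
      simp only [← Finset.mul_sum, (hQ _).2, mul_one, (ih s).2]

/-- Rewards are nonnegative, so the optimal value dominates γ times its mean after one step of π;
this is iterated k times. -/
lemma pow_mul_pow_sum_le_value [Nonempty A] (hP : ∀ s a, P s a ∈ stdSimplex ℝ S)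
    (hr : ∀ s a, r s a ∈ Set.Icc (0 : ℝ) 1) (h0 : 0 ≤ γ) (h1 : γ < 1)
    {π : S → A → ℝ} (hπ : ∀ s, π s ∈ stdSimplex ℝ A) (k : ℕ) (s : S) :
    γ ^ k * ∑ y, ((Matrix.of fun x y => ∑ a, π x a * P x a y) ^ k) s y * discountedValue P r γ y
      ≤ discountedValue P r γ s := by
  set Q : Matrix S S ℝ := Matrix.of fun x y => ∑ a, π x a * P x a y with hQdef
  set V := discountedValue P r γ with hV
  have hQ : ∀ s, Q s ∈ stdSimplex ℝ S := fun s => by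
    refine ⟨fun y => Finset.sum_nonneg fun a _ => mul_nonneg ((hπ s).1 a) ((hP s a).1 y), ?_⟩
    simp only [hQdef, Matrix.of_apply]
    rw [Finset.sum_comm]
    simp only [← Finset.mul_sum, (hP _ _).2, mul_one, (hπ s).2]
  have hstep : ∀ s, γ * ∑ y, Q s y * V y ≤ V s := fun s => by
    have h2 : ∑ y, Q s y * V y = ∑ a, π s a * ∑ y, P s a y * V y := by
      simp only [hQdef, Matrix.of_apply, Finset.sum_mul, Finset.mul_sum]
      rw [Finset.sum_comm]
      simp only [mul_assoc]
    rw [h2, Finset.mul_sum]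
    simp only [mul_left_comm γ]
    refine stdSimplex_sum_le (hπ s) fun a => ?_
    have h3 := le_bellman (P := P) (r := r) (γ := γ) V s a
    rw [bellman_discountedValue hP hr h0 h1] at h3
    linarith [(hr s a).1]
  induction k generalizing s with
  | zero => simp [Matrix.one_apply]
  | succ k ih =>
    refine le_trans ?_ (ih s)
    have h4 : ∑ y, (Q ^ (k + 1)) s y * V y = ∑ x, (Q ^ k) s x * ∑ y, Q x y * V y := by
      simp only [pow_succ, Matrix.mul_apply, Finset.sum_mul, Finset.mul_sum]
      rw [Finset.sum_comm]
      simp only [mul_assoc]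
    rw [h4, pow_succ, mul_assoc, Finset.mul_sum]
    refine mul_le_mul_of_nonneg_left ?_ (pow_nonneg h0 k)
    refine Finset.sum_le_sum fun x _ => ?_
    rw [mul_left_comm]
    exact mul_le_mul_of_nonneg_left (hstep x) ((pow_row_mem_stdSimplex hQ k s).1 x)

/-- Let V be minimal at m and maximal at M, and let some policy lead from m to M in k steps with
probability p. Then V m ≥ γ ^ k (V m + p (V M - V m)), while (1 - γ ^ k) V m ≤ k (1 - γ) V m ≤ k by
Bernoulli's inequality. For γ ≥ 1/2 the span is at most k 2 ^ k / p. As m and M vary with γ, the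
constant sums this over all pairs of states. -/
lemma Communicating.exists_span_bound (hc : Communicating P)
    (hP : ∀ s a, P s a ∈ stdSimplex ℝ S) (hr : ∀ s a, r s a ∈ Set.Icc (0 : ℝ) 1) :
    ∃ C : ℝ, ∀ γ ∈ Set.Ico (1 / 2 : ℝ) 1, ∀ s s',
      discountedValue P r γ s' - discountedValue P r γ s ≤ C := by
  choose π hπ k hk using hc
  set p : S → S → ℝ := fun s s' => ((Matrix.of fun x y => ∑ a, π s s' x a * P x a y) ^ k s s') s s'
    with hp
  have hCnn : ∀ s s', 0 ≤ k s s' * 2 ^ k s s' / p s s' := fun s s' => by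
    have : 0 < p s s' := hk s s'
    positivity
  refine ⟨∑ s, ∑ s', k s s' * 2 ^ k s s' / p s s', fun γ hγ s s' => ?_⟩
  have hA : Nonempty A := Communicating.nonempty_action (fun s s' => ⟨π s s', hπ s s', k s s',
    hk s s'⟩) s
  have h0 : (0 : ℝ) ≤ γ := by linarith [hγ.1]
  have h1 := hγ.2
  set V := discountedValue P r γ with hV
  have hfix := bellman_discountedValue (P := P) (r := r) hP hr h0 h1
  obtain ⟨m, -, hm⟩ := Finset.exists_min_image Finset.univ V ⟨s, Finset.mem_univ s⟩
  obtain ⟨M, -, hM⟩ := Finset.exists_max_image Finset.univ V ⟨s, Finset.mem_univ s⟩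
  have hpm : 0 < p m M := hk m M
  have hkm := pow_mul_pow_sum_le_value (r := r) hP hr h0 h1 (hπ m M) (k m M) m
  have hQ : ∀ s, (Matrix.of fun x y => ∑ a, π m M x a * P x a y) s ∈ stdSimplex ℝ S := fun s => by
    refine ⟨fun y => Finset.sum_nonneg fun a _ =>
      mul_nonneg ((hπ m M s).1 a) ((hP s a).1 y), ?_⟩
    simp only [Matrix.of_apply]
    rw [Finset.sum_comm]
    simp only [← Finset.mul_sum, (hP _ _).2, mul_one, (hπ m M s).2]
  have hrow := pow_row_mem_stdSimplex hQ (k m M) m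
  have hsum : V m + p m M * (V M - V m) ≤
      ∑ y, ((Matrix.of fun x y => ∑ a, π m M x a * P x a y) ^ k m M) m y * V y := by
    have h2 : p m M * (V M - V m) ≤ ∑ y, ((Matrix.of fun x y =>
        ∑ a, π m M x a * P x a y) ^ k m M) m y * (V y - V m) :=
      Finset.single_le_sum (f := fun y => ((Matrix.of fun x y =>
        ∑ a, π m M x a * P x a y) ^ k m M) m y * (V y - V m))
        (fun y _ => mul_nonneg (hrow.1 y) (sub_nonneg.2 (hm y (Finset.mem_univ y))))
        (Finset.mem_univ M)
    simp only [sub_eq_add_neg (V _) (V m)] at h2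
    rw [stdSimplex_sum_add_const hrow] at h2
    linarith
  have hγk : 0 < γ ^ k m M := pow_pos (by linarith [hγ.1]) _
  have hbern : 1 + (k m M : ℝ) * (γ - 1) ≤ γ ^ k m M := by
    have := one_add_mul_le_pow (a := γ - 1) (by linarith) (k m M)
    simpa using this
  have hmnn := bellman_fixedPoint_nonneg hP hr h0 h1 hfix m
  have hmle := bellman_fixedPoint_le hP hr h0 h1 hfix m
  have hkey : γ ^ k m M * (p m M * (V M - V m)) ≤ k m M := by
    have h3 := (mul_le_mul_of_nonneg_left hsum hγk.le).trans hkm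
    have h4 : V m * (1 - γ ^ k m M) ≤ V m * (k m M * (1 - γ)) :=
      mul_le_mul_of_nonneg_left (by linarith) hmnn
    have h5 : (k m M : ℝ) * ((1 - γ) * V m) ≤ k m M * 1 :=
      mul_le_mul_of_nonneg_left hmle (Nat.cast_nonneg _)
    linarith
  have hspan : V M - V m ≤ k m M * 2 ^ k m M / p m M := by
    rw [le_div_iff₀ hpm]
    have h6 : (1 / 2 : ℝ) ^ k m M ≤ γ ^ k m M := pow_le_pow_left₀ (by norm_num) hγ.1 _
    have h7 : 0 ≤ p m M * (V M - V m) :=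
      mul_nonneg hpm.le (sub_nonneg.2 (hm M (Finset.mem_univ M)))
    have h8 := (mul_le_mul_of_nonneg_right h6 h7).trans hkey
    rw [one_div, inv_pow, inv_mul_le_iff₀ (by positivity)] at h8
    linarith
  calc V s' - V s ≤ V M - V m := sub_le_sub (hM s' (Finset.mem_univ s')) (hm s (Finset.mem_univ s))
    _ ≤ _ := hspan
    _ ≤ ∑ s', k m s' * 2 ^ k m s' / p m s' :=
      Finset.single_le_sum (f := fun s' => k m s' * 2 ^ k m s' / p m s') (fun s' _ => hCnn m s')
        (Finset.mem_univ M)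
    _ ≤ _ := Finset.single_le_sum (f := fun s => ∑ s', k s s' * 2 ^ k s s' / p s s')
        (fun s _ => Finset.sum_nonneg fun s' _ => hCnn s s') (Finset.mem_univ m)

/-- The limit exists because the function is rational near 1 and takes values in [0, 1]; only then
is the `limUnder` in `optGain` meaningful. -/
lemma Communicating.tendsto_optGain (hc : Communicating P) (hP : ∀ s a, P s a ∈ stdSimplex ℝ S)
    (hr : ∀ s a, r s a ∈ Set.Icc (0 : ℝ) 1) (ŝ : S) :
    Tendsto (fun γ => (1 - γ) * discountedValue P r γ ŝ) (𝓝[<] 1) (𝓝 (optGain P r ŝ)) := by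
  have hA := hc.nonempty_action ŝ
  obtain ⟨π, hπ⟩ := exists_eventually_discountedValue_eq (P := P) (r := r) hP hr
  have hm : MeromorphicAt (fun γ : ℝ => (1 - γ) *
      ((valueNum P r π ŝ).eval γ / (valueDen P π).eval γ)) 1 :=
    ((MeromorphicAt.const 1 1).fun_sub (MeromorphicAt.id 1)).fun_mul (meromorphicAt_value P r π ŝ 1)
  have heq : ∀ᶠ γ in 𝓝[<] (1 : ℝ), (1 - γ) * ((valueNum P r π ŝ).eval γ / (valueDen P π).eval γ)
      = (1 - γ) * discountedValue P r γ ŝ := hπ.mono fun γ h => by rw [h ŝ]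
  obtain ⟨c, hcl⟩ := exists_tendsto_of_meromorphicAt (C := 1) hm (by
    filter_upwards [heq, Ioo_mem_nhdsLT one_pos] with γ h ⟨h0, h1⟩
    have hfix := bellman_discountedValue (P := P) (r := r) hP hr h0.le h1
    rw [h, abs_of_nonneg (mul_nonneg (sub_nonneg.2 h1.le)
      (bellman_fixedPoint_nonneg hP hr h0.le h1 hfix ŝ))]
    exact bellman_fixedPoint_le hP hr h0.le h1 hfix ŝ)
  exact tendsto_nhds_limUnder ⟨c, hcl.congr' heq⟩

/-- As for `tendsto_optGain`, with boundedness now supplied by `exists_span_bound`. -/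
lemma Communicating.tendsto_relValue (hc : Communicating P) (hP : ∀ s a, P s a ∈ stdSimplex ℝ S)
    (hr : ∀ s a, r s a ∈ Set.Icc (0 : ℝ) 1) (ŝ s : S) :
    Tendsto (fun γ => discountedValue P r γ s - discountedValue P r γ ŝ) (𝓝[<] 1)
      (𝓝 (relValue P r ŝ s)) := by
  have hA := hc.nonempty_action ŝ
  obtain ⟨π, hπ⟩ := exists_eventually_discountedValue_eq (P := P) (r := r) hP hr
  obtain ⟨C, hC⟩ := hc.exists_span_bound (r := r) hP hr
  have hm : MeromorphicAt (fun γ : ℝ => (valueNum P r π s).eval γ / (valueDen P π).eval γ -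
      (valueNum P r π ŝ).eval γ / (valueDen P π).eval γ) 1 :=
    (meromorphicAt_value P r π s 1).fun_sub (meromorphicAt_value P r π ŝ 1)
  have heq : ∀ᶠ γ in 𝓝[<] (1 : ℝ), (valueNum P r π s).eval γ / (valueDen P π).eval γ -
      (valueNum P r π ŝ).eval γ / (valueDen P π).eval γ
      = discountedValue P r γ s - discountedValue P r γ ŝ := hπ.mono fun γ h => by rw [h ŝ, h s]
  obtain ⟨c, hcl⟩ := exists_tendsto_of_meromorphicAt (C := C) hm (by
    filter_upwards [heq, Ico_mem_nhdsLT (show (1 / 2 : ℝ) < 1 by norm_num)] with γ h hγ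
    rw [h, abs_sub_le_iff]
    exact ⟨hC γ hγ ŝ s, hC γ hγ s ŝ⟩)
  exact tendsto_nhds_limUnder ⟨c, hcl.congr' heq⟩

lemma Communicating.tendsto_qValue (hc : Communicating P) (hP : ∀ s a, P s a ∈ stdSimplex ℝ S)
    (hr : ∀ s a, r s a ∈ Set.Icc (0 : ℝ) 1) (ŝ s : S) (a : A) :
    Tendsto (fun γ => r s a + γ * ∑ s', P s a s' *
      (discountedValue P r γ s' - discountedValue P r γ ŝ)) (𝓝[<] 1) (𝓝 (qValue P r ŝ s a)) := by
  have h1 : Tendsto (fun γ : ℝ => γ) (𝓝[<] 1) (𝓝 1) := tendsto_id.mono_left nhdsWithin_le_nhds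
  have := (h1.mul (tendsto_finsetSum Finset.univ fun s' _ =>
    (hc.tendsto_relValue hP hr ŝ s').const_mul (P s a s'))).const_add (r s a)
  simpa [qValue] using this

lemma Communicating.tendsto_relValue_add_optGain (hc : Communicating P)
    (hP : ∀ s a, P s a ∈ stdSimplex ℝ S) (hr : ∀ s a, r s a ∈ Set.Icc (0 : ℝ) 1) (ŝ s : S) :
    Tendsto (fun γ => discountedValue P r γ s - γ * discountedValue P r γ ŝ) (𝓝[<] 1)
      (𝓝 (relValue P r ŝ s + optGain P r ŝ)) := by
  refine ((hc.tendsto_relValue hP hr ŝ s).add (hc.tendsto_optGain hP hr ŝ)).congr fun γ => ?_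
  ring

/-- The average-reward Bellman equation. -/
lemma Communicating.exists_qValue_eq (hc : Communicating P) (hP : ∀ s a, P s a ∈ stdSimplex ℝ S)
    (hr : ∀ s a, r s a ∈ Set.Icc (0 : ℝ) 1) (ŝ s : S) :
    (∀ a, qValue P r ŝ s a ≤ relValue P r ŝ s + optGain P r ŝ) ∧
      ∃ a, relValue P r ŝ s + optGain P r ŝ ≤ qValue P r ŝ s a := by
  have hA := hc.nonempty_action ŝ
  have hI : ∀ᶠ γ in 𝓝[<] (1 : ℝ), γ ∈ Set.Ioo (0 : ℝ) 1 := Ioo_mem_nhdsLT one_pos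
  have hshift : ∀ γ a, r s a + γ * ∑ s', P s a s' *
      (discountedValue P r γ s' - discountedValue P r γ ŝ) =
      r s a + γ * ∑ s', P s a s' * discountedValue P r γ s' - γ * discountedValue P r γ ŝ := by
    intro γ a
    simp only [sub_eq_add_neg _ (discountedValue P r γ ŝ)]
    rw [stdSimplex_sum_add_const (hP s a)]
    ring
  constructor
  · intro a
    refine le_of_tendsto_of_tendsto (hc.tendsto_qValue hP hr ŝ s a)
      (hc.tendsto_relValue_add_optGain hP hr ŝ s) ?_
    filter_upwards [hI] with γ ⟨h0, h1⟩
    have h2 := le_bellman (P := P) (r := r) (γ := γ) (discountedValue P r γ) s a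
    rw [bellman_discountedValue hP hr h0.le h1] at h2
    rw [hshift]
    linarith
  -- If all actions fell strictly short in the limit, then, being finitely many, they would all fall
  -- short at some γ < 1, against the discounted Bellman equation.
  · by_contra! hlt
    have hev := eventually_all.2 fun a => (hc.tendsto_qValue hP hr ŝ s a).eventually_lt
      (hc.tendsto_relValue_add_optGain hP hr ŝ s) (hlt a)
    obtain ⟨γ, hγ, h0, h1⟩ := (hev.and hI).exists
    obtain ⟨a, ha⟩ := exists_bellman_eq (P := P) (r := r) (γ := γ) (discountedValue P r γ) s
    rw [bellman_discountedValue hP hr h0.le h1] at ha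
    have h2 := hγ a
    rw [hshift] at h2
    linarith

lemma Communicating.optGain_mem (hc : Communicating P) (hP : ∀ s a, P s a ∈ stdSimplex ℝ S)
    (hr : ∀ s a, r s a ∈ Set.Icc (0 : ℝ) 1) (ŝ : S) : optGain P r ŝ ∈ Set.Icc (0 : ℝ) 1 := by
  have hA := hc.nonempty_action ŝ
  refine isClosed_Icc.mem_of_tendsto (hc.tendsto_optGain hP hr ŝ) ?_
  filter_upwards [Ioo_mem_nhdsLT one_pos] with γ ⟨h0, h1⟩
  have hfix := bellman_discountedValue (P := P) (r := r) hP hr h0.le h1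
  exact ⟨mul_nonneg (sub_nonneg.2 h1.le) (bellman_fixedPoint_nonneg hP hr h0.le h1 hfix ŝ),
    bellman_fixedPoint_le hP hr h0.le h1 hfix ŝ⟩

end Communicating

/-! ### Measurability in the parameter. -/

section Measurability

variable {S A Θ : Type*} [Fintype S] [DecidableEq S] [Fintype A] [MeasurableSpace Θ]
  (M : MDPFamily S A Θ)

/-- The supremum over policies need not be countable, so the value is obtained instead as the limit
of value iteration, whose iterates are finite maxima of measurable functions. -/
lemma measurable_discountedValue [Nonempty A] {γ : ℝ} (h0 : 0 ≤ γ) (h1 : γ < 1) (s : S) :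
    Measurable fun θ => discountedValue (M.P θ) M.r γ s := by
  refine measurable_of_tendsto_metrizable (f := fun n θ => ((bellman (M.P θ) M.r γ)^[n] 0) s)
    (fun n => ?_) (tendsto_pi_nhds.2 fun θ =>
      tendsto_bellman_iterate (M.P_mem θ) M.r_mem h0 h1 s)
  induction n generalizing s with
  | zero => exact measurable_const
  | succ n ih =>
    simp only [Function.iterate_succ_apply', bellman]
    have : ∀ a ∈ (Finset.univ : Finset A), Measurable fun θ => M.r s a + γ * ∑ s', M.P θ s a s' *
        ((bellman (M.P θ) M.r γ)^[n] 0) s' := fun a _ =>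
      ((Finset.measurable_fun_sum _ fun s' _ =>
        (M.P_measurable s a s').mul (ih s')).const_mul γ).const_add _
    convert Finset.measurable_sup' Finset.univ_nonempty this using 1
    ext θ
    rw [Finset.sup'_apply]

lemma exists_seq_tendsto_one :
    ∃ u : ℕ → ℝ, (∀ n, 0 ≤ u n) ∧ (∀ n, u n < 1) ∧ Tendsto u atTop (𝓝[<] 1) := by
  obtain ⟨u, -, hu, ht⟩ := exists_seq_strictMono_tendsto' (zero_lt_one (α := ℝ))
  exact ⟨u, fun n => (hu n).1.le, fun n => (hu n).2, tendsto_nhdsWithin_iff.2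
    ⟨ht, Eventually.of_forall fun n => (hu n).2⟩⟩

variable (hc : ∀ θ, Communicating (M.P θ)) (ŝ : S)
include hc

lemma measurable_optGain : Measurable fun θ => optGain (M.P θ) M.r ŝ := by
  obtain ⟨u, h0, h1, ht⟩ := exists_seq_tendsto_one
  rcases isEmpty_or_nonempty Θ with hΘ | ⟨⟨θ₀⟩⟩
  · exact measurable_of_empty _
  have hA := (hc θ₀).nonempty_action ŝ
  refine measurable_of_tendsto_metrizable
    (f := fun n θ => (1 - u n) * discountedValue (M.P θ) M.r (u n) ŝ)
    (fun n => (measurable_discountedValue M (h0 n) (h1 n) ŝ).const_mul _)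
    (tendsto_pi_nhds.2 fun θ => ((hc θ).tendsto_optGain (M.P_mem θ) M.r_mem ŝ).comp ht)

lemma measurable_relValue (s : S) : Measurable fun θ => relValue (M.P θ) M.r ŝ s := by
  obtain ⟨u, h0, h1, ht⟩ := exists_seq_tendsto_one
  rcases isEmpty_or_nonempty Θ with hΘ | ⟨⟨θ₀⟩⟩
  · exact measurable_of_empty _
  have hA := (hc θ₀).nonempty_action ŝ
  refine measurable_of_tendsto_metrizable (f := fun n θ =>
    discountedValue (M.P θ) M.r (u n) s - discountedValue (M.P θ) M.r (u n) ŝ)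
    (fun n => (measurable_discountedValue M (h0 n) (h1 n) s).sub
      (measurable_discountedValue M (h0 n) (h1 n) ŝ))
    (tendsto_pi_nhds.2 fun θ => ((hc θ).tendsto_relValue (M.P_mem θ) M.r_mem ŝ s).comp ht)

lemma measurable_qValue (s : S) (a : A) : Measurable fun θ => qValue (M.P θ) M.r ŝ s a :=
  (Finset.measurable_fun_sum _ fun s' _ => (M.P_measurable s a s').mul
    (measurable_relValue M hc ŝ s')).const_add _

lemma measurable_expertPolicy (β : ℝ) (s : S) (a : A) :
    Measurable fun θ => expertPolicy (M.P θ) M.r ŝ β s a := by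
  have h := fun a => ((measurable_qValue M hc ŝ s a).const_mul β).exp
  exact (h a).div (Finset.measurable_fun_sum _ fun a' _ => h a')

end Measurability

/-! ### Episode schedules. -/

section Schedule

variable {sched : ℕ → ℕ}

lemma episodeStart_zero : episodeStart sched 0 = 0 := by simp [episodeStart]

lemma episodeStart_one : episodeStart sched 1 = 0 := by simp [episodeStart]

lemma episodeStart_succ {k : ℕ} (hk : 1 ≤ k) :
    episodeStart sched (k + 1) = episodeStart sched k + sched k := by
  rw [episodeStart, Finset.sum_Ico_succ_top hk, episodeStart]

lemma episodeStart_mono : Monotone (episodeStart sched) := fun _ _ h =>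
  Finset.sum_le_sum_of_subset (Finset.Ico_subset_Ico_right h)

lemma one_le_episodeAt (t : ℕ) : 1 ≤ episodeAt sched t :=
  Nat.le_findGreatest (by omega) (by rw [episodeStart_one]; omega)

lemma episodeStart_episodeAt_le (t : ℕ) : episodeStart sched (episodeAt sched t) ≤ t :=
  Nat.findGreatest_spec (P := fun k => episodeStart sched k ≤ t) (n := t + 1) (Nat.zero_le _)
    (by rw [episodeStart_zero]; omega)

variable (hs : ∀ k, 1 ≤ k → 1 ≤ sched k)
include hs

/-- Episodes started by time t have index at most t + 1, so the search range in `episodeAt`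
truncates nothing. -/
lemma le_episodeStart_succ (k : ℕ) : k ≤ episodeStart sched (k + 1) := by
  induction k with
  | zero => omega
  | succ k ih =>
    rw [episodeStart_succ (by omega)]
    have := hs (k + 1) (by omega)
    omega

lemma lt_episodeStart_episodeAt_succ (t : ℕ) :
    t < episodeStart sched (episodeAt sched t + 1) := by
  by_contra! h
  have h1 := (le_episodeStart_succ hs _).trans h
  have h2 := Nat.le_findGreatest (P := fun k => episodeStart sched k ≤ t) (n := t + 1)
    (by omega) h
  change episodeAt sched t + 1 ≤ episodeAt sched t at h2
  omega

lemma episodeAt_eq {t k : ℕ} (h1 : episodeStart sched k ≤ t) (h2 : t < episodeStart sched (k + 1)) :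
    episodeAt sched t = k := by
  have h3 := lt_episodeStart_episodeAt_succ hs t
  have h4 := episodeStart_episodeAt_le (sched := sched) t
  by_contra hne
  rcases lt_or_gt_of_ne hne with h | h
  · have := episodeStart_mono (sched := sched) (show episodeAt sched t + 1 ≤ k by omega)
    omega
  · have := episodeStart_mono (sched := sched) (show k + 1 ≤ episodeAt sched t by omega)
    omega

lemma episodeAt_succ_of_ne {n : ℕ} (h : episodeStart sched (episodeAt sched (n + 1)) ≠ n + 1) :
    episodeAt sched (n + 1) = episodeAt sched n := by
  have h1 := episodeStart_episodeAt_le (sched := sched) (n + 1)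
  have h2 := lt_episodeStart_episodeAt_succ hs (n + 1)
  exact (episodeAt_eq hs (by omega) (by omega)).symm

end Schedule

/-! ### A class of functions that are integrable for every finite measure. -/

section Bounded

/-- Bounded measurable functions. -/
def BddMeas {α : Type*} [MeasurableSpace α] (f : α → ℝ) : Prop :=
  Measurable f ∧ ∃ C, ∀ x, |f x| ≤ C

namespace BddMeas

variable {α γ ι : Type*} [MeasurableSpace α] [MeasurableSpace γ] {f g : α → ℝ}

lemma const (c : ℝ) : BddMeas fun _ : α => c := ⟨measurable_const, |c|, fun _ => le_rfl⟩

lemma add (hf : BddMeas f) (hg : BddMeas g) : BddMeas fun x => f x + g x := by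
  obtain ⟨C, hC⟩ := hf.2
  obtain ⟨C', hC'⟩ := hg.2
  exact ⟨hf.1.add hg.1, C + C', fun x => (abs_add_le _ _).trans (add_le_add (hC x) (hC' x))⟩

lemma mul (hf : BddMeas f) (hg : BddMeas g) : BddMeas fun x => f x * g x := by
  obtain ⟨C, hC⟩ := hf.2
  obtain ⟨C', hC'⟩ := hg.2
  refine ⟨hf.1.mul hg.1, C * C', fun x => ?_⟩
  rw [abs_mul]
  exact mul_le_mul (hC x) (hC' x) (abs_nonneg _) ((abs_nonneg _).trans (hC x))

lemma const_mul (c : ℝ) (hf : BddMeas f) : BddMeas fun x => c * f x := (const c).mul hf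

lemma sub (hf : BddMeas f) (hg : BddMeas g) : BddMeas fun x => f x - g x := by
  simpa [sub_eq_add_neg] using hf.add (hg.const_mul (-1))

lemma sum (s : Finset ι) {F : ι → α → ℝ} (h : ∀ i ∈ s, BddMeas (F i)) :
    BddMeas fun x => ∑ i ∈ s, F i x := by
  classical
  induction s using Finset.induction_on with
  | empty => simpa using const (0 : ℝ)
  | insert a s ha ih =>
    simp only [Finset.sum_insert ha]
    exact (h a (Finset.mem_insert_self a s)).add
      (ih fun i hi => h i (Finset.mem_insert_of_mem hi))

lemma prod (s : Finset ι) {F : ι → α → ℝ} (h : ∀ i ∈ s, BddMeas (F i)) :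
    BddMeas fun x => ∏ i ∈ s, F i x := by
  classical
  induction s using Finset.induction_on with
  | empty => simpa using const (1 : ℝ)
  | insert a s ha ih =>
    simp only [Finset.prod_insert ha]
    exact (h a (Finset.mem_insert_self a s)).mul
      (ih fun i hi => h i (Finset.mem_insert_of_mem hi))

lemma comp (hf : BddMeas f) {φ : γ → α} (hφ : Measurable φ) : BddMeas fun x => f (φ x) := by
  obtain ⟨C, hC⟩ := hf.2
  exact ⟨hf.1.comp hφ, C, fun x => hC _⟩

lemma ite {p : α → Prop} [DecidablePred p] (hp : MeasurableSet {x | p x}) (hf : BddMeas f)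
    (hg : BddMeas g) : BddMeas fun x => if p x then f x else g x := by
  obtain ⟨C, hC⟩ := hf.2
  obtain ⟨C', hC'⟩ := hg.2
  refine ⟨Measurable.ite hp hf.1 hg.1, max C C', fun x => ?_⟩
  dsimp only
  split_ifs
  · exact (hC x).trans (le_max_left _ _)
  · exact (hC' x).trans (le_max_right _ _)

lemma of_mem_Icc (hf : Measurable f) {a b : ℝ} (h : ∀ x, f x ∈ Set.Icc a b) : BddMeas f :=
  ⟨hf, max |a| |b|, fun x => abs_le_max_abs_abs (h x).1 (h x).2⟩

lemma integrable (hf : BddMeas f) (μ : Measure α) [IsFiniteMeasure μ] : Integrable f μ := by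
  obtain ⟨C, hC⟩ := hf.2
  exact Integrable.of_bound hf.1.aestronglyMeasurable C (Eventually.of_forall fun x => hC x)

lemma integral_right {f : α × γ → ℝ} (hf : BddMeas f) (μ : Measure γ) [IsFiniteMeasure μ] :
    BddMeas fun x => ∫ y, f (x, y) ∂μ := by
  obtain ⟨C, hC⟩ := hf.2
  refine ⟨(hf.1.stronglyMeasurable.integral_prod_right' (ν := μ)).measurable, C * μ.real Set.univ,
    fun x => ?_⟩
  exact norm_integral_le_of_norm_le_const (f := fun y => f (x, y)) (Eventually.of_forall fun y => hC (x, y))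

end BddMeas

end Bounded

/-! ### Bayes' rule. -/

section Bayes

variable {Θ : Type*} [MeasurableSpace Θ] {μ : Measure Θ} {L f : Θ → ℝ}

lemma toReal_lintegral_ofReal (hL : Measurable L) (h0 : ∀ θ, 0 ≤ L θ) :
    (∫⁻ θ, ENNReal.ofReal (L θ) ∂μ).toReal = ∫ θ, L θ ∂μ :=
  (integral_eq_lintegral_of_nonneg_ae (Eventually.of_forall h0) hL.aestronglyMeasurable).symm

lemma integral_withDensity_ofReal (hL : Measurable L) (h0 : ∀ θ, 0 ≤ L θ) (f : Θ → ℝ) :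
    ∫ θ, f θ ∂μ.withDensity (fun θ => ENNReal.ofReal (L θ)) = ∫ θ, L θ * f θ ∂μ := by
  rw [integral_withDensity_eq_integral_toReal_smul hL.ennreal_ofReal
    (Eventually.of_forall fun _ => ENNReal.ofReal_lt_top)]
  refine integral_congr_ae (Eventually.of_forall fun θ => ?_)
  simp [ENNReal.toReal_ofReal (h0 θ)]

lemma isFiniteMeasure_withDensity_of_bddMeas [IsFiniteMeasure μ] (hL : BddMeas L) :
    IsFiniteMeasure (μ.withDensity fun θ => ENNReal.ofReal (L θ)) :=
  isFiniteMeasure_withDensity_ofReal (hL.integrable μ).2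

lemma lintegral_ofReal_ne_top [IsFiniteMeasure μ] (hL : BddMeas L) :
    ∫⁻ θ, ENNReal.ofReal (L θ) ∂μ ≠ ⊤ :=
  ((hL.integrable μ).lintegral_lt_top).ne

lemma isProbabilityMeasure_bayesUpdate [IsProbabilityMeasure μ] (hL : BddMeas L) :
    IsProbabilityMeasure (bayesUpdate μ L) := by
  rw [bayesUpdate]
  split_ifs with h
  · infer_instance
  · refine ⟨?_⟩
    rw [Measure.smul_apply, withDensity_apply _ MeasurableSet.univ, Measure.restrict_univ,
      smul_eq_mul]
    exact ENNReal.inv_mul_cancel h (lintegral_ofReal_ne_top hL)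

/-- Bayes' formula. -/
lemma integral_mul_eq_bayesUpdate [IsProbabilityMeasure μ] (hL : BddMeas L) (h0 : ∀ θ, 0 ≤ L θ)
    (f : Θ → ℝ) : ∫ θ, L θ * f θ ∂μ = (∫ θ, L θ ∂μ) * ∫ θ, f θ ∂bayesUpdate μ L := by
  rw [bayesUpdate]
  split_ifs with h
  -- When the normalizing constant is zero both sides vanish, whatever the convention for the
  -- posterior.
  · have h1 : ∀ᵐ θ ∂μ, L θ = 0 := by
      rw [lintegral_eq_zero_iff hL.1.ennreal_ofReal] at h
      filter_upwards [h] with θ hθ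
      exact le_antisymm (ENNReal.ofReal_eq_zero.1 hθ) (h0 θ)
    rw [integral_congr_ae (g := fun _ => 0) (by filter_upwards [h1] with θ hθ; simp [hθ]),
      integral_congr_ae (f := L) (g := fun _ => 0) h1]
    simp
  · rw [integral_smul_measure, integral_withDensity_ofReal hL.1 h0, ENNReal.toReal_inv,
      toReal_lintegral_ofReal hL.1 h0, smul_eq_mul, mul_inv_cancel_left₀]
    rw [← toReal_lintegral_ofReal hL.1 h0]
    exact ENNReal.toReal_ne_zero.2 ⟨h, lintegral_ofReal_ne_top hL⟩

end Bayes

/-! ### Extending a sequence of records. -/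

section Push

variable {S A : Type*}

/-- Appending one record to a sequence of records. -/
def push {n : ℕ} (h : Fin n → Rec S A) (y : Rec S A) : Fin (n + 1) → Rec S A :=
  Fin.snoc (α := fun _ => Rec S A) h y

@[simp] lemma push_castSucc {n : ℕ} (h : Fin n → Rec S A) (y : Rec S A) (i : Fin n) :
    push h y i.castSucc = h i := Fin.snoc_castSucc (α := fun _ => Rec S A) y h i

@[simp] lemma push_last {n : ℕ} (h : Fin n → Rec S A) (y : Rec S A) :
    push h y (Fin.last n) = y := Fin.snoc_last (α := fun _ => Rec S A) y h

/-- The last policy does not affect the recorded states. Hence the belief from which a policy is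
drawn does not depend on the outcome of the draw. -/
lemma push_fst_congr {n : ℕ} (h : Fin n → Rec S A) (s : S) (π π' : S → A) (i : Fin (n + 1)) :
    (push h (s, π) i).1 = (push h (s, π') i).1 := by
  induction i using Fin.lastCases <;> simp

/-- The state-action pair of a record. -/
def Rec.pair (x : Rec S A) : S × A := (x.1, x.2 x.1)

variable [Fintype S] [DecidableEq S] [Fintype A]

lemma sum_push {n : ℕ} (G : (Fin (n + 1) → Rec S A) → ℝ) :
    ∑ h, G h = ∑ h : Fin n → Rec S A, ∑ s, ∑ π, G (push h (s, π)) := by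
  rw [← (Fin.snocEquiv fun _ : Fin (n + 1) => Rec S A).sum_comp, Fintype.sum_prod_type_right]
  refine Finset.sum_congr rfl fun h _ => ?_
  rw [Fintype.sum_prod_type]
  rfl

end Push

/-! ### Beliefs and trajectory probabilities. -/

/-- The data of the Bayesian problem: environments, prior, expert, planning oracle, schedule. -/
structure Scenario (S A Θ : Type*) [Fintype S] [DecidableEq S] [Fintype A] [DecidableEq A]
    [MeasurableSpace Θ] where
  M : MDPFamily S A Θ
  communicating : ∀ θ, Communicating (M.P θ)
  ŝ : S
  β : ℝ
  μ₀ : Measure Θ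
  isProbabilityMeasure : IsProbabilityMeasure μ₀
  s₀ : S
  solve : Θ → S → A
  oracle : IsPlanningOracle M ŝ solve
  sched : ℕ → ℕ
  sched_pos : ∀ k, 1 ≤ k → 1 ≤ sched k

attribute [instance] Scenario.isProbabilityMeasure

namespace Scenario

variable {S A Θ : Type*} [Fintype S] [DecidableEq S] [Fintype A] [DecidableEq A]
  [MeasurableSpace Θ] (R : Scenario S A Θ) {N : ℕ} (D : Offline S A N)

/-- The probability of the transition between two consecutive records. -/
def stepProb {n : ℕ} (h : Fin (n + 1) → Rec S A) (i : Fin n) (θ : Θ) : ℝ :=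
  R.M.P θ (h i.castSucc).1 ((h i.castSucc).2 (h i.castSucc).1) (h i.succ).1

lemma stepProb_nonneg {n : ℕ} (h : Fin (n + 1) → Rec S A) (i : Fin n) (θ : Θ) :
    0 ≤ R.stepProb h i θ := (R.M.P_mem θ _ _).1 _

lemma bddMeas_P (s : S) (a : A) (s' : S) : BddMeas fun θ => R.M.P θ s a s' :=
  BddMeas.of_mem_Icc (R.M.P_measurable s a s') fun θ =>
    ⟨(R.M.P_mem θ s a).1 s', stdSimplex_le_one (R.M.P_mem θ s a) s'⟩

lemma bddMeas_stepProb {n : ℕ} (h : Fin (n + 1) → Rec S A) (i : Fin n) :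
    BddMeas (R.stepProb h i) := R.bddMeas_P _ _ _

lemma nonempty_action (R : Scenario S A Θ) : Nonempty A := ⟨R.solve (R.μ₀.nonempty_of_neZero).some R.ŝ⟩

lemma expertPolicy_mem (θ : Θ) (s : S) :
    expertPolicy (R.M.P θ) R.M.r R.ŝ R.β s ∈ stdSimplex ℝ A := by
  have := R.nonempty_action
  have hpos : 0 < ∑ a', Real.exp (R.β * qValue (R.M.P θ) R.M.r R.ŝ s a') :=
    Finset.sum_pos (fun _ _ => Real.exp_pos _) Finset.univ_nonempty
  refine ⟨fun a => div_nonneg (Real.exp_pos _).le hpos.le, ?_⟩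
  simp only [expertPolicy]
  rw [← Finset.sum_div, div_self hpos.ne']

lemma bddMeas_expertPolicy (s : S) (a : A) :
    BddMeas fun θ => expertPolicy (R.M.P θ) R.M.r R.ŝ R.β s a :=
  BddMeas.of_mem_Icc (measurable_expertPolicy R.M R.communicating R.ŝ R.β s a) fun θ =>
    ⟨(R.expertPolicy_mem θ s).1 a, stdSimplex_le_one (R.expertPolicy_mem θ s) a⟩

lemma offlineLik_nonneg (θ : Θ) : 0 ≤ offlineLik R.M R.ŝ R.β D θ :=
  Finset.prod_nonneg fun _ _ => mul_nonneg ((R.M.P_mem θ _ _).1 _) ((R.expertPolicy_mem θ _).1 _)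

lemma bddMeas_offlineLik : BddMeas (offlineLik R.M R.ŝ R.β D) :=
  BddMeas.prod _ fun _ _ => (R.bddMeas_P _ _ _).mul (R.bddMeas_expertPolicy _ _)

lemma episodeLik_eq {n : ℕ} (h : Fin (n + 1) → Rec S A) (k : ℕ) (θ : Θ) :
    episodeLik R.M R.sched h k θ = ∏ i : Fin n,
      if episodeStart R.sched k ≤ i.1 ∧ i.1 < episodeStart R.sched (k + 1) then R.stepProb h i θ
      else 1 := by
  rw [episodeLik, Finset.prod_filter]
  rfl

lemma episodeLik_nonneg {n : ℕ} (h : Fin (n + 1) → Rec S A) (k : ℕ) (θ : Θ) :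
    0 ≤ episodeLik R.M R.sched h k θ :=
  Finset.prod_nonneg fun i _ => R.stepProb_nonneg h i θ

lemma bddMeas_episodeLik {n : ℕ} (h : Fin (n + 1) → Rec S A) (k : ℕ) :
    BddMeas (episodeLik R.M R.sched h k) :=
  BddMeas.prod _ fun i _ => R.bddMeas_stepProb h i

/-- The belief after the episodes before `k`. -/
noncomputable def belief {n : ℕ} (h : Fin (n + 1) → Rec S A) (k : ℕ) : Measure Θ :=
  posterior R.M R.ŝ R.β R.μ₀ R.sched D h k

/-- The likelihood of the offline data and of the transitions before the episode `k`. -/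
noncomputable def likBefore {n : ℕ} (h : Fin (n + 1) → Rec S A) (k : ℕ) (θ : Θ) : ℝ :=
  offlineLik R.M R.ŝ R.β D θ *
    ∏ i : Fin n, if i.1 < episodeStart R.sched k then R.stepProb h i θ else 1

lemma likBefore_succ {n : ℕ} (h : Fin (n + 1) → Rec S A) (k : ℕ) (θ : Θ) :
    R.likBefore D h (k + 1) θ = R.likBefore D h k θ * episodeLik R.M R.sched h k θ := by
  rw [likBefore, likBefore, episodeLik_eq, mul_assoc, ← Finset.prod_mul_distrib]
  congr 1
  refine Finset.prod_congr rfl fun i _ => ?_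
  have := episodeStart_mono (sched := R.sched) (show k ≤ k + 1 by omega)
  split_ifs <;> first | omega | simp

/-- Bayes' formula iterated over the episodes. Keeping the normalizing constant as a factor, instead
of dividing by it, covers data of probability zero. -/
lemma belief_spec {n : ℕ} (h : Fin (n + 1) → Rec S A) (k : ℕ) :
    IsProbabilityMeasure (R.belief D h (k + 1)) ∧ ∀ f, BddMeas f →
      ∫ θ, R.likBefore D h (k + 1) θ * f θ ∂(R.μ₀) =
        (∫ θ, R.likBefore D h (k + 1) θ ∂(R.μ₀)) * ∫ θ, f θ ∂(R.belief D h (k + 1)) := by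
  induction k with
  | zero =>
    have h1 : R.likBefore D h (0 + 1) = offlineLik R.M R.ŝ R.β D := by
      ext θ
      simp [likBefore, episodeStart_one]
    refine ⟨isProbabilityMeasure_bayesUpdate (R.bddMeas_offlineLik D), fun f _ => ?_⟩
    rw [h1]
    exact integral_mul_eq_bayesUpdate (R.bddMeas_offlineLik D) (R.offlineLik_nonneg D) f
  | succ k ih =>
    obtain ⟨hp, ih⟩ := ih
    have hb := R.bddMeas_episodeLik h (k + 1)
    refine ⟨isProbabilityMeasure_bayesUpdate (μ := R.belief D h (k + 1)) hb, fun f hf => ?_⟩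
    have h1 := ih _ (hb.mul hf)
    have h2 := ih _ hb
    have h3 := integral_mul_eq_bayesUpdate (μ := R.belief D h (k + 1)) hb
      (R.episodeLik_nonneg h (k + 1)) f
    simp only [R.likBefore_succ D h (k + 1), mul_assoc]
    rw [h1, h2, h3, mul_assoc]
    rfl

lemma episodeLik_push {n : ℕ} (h : Fin (n + 1) → Rec S A) (y : Rec S A) {k : ℕ}
    (hk : episodeStart R.sched (k + 1) ≤ n) :
    episodeLik R.M R.sched (push h y) k = episodeLik R.M R.sched h k := by
  ext θ
  rw [episodeLik_eq, episodeLik_eq, Fin.prod_univ_castSucc]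
  have h1 : ¬ (episodeStart R.sched k ≤ n ∧ n < episodeStart R.sched (k + 1)) := by omega
  simp only [Fin.val_castSucc, Fin.val_last, if_neg h1, mul_one]
  refine Finset.prod_congr rfl fun i _ => ?_
  simp only [stepProb, push_castSucc, Fin.succ_castSucc]

/-- A belief uses only the transitions that precede the start of its episode, so later records leave
it unchanged. -/
lemma belief_push {n : ℕ} (h : Fin (n + 1) → Rec S A) (y : Rec S A) (k : ℕ)
    (hk : episodeStart R.sched k ≤ n) : R.belief D (push h y) k = R.belief D h k := by
  induction k with
  | zero => rfl
  | succ k ih =>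
    have h1 := (episodeStart_mono (sched := R.sched) (show k ≤ k + 1 by omega)).trans hk
    cases k with
    | zero => rfl
    | succ k =>
      change bayesUpdate (R.belief D (push h y) (k + 1)) _ = bayesUpdate (R.belief D h (k + 1)) _
      rw [ih h1, R.episodeLik_push h y hk]

lemma belief_push_congr {n : ℕ} (h : Fin n → Rec S A) (s : S) (π π' : S → A) (k : ℕ) :
    R.belief D (push h (s, π)) k = R.belief D (push h (s, π')) k := by
  induction k with
  | zero => rfl
  | succ k ih =>
    cases k with
    | zero => rfl
    | succ k =>
      have h1 : episodeLik R.M R.sched (push h (s, π)) (k + 1)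
          = episodeLik R.M R.sched (push h (s, π')) (k + 1) := by
        ext θ
        simp only [episodeLik, push_castSucc, push_fst_congr h s π π']
      change bayesUpdate (R.belief D (push h (s, π)) (k + 1)) _
        = bayesUpdate (R.belief D (push h (s, π')) (k + 1)) _
      rw [ih, h1]

/-- The belief in use at the last time of the records `h`. -/
noncomputable def post {n : ℕ} (h : Fin (n + 1) → Rec S A) : Measure Θ :=
  R.belief D h (episodeAt R.sched n)

instance isProbabilityMeasure_post {n : ℕ} (h : Fin (n + 1) → Rec S A) :
    IsProbabilityMeasure (R.post D h) := by
  obtain ⟨k, hk⟩ := Nat.exists_eq_add_of_le' (one_le_episodeAt (sched := R.sched) n)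
  rw [post, hk]
  exact (R.belief_spec D h k).1

/-- The times at which an episode starts. -/
def IsStart (n : ℕ) : Prop := episodeStart R.sched (episodeAt R.sched n) = n

instance (n : ℕ) : Decidable (R.IsStart n) := inferInstanceAs (Decidable (_ = _))

lemma isStart_zero : R.IsStart 0 :=
  Nat.le_zero.1 (episodeStart_episodeAt_le (sched := R.sched) 0)

lemma episodeAt_succ {n : ℕ} (hn : ¬ R.IsStart (n + 1)) :
    episodeAt R.sched (n + 1) = episodeAt R.sched n := episodeAt_succ_of_ne R.sched_pos hn

lemma post_push {n : ℕ} (hn : ¬ R.IsStart (n + 1)) (h : Fin (n + 1) → Rec S A) (y : Rec S A) :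
    R.post D (push h y) = R.post D h := by
  rw [post, R.episodeAt_succ hn, R.belief_push D h y _ (episodeStart_episodeAt_le n), post]

lemma post_push_congr {n : ℕ} (h : Fin n → Rec S A) (s : S) (π π' : S → A) :
    R.post D (push h (s, π)) = R.post D (push h (s, π')) := R.belief_push_congr D h s π π' _

/-- Probability of the records in the environment `θ`, given the offline data. -/
noncomputable def traj {n : ℕ} (h : Fin (n + 1) → Rec S A) (θ : Θ) : ℝ :=
  trajProb R.M R.ŝ R.β R.μ₀ R.solve R.sched D θ n h

lemma traj_zero (h : Fin 0 → Rec S A) (s : S) (π : S → A) (θ : Θ) :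
    R.traj D (push h (s, π)) θ
      = R.M.ν s * (R.post D (push h (s, π))).real {θ' | R.solve θ' = π} := by
  rw [traj, trajProb]
  have h1 : push h (s, π) 0 = (s, π) := push_last h (s, π)
  rw [h1, sampleProb, push_last]
  rfl

lemma traj_succ {n : ℕ} (h : Fin (n + 1) → Rec S A) (s : S) (π : S → A) (θ : Θ) :
    R.traj D (push h (s, π)) θ =
      R.traj D h θ * R.M.P θ (h (Fin.last n)).1 ((h (Fin.last n)).2 (h (Fin.last n)).1) s *
        if R.IsStart (n + 1) then (R.post D (push h (s, π))).real {θ' | R.solve θ' = π}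
        else if π = (h (Fin.last n)).2 then 1 else 0 := by
  rw [traj, trajProb]
  simp only [push_castSucc, push_last, sampleProb]
  rfl

lemma sum_post {n : ℕ} (h : Fin (n + 1) → Rec S A) (f : Θ → ℝ) (hf : BddMeas f) :
    ∑ π, ∫ θ in {θ | R.solve θ = π}, f θ ∂(R.post D h) = ∫ θ, f θ ∂(R.post D h) := by
  rw [← integral_iUnion_fintype (fun π => R.oracle.measurable π) (fun π π' hne => ?_)
    (fun π => (hf.integrable _).integrableOn)]
  · rw [show ⋃ π, {θ | R.solve θ = π} = Set.univ from Set.iUnion_eq_univ_iff.2 fun θ => ⟨_, rfl⟩,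
      Measure.restrict_univ]
  · exact Set.disjoint_left.2 fun θ h1 h2 => hne (h1.symm.trans h2)

end Scenario

/-! ### The joint law of the records, the true parameter and the sampled parameter. -/

namespace Scenario

variable {S A Θ : Type*} [Fintype S] [DecidableEq S] [Fintype A] [DecidableEq A]
  [MeasurableSpace Θ] (R : Scenario S A Θ) {N : ℕ} (D : Offline S A N)

lemma sum_post_real {n : ℕ} (h : Fin (n + 1) → Rec S A) :
    ∑ π, (R.post D h).real {θ | R.solve θ = π} = 1 := by
  have := R.sum_post D h (fun _ => 1) (BddMeas.const 1)
  simpa using this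

/-- The factor V collects all that happens before the new policy is drawn. -/
lemma traj_start {n : ℕ} (hn : R.IsStart n) : ∃ V : (Fin n → Rec S A) → S → Θ → ℝ,
    (∀ h s, BddMeas (V h s)) ∧ ∀ h s π θ, R.traj D (push h (s, π)) θ
      = V h s θ * (R.post D (push h (s, π))).real {θ' | R.solve θ' = π} := by
  cases n with
  | zero => exact ⟨fun _ s _ => R.M.ν s, fun _ _ => BddMeas.const _, R.traj_zero D⟩
  | succ n =>
    have hb : ∀ m (h : Fin (m + 1) → Rec S A), BddMeas (R.traj D h) := by
      intro m
      induction m with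
      | zero =>
        intro h
        rw [← Fin.snoc_init_self h]
        exact (BddMeas.const _).mul (BddMeas.const _)
      | succ m ih =>
        intro h
        exact ((ih _).mul (R.bddMeas_P _ _ _)).mul (BddMeas.const _)
    refine ⟨fun h s θ => R.traj D h θ *
      R.M.P θ (h (Fin.last n)).1 ((h (Fin.last n)).2 (h (Fin.last n)).1) s,
      fun h s => (hb n h).mul (R.bddMeas_P _ _ _), fun h s π θ => ?_⟩
    rw [traj_succ, if_pos hn]

lemma bddMeas_traj {n : ℕ} (h : Fin (n + 1) → Rec S A) : BddMeas (R.traj D h) := by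
  induction n with
  | zero =>
    exact (BddMeas.const _).mul (BddMeas.const _)
  | succ n ih => exact ((ih _).mul (R.bddMeas_P _ _ _)).mul (BddMeas.const _)

lemma traj_nonneg {n : ℕ} (h : Fin (n + 1) → Rec S A) (θ : Θ) : 0 ≤ R.traj D h θ := by
  induction n with
  | zero => exact mul_nonneg (R.M.ν_mem.1 _) measureReal_nonneg
  | succ n ih =>
    refine mul_nonneg (mul_nonneg (ih _) ((R.M.P_mem θ _ _).1 _)) ?_
    split_ifs
    exacts [measureReal_nonneg, zero_le_one, le_rfl]

/-- The agent draws policies from the data alone, so the true parameter enters only through the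
transitions. This is why Bayes' rule with the transition likelihoods alone gives the right
conditional law. -/
lemma exists_traj_eq_mul {n : ℕ} (h : Fin (n + 1) → Rec S A) :
    ∃ c : ℝ, ∀ θ, R.traj D h θ = c * ∏ i, R.stepProb h i θ := by
  induction n with
  | zero => exact ⟨R.traj D h (R.μ₀.nonempty_of_neZero).some, fun θ => by simp [traj, trajProb]⟩
  | succ n ih =>
    obtain ⟨c, hc⟩ := ih fun i => h i.castSucc
    refine ⟨c * if R.IsStart (n + 1) then sampleProb R.M R.ŝ R.β R.μ₀ R.solve R.sched D h
      else if (h (Fin.last (n + 1))).2 = (h (Fin.last n).castSucc).2 then 1 else 0, fun θ => ?_⟩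
    rw [Fin.prod_univ_castSucc, mul_right_comm, ← mul_assoc]
    exact congrArg₂ _ (congrArg₂ _ (hc θ) rfl) rfl

/-- Marginalizing over the policy in use. -/
lemma sum_traj_succ {n : ℕ} (h : Fin (n + 1) → Rec S A) (s : S) (θ : Θ) :
    ∑ π, R.traj D (push h (s, π)) θ = R.traj D h θ *
      R.M.P θ (h (Fin.last n)).1 ((h (Fin.last n)).2 (h (Fin.last n)).1) s := by
  simp only [traj_succ, ← Finset.mul_sum]
  split_ifs
  · have : ∀ π, R.post D (push h (s, π)) = R.post D (push h (s, (h (Fin.last n)).2)) :=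
      fun π => R.post_push_congr D h s _ _
    simp only [this, R.sum_post_real, mul_one]
  · simp

lemma sum_traj (n : ℕ) (θ : Θ) : ∑ h : Fin (n + 1) → Rec S A, R.traj D h θ = 1 := by
  induction n with
  | zero =>
    rw [sum_push]
    have h1 : ∀ (h : Fin 0 → Rec S A) (s : S) (π π' : S → A), R.post D (push h (s, π))
      = R.post D (push h (s, π')) := R.post_push_congr D
    have h2 : ∀ (h : Fin 0 → Rec S A) s, ∑ π, R.traj D (push h (s, π)) θ = R.M.ν s := by
      intro h s
      have := R.nonempty_action
      simp only [traj_zero, ← Finset.mul_sum, h1 h s _ (Classical.arbitrary _), R.sum_post_real,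
        mul_one]
    simp [h2, R.M.ν_mem.2]
  | succ n ih =>
    rw [sum_push]
    simp only [sum_traj_succ, ← Finset.mul_sum, (R.M.P_mem _ _ _).2, mul_one, ih]

/-- Makes `sampler` harmless on null events: conditioning there gives the zero measure, but the
records have probability zero as well. -/
lemma traj_eq_zero_of_post {n : ℕ} (h : Fin (n + 1) → Rec S A)
    (h0 : (R.post D h).real {θ' | R.solve θ' = (h (Fin.last n)).2} = 0) (θ : Θ) :
    R.traj D h θ = 0 := by
  induction n with
  | zero => exact mul_eq_zero_of_right _ h0
  | succ n ih =>
    obtain ⟨h, ⟨s, π⟩, rfl⟩ : ∃ h' y, h = push h' y := ⟨_, _, (Fin.snoc_init_self h).symm⟩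
    rw [push_last] at h0
    rw [traj_succ]
    split_ifs with h1 h2
    · rw [h0, mul_zero]
    · rw [R.post_push D h1, h2] at h0
      rw [ih h h0, zero_mul, zero_mul]
    · rw [mul_zero]

/-- The prior weighted by the probability of the offline data. -/
noncomputable def prior : Measure Θ :=
  R.μ₀.withDensity fun θ => ENNReal.ofReal (offlineProb R.M R.ŝ R.β R.s₀ θ D)

lemma offlineProb_nonneg (θ : Θ) : 0 ≤ offlineProb R.M R.ŝ R.β R.s₀ θ D := by
  rw [offlineProb]
  split_ifs
  exacts [R.offlineLik_nonneg D θ, le_rfl]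

lemma bddMeas_offlineProb : BddMeas fun θ => offlineProb R.M R.ŝ R.β R.s₀ θ D := by
  simp only [offlineProb]
  split_ifs
  exacts [R.bddMeas_offlineLik D, BddMeas.const 0]

instance isFiniteMeasure_prior : IsFiniteMeasure (R.prior D) :=
  isFiniteMeasure_withDensity_of_bddMeas (R.bddMeas_offlineProb D)

lemma integral_prior (f : Θ → ℝ) :
    ∫ θ, f θ ∂(R.prior D) = ∫ θ, offlineProb R.M R.ŝ R.β R.s₀ θ D * f θ ∂(R.μ₀) :=
  integral_withDensity_ofReal (R.bddMeas_offlineProb D).1 (R.offlineProb_nonneg D) f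

/-- At the start of an episode the belief is the conditional law of the true parameter. -/
lemma integral_traj_mul {n : ℕ} (hn : R.IsStart n) (h : Fin (n + 1) → Rec S A) {f : Θ → ℝ}
    (hf : BddMeas f) : ∫ θ, R.traj D h θ * f θ ∂(R.prior D)
      = (∫ θ, R.traj D h θ ∂(R.prior D)) * ∫ θ, f θ ∂(R.post D h) := by
  obtain ⟨c, hc⟩ := R.exists_traj_eq_mul D h
  obtain ⟨k, hk⟩ := Nat.exists_eq_add_of_le' (one_le_episodeAt (sched := R.sched) n)
  simp only [integral_prior, offlineProb]
  split_ifs with h0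
  -- Episode k + 1 starts at time n, so `likBefore` contains all n recorded transitions.
  · have hL : ∀ θ, offlineLik R.M R.ŝ R.β D θ * R.traj D h θ = c * R.likBefore D h (k + 1) θ := by
      intro θ
      rw [IsStart, hk] at hn
      simp only [hc, likBefore, hn, Fin.is_lt, if_true]
      ring
    simp only [← mul_assoc, hL]
    simp only [mul_assoc, integral_const_mul]
    rw [(R.belief_spec D h k).2 f hf, post, hk]
  · simp

/-- The law of the sampled parameter in use, given the records. -/
noncomputable def sampler {n : ℕ} (h : Fin (n + 1) → Rec S A) : Measure Θ :=
  ProbabilityTheory.cond (R.post D h) {θ' | R.solve θ' = (h (Fin.last n)).2}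

instance isFiniteMeasure_sampler {n : ℕ} (h : Fin (n + 1) → Rec S A) :
    IsFiniteMeasure (R.sampler D h) := by
  rw [sampler]
  infer_instance

lemma real_mul_integral_sampler {n : ℕ} (h : Fin (n + 1) → Rec S A) (f : Θ → ℝ) :
    (R.post D h).real {θ' | R.solve θ' = (h (Fin.last n)).2} * ∫ θ, f θ ∂(R.sampler D h)
      = ∫ θ in {θ' | R.solve θ' = (h (Fin.last n)).2}, f θ ∂(R.post D h) := by
  rw [sampler, ProbabilityTheory.cond, integral_smul_measure, ENNReal.toReal_inv, smul_eq_mul]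
  rcases eq_or_ne ((R.post D h).real {θ' | R.solve θ' = (h (Fin.last n)).2}) 0 with h0 | h0
  · rw [h0, zero_mul, Measure.restrict_eq_zero.2 ((measureReal_eq_zero_iff).1 h0),
      integral_zero_measure]
  · exact mul_inv_cancel_left₀ h0 _

lemma traj_mul_integral_sampler_const {n : ℕ} (h : Fin (n + 1) → Rec S A) (θ : Θ) (c : ℝ) :
    R.traj D h θ * ∫ _, c ∂(R.sampler D h) = R.traj D h θ * c := by
  rcases eq_or_ne ((R.post D h).real {θ' | R.solve θ' = (h (Fin.last n)).2}) 0 with h0 | h0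
  · rw [R.traj_eq_zero_of_post D h h0, zero_mul, zero_mul]
  · have : IsProbabilityMeasure (R.sampler D h) :=
      ProbabilityTheory.cond_isProbabilityMeasure fun h1 => h0 (by
        rw [measureReal_def, h1, ENNReal.toReal_zero])
    simp

/-- The joint (unnormalized) law of the true and of the sampled parameter, on the event that the
records are `h`. -/
noncomputable def pairLaw {n : ℕ} (h : Fin (n + 1) → Rec S A) : Measure (Θ × Θ) :=
  ((R.prior D).withDensity fun θ => ENNReal.ofReal (R.traj D h θ)).prod (R.sampler D h)

instance isFiniteMeasure_pairLaw {n : ℕ} (h : Fin (n + 1) → Rec S A) :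
    IsFiniteMeasure (R.pairLaw D h) := by
  have := isFiniteMeasure_withDensity_of_bddMeas (μ := R.prior D) (R.bddMeas_traj D h)
  rw [pairLaw]
  infer_instance

/-- Expectation, restricted to the offline data `D`, of a function of the records at times
`0, ..., n`, of the true parameter and of the sampled parameter in use at time `n`. -/
noncomputable def E {n : ℕ} (F : (Fin (n + 1) → Rec S A) → Θ × Θ → ℝ) : ℝ :=
  ∑ h, ∫ z, F h z ∂(R.pairLaw D h)

variable {D} {n : ℕ} {F G : (Fin (n + 1) → Rec S A) → Θ × Θ → ℝ}

lemma E_add (hF : ∀ h, BddMeas (F h)) (hG : ∀ h, BddMeas (G h)) :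
    R.E D (fun h z => F h z + G h z) = R.E D F + R.E D G := by
  simp only [E, ← Finset.sum_add_distrib]
  exact Finset.sum_congr rfl fun h _ => integral_add ((hF h).integrable _) ((hG h).integrable _)

lemma E_sub (hF : ∀ h, BddMeas (F h)) (hG : ∀ h, BddMeas (G h)) :
    R.E D (fun h z => F h z - G h z) = R.E D F - R.E D G := by
  simp only [E, ← Finset.sum_sub_distrib]
  exact Finset.sum_congr rfl fun h _ => integral_sub ((hF h).integrable _) ((hG h).integrable _)

lemma E_const_mul (c : ℝ) : R.E D (fun h z => c * F h z) = c * R.E D F := by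
  simp only [E, Finset.mul_sum, integral_const_mul]

lemma E_sum {ι : Type*} (s : Finset ι) {F : ι → (Fin (n + 1) → Rec S A) → Θ × Θ → ℝ}
    (hF : ∀ i ∈ s, ∀ h, BddMeas (F i h)) :
    R.E D (fun h z => ∑ i ∈ s, F i h z) = ∑ i ∈ s, R.E D (F i) := by
  simp only [E]
  rw [Finset.sum_comm]
  exact Finset.sum_congr rfl fun h _ =>
    integral_finsetSum s fun i hi => (hF i hi h).integrable _

/-- This lets `E_mono` and `E_congr` assume that the sampled parameter induces the recorded policy.
-/
lemma ae_pairLaw (h : Fin (n + 1) → Rec S A) :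
    ∀ᵐ z ∂(R.pairLaw D h), R.solve z.2 = (h (Fin.last n)).2 := by
  have hm := R.oracle.measurable (h (Fin.last n)).2
  have := isFiniteMeasure_withDensity_of_bddMeas (μ := R.prior D) (R.bddMeas_traj D h)
  exact Measure.quasiMeasurePreserving_snd.ae (ProbabilityTheory.ae_cond_mem hm)

lemma E_mono (hF : ∀ h, BddMeas (F h)) (hG : ∀ h, BddMeas (G h))
    (hle : ∀ h θ θ', R.solve θ' = (h (Fin.last n)).2 → F h (θ, θ') ≤ G h (θ, θ')) :
    R.E D F ≤ R.E D G := by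
  refine Finset.sum_le_sum fun h _ => ?_
  refine integral_mono_ae ((hF h).integrable _) ((hG h).integrable _) ?_
  filter_upwards [R.ae_pairLaw h] with z hz
  exact hle h z.1 z.2 hz

lemma E_congr (heq : ∀ h θ θ', R.solve θ' = (h (Fin.last n)).2 → F h (θ, θ') = G h (θ, θ')) :
    R.E D F = R.E D G := by
  refine Finset.sum_congr rfl fun h _ => ?_
  refine integral_congr_ae ?_
  filter_upwards [R.ae_pairLaw h] with z hz
  exact heq h z.1 z.2 hz

lemma integral_pairLaw (h : Fin (n + 1) → Rec S A) {f : Θ × Θ → ℝ} (hf : BddMeas f) :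
    ∫ z, f z ∂(R.pairLaw D h)
      = ∫ θ, R.traj D h θ * ∫ θ', f (θ, θ') ∂(R.sampler D h) ∂(R.prior D) := by
  have := isFiniteMeasure_withDensity_of_bddMeas (μ := R.prior D) (R.bddMeas_traj D h)
  rw [pairLaw, integral_prod f (by simpa only [pairLaw] using hf.integrable (R.pairLaw D h)),
    integral_withDensity_ofReal (R.bddMeas_traj D h).1 (R.traj_nonneg D h)]

lemma E_eq (hF : ∀ h, BddMeas (F h)) : R.E D F =
    ∑ h, ∫ θ, R.traj D h θ * ∫ θ', F h (θ, θ') ∂(R.sampler D h) ∂(R.prior D) :=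
  Finset.sum_congr rfl fun h _ => R.integral_pairLaw h (hF h)

lemma E_fst {f : (Fin (n + 1) → Rec S A) → Θ → ℝ} (hf : ∀ h, BddMeas (f h)) :
    R.E D (fun h z => f h z.1) = ∑ h, ∫ θ, R.traj D h θ * f h θ ∂(R.prior D) := by
  rw [R.E_eq fun h => (hf h).comp measurable_fst]
  simp only [traj_mul_integral_sampler_const]

/-- One step of the process, for functions which do not involve the sampled parameter. -/
lemma E_succ_fst {f : (Fin (n + 1) → Rec S A) → S → Θ → ℝ} (hf : ∀ h s, BddMeas (f h s))
    {g : (Fin (n + 2) → Rec S A) → Θ → ℝ} (hg : ∀ h s π, g (push h (s, π)) = f h s) :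
    R.E D (fun h z => g h z.1) = R.E D fun h z => ∑ s, R.M.P z.1 (h (Fin.last n)).1
      ((h (Fin.last n)).2 (h (Fin.last n)).1) s * f h s z.1 := by
  have hg' : ∀ h, BddMeas (g h) := fun h => by
    obtain ⟨h, ⟨s, π⟩, rfl⟩ : ∃ h' y, h = push h' y := ⟨_, _, (Fin.snoc_init_self h).symm⟩
    rw [hg]
    exact hf h s
  rw [R.E_fst hg', R.E_fst (f := fun h θ => ∑ s, R.M.P θ (h (Fin.last n)).1
      ((h (Fin.last n)).2 (h (Fin.last n)).1) s * f h s θ)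
      fun h => BddMeas.sum _ fun s _ => (R.bddMeas_P _ _ _).mul (hf h s), sum_push]
  refine Finset.sum_congr rfl fun h _ => ?_
  simp only [Finset.mul_sum]
  rw [integral_finsetSum _ fun s _ => ((R.bddMeas_traj D h).mul
    ((R.bddMeas_P _ _ _).mul (hf h s))).integrable _]
  refine Finset.sum_congr rfl fun s _ => ?_
  rw [← integral_finsetSum _ fun π _ => ((R.bddMeas_traj D _).mul (hg' _)).integrable _]
  refine integral_congr_ae (Eventually.of_forall fun θ => ?_)
  simp only [hg, ← Finset.sum_mul, sum_traj_succ, mul_assoc]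

/-- One step of the process inside an episode. -/
lemma E_succ (hn : ¬ R.IsStart (n + 1)) {f : (Fin (n + 1) → Rec S A) → S → Θ × Θ → ℝ}
    (hf : ∀ h s, BddMeas (f h s)) {g : (Fin (n + 2) → Rec S A) → Θ × Θ → ℝ}
    (hg : ∀ h s, g (push h (s, (h (Fin.last n)).2)) = f h s) (hg' : ∀ h, BddMeas (g h)) :
    R.E D g = R.E D fun h z => ∑ s, R.M.P z.1 (h (Fin.last n)).1
      ((h (Fin.last n)).2 (h (Fin.last n)).1) s * f h s z := by
  rw [R.E_eq hg', R.E_eq (F := fun h z => ∑ s, R.M.P z.1 (h (Fin.last n)).1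
      ((h (Fin.last n)).2 (h (Fin.last n)).1) s * f h s z)
      fun h => BddMeas.sum _ fun s _ => ((R.bddMeas_P _ _ _).comp measurable_fst).mul (hf h s),
      sum_push]
  refine Finset.sum_congr rfl fun h _ => ?_
  have h1 : ∀ θ, R.traj D h θ * ∫ θ', ∑ s, R.M.P θ (h (Fin.last n)).1
      ((h (Fin.last n)).2 (h (Fin.last n)).1) s * f h s (θ, θ') ∂(R.sampler D h) =
      ∑ s, R.traj D h θ * (R.M.P θ (h (Fin.last n)).1
        ((h (Fin.last n)).2 (h (Fin.last n)).1) s * ∫ θ', f h s (θ, θ') ∂(R.sampler D h)) := by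
    intro θ
    rw [integral_finsetSum _ fun s _ => (((hf h s).comp measurable_prodMk_left).const_mul
      _).integrable _, Finset.mul_sum]
    simp only [integral_const_mul]
  simp only [h1]
  rw [integral_finsetSum _ fun s _ => ((R.bddMeas_traj D h).mul ((R.bddMeas_P _ _ _).mul
    ((hf h s).integral_right _))).integrable _]
  refine Finset.sum_congr rfl fun s _ => ?_
  -- Inside an episode a change of policy has probability zero, and the law of the sampled parameter
  -- stays the same because both the belief and the policy do.
  rw [Finset.sum_eq_single (h (Fin.last n)).2 (fun π _ hπ => ?_) (by simp)]
  · simp only [traj_succ, if_neg hn, if_true, mul_one, hg]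
    have : R.sampler D (push h (s, (h (Fin.last n)).2)) = R.sampler D h := by
      rw [sampler, sampler, R.post_push D hn, push_last]
    rw [this]
    simp only [mul_assoc]
  · simp [traj_succ, if_neg hn, hπ]

/-- At the start of an episode the true and the sampled parameters are conditionally independent
with the same law. -/
lemma E_start (hn : R.IsStart n) (hF : ∀ h, BddMeas (F h))
    (hind : ∀ h s π π', F (push h (s, π)) = F (push h (s, π'))) :
    R.E D F = ∑ h, (∫ θ, R.traj D h θ ∂(R.prior D)) *
      ∫ z, F h z ∂((R.post D h).prod (R.post D h)) := by
  obtain ⟨V, hV, hVt⟩ := R.traj_start D hn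
  have := R.nonempty_action
  rw [R.E_eq hF, sum_push, sum_push]
  refine Finset.sum_congr rfl fun h _ => Finset.sum_congr rfl fun s _ => ?_
  set π₀ : S → A := Classical.arbitrary _
  have hpost : ∀ π, R.post D (push h (s, π)) = R.post D (push h (s, π₀)) := fun π =>
    R.post_push_congr D h s _ _
  have hI := (hF (push h (s, π₀))).integral_right (R.post D (push h (s, π₀)))
  -- Weighted by the probabilities of the policies, the conditional laws of the sampled parameter
  -- reassemble into the full belief.
  have h1 : ∑ π, ∫ θ, R.traj D (push h (s, π)) θ *
      ∫ θ', F (push h (s, π)) (θ, θ') ∂(R.sampler D (push h (s, π))) ∂(R.prior D) =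
      ∫ θ, V h s θ * ∫ θ', F (push h (s, π₀)) (θ, θ') ∂(R.post D (push h (s, π₀)))
        ∂(R.prior D) := by
    rw [← integral_finsetSum _ fun π _ => ((R.bddMeas_traj D _).mul
      ((hF _).integral_right _)).integrable _]
    refine integral_congr_ae (Eventually.of_forall fun θ => ?_)
    dsimp only
    rw [← R.sum_post D _ _ ((hF (push h (s, π₀))).comp measurable_prodMk_left), Finset.mul_sum]
    refine Finset.sum_congr rfl fun π _ => ?_
    have h2 := R.real_mul_integral_sampler D (push h (s, π))
      (fun θ' => F (push h (s, π)) (θ, θ'))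
    rw [push_last] at h2
    rw [hVt, mul_assoc, h2, hind h s π π₀, hpost π]
  -- `integral_traj_mul` summed over the drawn policy: the true parameter has the same conditional
  -- law.
  have h3 : ∀ f : Θ → ℝ, BddMeas f → ∫ θ, V h s θ * f θ ∂(R.prior D) =
      (∫ θ, V h s θ ∂(R.prior D)) * ∫ θ, f θ ∂(R.post D (push h (s, π₀))) := by
    intro f hf
    have h4 : ∀ g : Θ → ℝ, BddMeas g → ∫ θ, V h s θ * g θ ∂(R.prior D) =
        ∑ π, ∫ θ, R.traj D (push h (s, π)) θ * g θ ∂(R.prior D) := by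
      intro g hg
      rw [← integral_finsetSum _ fun π _ => ((R.bddMeas_traj D _).mul hg).integrable _]
      refine integral_congr_ae (Eventually.of_forall fun θ => ?_)
      simp only [hVt, ← Finset.sum_mul, ← Finset.mul_sum, hpost, R.sum_post_real, mul_one]
    have h5 := h4 (fun _ => 1) (BddMeas.const 1)
    simp only [mul_one] at h5
    rw [h4 f hf, h5, Finset.sum_mul]
    exact Finset.sum_congr rfl fun π _ => by rw [R.integral_traj_mul D hn _ hf, hpost π]
  have h6 : ∀ π, ∫ z, F (push h (s, π)) z ∂((R.post D (push h (s, π))).prod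
      (R.post D (push h (s, π)))) = ∫ z, F (push h (s, π₀)) z ∂((R.post D (push h (s, π₀))).prod
      (R.post D (push h (s, π₀)))) := fun π => by rw [hind h s π π₀, hpost π]
  rw [h1, h3 _ hI, ← integral_prod (F (push h (s, π₀))) ((hF _).integrable _),
    Finset.sum_congr rfl fun π _ => congrArg _ (h6 π), ← Finset.sum_mul]
  congr 1
  rw [← integral_finsetSum _ fun π _ => (R.bddMeas_traj D _).integrable _]
  refine integral_congr_ae (Eventually.of_forall fun θ => ?_)
  dsimp only
  rw [Finset.sum_congr rfl fun π _ => (hVt h s π θ).trans (by rw [hpost π]), ← Finset.mul_sum,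
    R.sum_post_real, mul_one]

/-- The exchangeability behind posterior sampling: the square of the belief is invariant under
swapping the factors. -/
lemma E_start_swap (hn : R.IsStart n) (hF : ∀ h, BddMeas (F h))
    (hind : ∀ h s π π', F (push h (s, π)) = F (push h (s, π'))) :
    R.E D (fun h z => F h z.swap) = R.E D F := by
  rw [R.E_start hn hF hind, R.E_start hn (fun h => (hF h).comp measurable_swap) fun h s π π' => by
    simp only [hind h s π π']]
  simp only [integral_prod_swap]

end Scenario

/-! ### Exponential moments. -/

/-- Hoeffding's lemma for a Bernoulli variable. -/
lemma bernoulli_exp_le {q : ℝ} (h0 : 0 ≤ q) (h1 : q ≤ 1) (l : ℝ) :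
    q * Real.exp (l * (1 - q)) + (1 - q) * Real.exp (l * (0 - q)) ≤ Real.exp (l ^ 2 / 8) := by
  set μ : Measure Bool := ENNReal.ofReal q • Measure.dirac true +
    ENNReal.ofReal (1 - q) • Measure.dirac false with hμ
  have hprob : IsProbabilityMeasure μ := ⟨by
    simp [hμ, ← ENNReal.ofReal_add h0 (sub_nonneg.2 h1)]⟩
  have hint : ∀ f : Bool → ℝ, ∫ b, f b ∂μ = q * f true + (1 - q) * f false := fun f => by
    rw [hμ, integral_add_measure (Integrable.of_finite.smul_measure ENNReal.ofReal_ne_top)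
      (Integrable.of_finite.smul_measure ENNReal.ofReal_ne_top), integral_smul_measure,
      integral_smul_measure, integral_dirac, integral_dirac, ENNReal.toReal_ofReal h0,
      ENNReal.toReal_ofReal (sub_nonneg.2 h1), smul_eq_mul, smul_eq_mul]
  have h := (ProbabilityTheory.hasSubgaussianMGF_of_mem_Icc (μ := μ)
    (X := fun b => if b then (1 : ℝ) else 0) (a := 0) (b := 1)
    (measurable_of_countable _).aemeasurable
    (Eventually.of_forall fun b => by cases b <;> simp)).mgf_le l
  rw [ProbabilityTheory.mgf, hint, hint] at h
  simp only [Bool.false_eq_true, if_true, if_false, mul_one, mul_zero, add_zero] at h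
  refine h.trans (le_of_eq ?_)
  congr 1
  simp
  ring

/-- Membership in B is a Bernoulli variable, so this is Hoeffding's lemma. It is the one-step
inequality that makes `expDev` a supermartingale. -/
lemma stdSimplex_exp_le {ι : Type*} [Fintype ι] [DecidableEq ι] {p : ι → ℝ}
    (hp : p ∈ stdSimplex ℝ ι) (B : Finset ι) (l : ℝ) :
    ∑ i, p i * Real.exp (l * ((if i ∈ B then 1 else 0) - ∑ j ∈ B, p j) - l ^ 2 / 8) ≤ 1 := by
  have hq0 : 0 ≤ ∑ j ∈ B, p j := Finset.sum_nonneg fun j _ => hp.1 j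
  have hsum : ∑ j ∈ B, p j + ∑ j ∈ Bᶜ, p j = 1 := by rw [Finset.sum_add_sum_compl, hp.2]
  have hq1 : 0 ≤ ∑ j ∈ Bᶜ, p j := Finset.sum_nonneg fun j _ => hp.1 j
  set q := ∑ j ∈ B, p j
  have h := bernoulli_exp_le hq0 (by linarith) l
  rw [← Finset.sum_add_sum_compl B]
  have h1 : ∑ i ∈ B, p i * Real.exp (l * ((if i ∈ B then 1 else 0) - q) - l ^ 2 / 8)
      = q * Real.exp (l * (1 - q)) * Real.exp (- (l ^ 2 / 8)) := by
    rw [Finset.sum_mul, Finset.sum_mul]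
    refine Finset.sum_congr rfl fun i hi => ?_
    rw [if_pos hi, sub_eq_add_neg (l * _), Real.exp_add, mul_assoc]
  have h2 : ∑ i ∈ Bᶜ, p i * Real.exp (l * ((if i ∈ B then 1 else 0) - q) - l ^ 2 / 8)
      = (1 - q) * Real.exp (l * (0 - q)) * Real.exp (- (l ^ 2 / 8)) := by
    rw [← hsum, add_sub_cancel_left, Finset.sum_mul, Finset.sum_mul]
    refine Finset.sum_congr rfl fun i hi => ?_
    rw [if_neg (Finset.mem_compl.1 hi), sub_eq_add_neg (l * _), Real.exp_add, mul_assoc]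
  rw [h1, h2, ← add_mul]
  calc _ ≤ Real.exp (l ^ 2 / 8) * Real.exp (- (l ^ 2 / 8)) :=
        mul_le_mul_of_nonneg_right h (Real.exp_pos _).le
    _ = 1 := by rw [← Real.exp_add, add_neg_cancel, Real.exp_zero]

/-! ### Visit and transition counts. -/

section Counts

variable {S A : Type*} [DecidableEq S] [DecidableEq A]

/-- The number of visits to the pair `x` before the time `j`. -/
def visits (j : ℕ) {n : ℕ} (h : Fin (n + 1) → Rec S A) (x : S × A) : ℕ :=
  ∑ i : Fin n, if i.1 < j ∧ (h i.castSucc).pair = x then 1 else 0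

/-- The number of transitions from `x` into the set `B` before the time `j`. -/
def hits (j : ℕ) {n : ℕ} (h : Fin (n + 1) → Rec S A) (x : S × A) (B : Finset S) : ℕ :=
  ∑ i : Fin n, if i.1 < j ∧ (h i.castSucc).pair = x ∧ (h i.succ).1 ∈ B then 1 else 0

variable {n : ℕ} {j : ℕ}

lemma visits_push (hj : j ≤ n) (h : Fin (n + 1) → Rec S A) (y : Rec S A) (x : S × A) :
    visits j (push h y) x = visits j h x := by
  rw [visits, Fin.sum_univ_castSucc, if_neg (by simp; omega), add_zero]
  simp only [Fin.val_castSucc, push_castSucc]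
  rfl

lemma hits_push (hj : j ≤ n) (h : Fin (n + 1) → Rec S A) (y : Rec S A) (x : S × A)
    (B : Finset S) : hits j (push h y) x B = hits j h x B := by
  rw [hits, Fin.sum_univ_castSucc, if_neg (by simp; omega), add_zero]
  simp only [Fin.val_castSucc, push_castSucc, Fin.succ_castSucc]
  rfl

lemma visits_of_le {j' : ℕ} (hj : n ≤ j) (hj' : n ≤ j') (h : Fin (n + 1) → Rec S A) (x : S × A) :
    visits j h x = visits j' h x :=
  Finset.sum_congr rfl fun i _ => by
    have := i.2
    simp only [show i.1 < j by omega, show i.1 < j' by omega]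

lemma hits_of_le {j' : ℕ} (hj : n ≤ j) (hj' : n ≤ j') (h : Fin (n + 1) → Rec S A) (x : S × A)
    (B : Finset S) : hits j h x B = hits j' h x B :=
  Finset.sum_congr rfl fun i _ => by
    have := i.2
    simp only [show i.1 < j by omega, show i.1 < j' by omega]

lemma visits_push_self (h : Fin (n + 1) → Rec S A) (y : Rec S A) (x : S × A) :
    visits (n + 1) (push h y) x =
      visits n h x + if (h (Fin.last n)).pair = x then 1 else 0 := by
  rw [visits, Fin.sum_univ_castSucc]
  simp only [Fin.val_castSucc, push_castSucc, Fin.val_last, Nat.lt_succ_self, true_and]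
  congr 1
  exact visits_of_le (by omega) le_rfl h x

lemma hits_push_self (h : Fin (n + 1) → Rec S A) (y : Rec S A) (x : S × A) (B : Finset S) :
    hits (n + 1) (push h y) x B =
      hits n h x B + if (h (Fin.last n)).pair = x ∧ y.1 ∈ B then 1 else 0 := by
  rw [hits, Fin.sum_univ_castSucc]
  simp only [Fin.val_castSucc, push_castSucc, Fin.val_last, Nat.lt_succ_self, true_and,
    Fin.succ_last, push_last, Fin.succ_castSucc]
  congr 1
  exact hits_of_le (by omega) le_rfl h x B

lemma visits_push_congr (h : Fin n → Rec S A) (s : S) (π π' : S → A) (x : S × A) :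
    visits j (push h (s, π)) x = visits j (push h (s, π')) x := by
  simp only [visits, push_castSucc]

lemma hits_push_congr (h : Fin n → Rec S A) (s : S) (π π' : S → A) (x : S × A) (B : Finset S) :
    hits j (push h (s, π)) x B = hits j (push h (s, π')) x B := by
  simp only [hits, push_castSucc, push_fst_congr h s π π']

lemma visits_le (h : Fin (n + 1) → Rec S A) (x : S × A) : visits j h x ≤ n := by
  calc visits j h x ≤ ∑ _i : Fin n, 1 := Finset.sum_le_sum fun i _ => by split_ifs <;> simp
    _ = n := by simp

/-- A pair gains at most one visit per step; this controls how stale the counts frozen at the start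
of an episode can be. -/
lemma visits_le_add (h : Fin (n + 1) → Rec S A) (x : S × A) (hj : j ≤ n) :
    visits n h x ≤ visits j h x + (n - j) := by
  induction n with
  | zero => simp [visits]
  | succ n ih =>
    obtain ⟨h, y, rfl⟩ : ∃ h' y, h = push h' y := ⟨_, _, (Fin.snoc_init_self h).symm⟩
    rw [visits_push_self]
    rcases Nat.lt_or_ge n j with h1 | h1
    · obtain rfl : j = n + 1 := by omega
      rw [visits_push_self]
      omega
    · rw [visits_push h1]
      have := ih h h1
      split_ifs <;> omega

end Counts

/-! ### The mismatch probability and sums over visits. -/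

namespace Scenario

variable {S A Θ : Type*} [Fintype S] [DecidableEq S] [Fintype A] [DecidableEq A]
  [MeasurableSpace Θ] (R : Scenario S A Θ) {N : ℕ} {D : Offline S A N} {n : ℕ}

lemma E_push (hn : ¬ R.IsStart (n + 1)) {f : (Fin (n + 1) → Rec S A) → Θ × Θ → ℝ}
    (hf : ∀ h, BddMeas (f h)) {g : (Fin (n + 2) → Rec S A) → Θ × Θ → ℝ}
    (hg : ∀ h y, g (push h y) = f h) : R.E D g = R.E D f := by
  rw [R.E_succ hn (f := fun h _ => f h) (fun h _ => hf h) (fun h s => hg h _) fun h => by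
    obtain ⟨h, y, rfl⟩ : ∃ h' y, h = push h' y := ⟨_, _, (Fin.snoc_init_self h).symm⟩
    rw [hg]
    exact hf h]
  simp only [← Finset.sum_mul, (R.M.P_mem _ _ _).2, one_mul]

lemma E_fst_const {f : Θ → ℝ} (hf : BddMeas f) (n : ℕ) :
    R.E D (n := n) (fun _ z => f z.1) = ∫ θ, f θ ∂(R.prior D) := by
  rw [R.E_fst (f := fun _ => f) fun _ => hf, ← integral_finsetSum _ fun h _ =>
    ((R.bddMeas_traj D h).mul hf).integrable _]
  simp only [← Finset.sum_mul, R.sum_traj, one_mul]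

/-- The probability of the offline data. -/
noncomputable def mass (D : Offline S A N) : ℝ := (R.prior D).real Set.univ

lemma mass_nonneg : 0 ≤ R.mass D := measureReal_nonneg

lemma E_const (c : ℝ) (n : ℕ) : R.E D (n := n) (fun _ _ => c) = c * R.mass D := by
  rw [R.E_fst_const (BddMeas.const c) n, integral_const, smul_eq_mul, mul_comm, mass]

/-- The indicator of the event that the sampled policy differs from the optimal one. -/
noncomputable def mis (z : Θ × Θ) : ℝ := if R.solve z.1 = R.solve z.2 then 0 else 1

lemma measurableSet_match : MeasurableSet {z : Θ × Θ | R.solve z.1 = R.solve z.2} := by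
  have : {z : Θ × Θ | R.solve z.1 = R.solve z.2}
      = ⋃ π, {θ | R.solve θ = π} ×ˢ {θ | R.solve θ = π} := by
    ext z
    simp [eq_comm]
  rw [this]
  exact MeasurableSet.iUnion fun π => (R.oracle.measurable π).prod (R.oracle.measurable π)

lemma bddMeas_mis : BddMeas R.mis :=
  BddMeas.ite R.measurableSet_match (BddMeas.const 0) (BddMeas.const 1)

lemma mis_nonneg (z : Θ × Θ) : 0 ≤ R.mis z := by
  rw [mis]
  split_ifs <;> norm_num

lemma mis_le_one (z : Θ × Θ) : R.mis z ≤ 1 := by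
  rw [mis]
  split_ifs <;> norm_num

/-- Swapping the two parameters, exchangeable at the start of an episode, preserves the mismatch
indicator and reverses the sign of the difference. Inside an episode neither parameter changes. -/
lemma E_mis_mul_sub {f : Θ → ℝ} (hf : BddMeas f) (n : ℕ) :
    R.E D (n := n) (fun _ z => R.mis z * (f z.1 - f z.2)) = 0 := by
  have hb : BddMeas fun z : Θ × Θ => R.mis z * (f z.1 - f z.2) :=
    R.bddMeas_mis.mul ((hf.comp measurable_fst).sub (hf.comp measurable_snd))
  have hstart : ∀ n, R.IsStart n →
      R.E D (n := n) (fun _ z => R.mis z * (f z.1 - f z.2)) = 0 := fun n hn => by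
    have h1 := R.E_start_swap (D := D) hn (F := fun _ z => R.mis z * (f z.1 - f z.2))
      (fun _ => hb) fun _ _ _ _ => rfl
    have h2 : (fun (_ : Fin (n + 1) → Rec S A) (z : Θ × Θ) =>
        R.mis z.swap * (f z.swap.1 - f z.swap.2)) = fun _ z =>
        (-1) * (R.mis z * (f z.1 - f z.2)) := by
      funext _ z
      simp only [mis, Prod.fst_swap, Prod.snd_swap, eq_comm (a := R.solve z.2)]
      ring
    rw [h2, E_const_mul] at h1
    linarith
  induction n with
  | zero => exact hstart 0 R.isStart_zero
  | succ n ih =>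
    by_cases hn : R.IsStart (n + 1)
    · exact hstart _ hn
    · rw [R.E_push hn (f := fun _ z => R.mis z * (f z.1 - f z.2)) (fun _ => hb) fun _ _ => rfl, ih]

lemma integral_mis (p : Measure Θ) [IsProbabilityMeasure p] :
    ∫ z, R.mis z ∂(p.prod p) = 1 - ∑ π, p.real {θ | R.solve θ = π} ^ 2 := by
  classical
  have h1 : ∀ z, R.mis z = 1 - ∑ π, ({θ | R.solve θ = π}.indicator (fun _ => (1 : ℝ)) z.1) *
      {θ | R.solve θ = π}.indicator (fun _ => (1 : ℝ)) z.2 := fun z => by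
    simp only [mis, Set.indicator_apply, Set.mem_ofPred_eq, ite_mul, one_mul, zero_mul,
      Finset.sum_ite_eq, Finset.mem_univ, if_true]
    simp only [eq_comm (a := R.solve z.2)]
    split_ifs <;> norm_num
  have hind : ∀ π, BddMeas ({θ | R.solve θ = π}.indicator fun _ => (1 : ℝ)) := fun π => by
    refine BddMeas.of_mem_Icc (a := 0) (b := 1)
      (measurable_const.indicator (R.oracle.measurable π)) fun θ => ?_
    rw [Set.indicator_apply]
    split_ifs <;> norm_num
  simp only [h1]
  rw [integral_sub (integrable_const _) ((BddMeas.sum _ fun π _ =>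
    ((hind π).comp measurable_fst).mul ((hind π).comp measurable_snd)).integrable _),
    integral_finsetSum _ fun π _ =>
    (((hind π).comp measurable_fst).mul ((hind π).comp measurable_snd)).integrable _]
  congr 1
  · simp
  · refine Finset.sum_congr rfl fun π _ => ?_
    rw [integral_prod_mul (μ := p) (ν := p), integral_indicator (R.oracle.measurable π)]
    simp [sq]

/-- A linear upper bound, in the law of the true policy, of the mismatch probability. -/
noncomputable def misBound (a : (S → A) → ℝ) (θ : Θ) : ℝ :=
  1 + ∑ π, a π ^ 2 - 2 * a (R.solve θ)

lemma bddMeas_misBound (a : (S → A) → ℝ) : BddMeas (R.misBound a) := by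
  refine (BddMeas.const _).sub (BddMeas.const_mul 2 ⟨?_, ∑ π, |a π|, fun θ =>
    Finset.single_le_sum (f := fun π => |a π|) (fun _ _ => abs_nonneg _) (Finset.mem_univ _)⟩)
  let _ : MeasurableSpace (S → A) := ⊤
  have : Measurable R.solve := measurable_to_countable' fun π => R.oracle.measurable π
  exact (measurable_from_top (f := a)).comp this

lemma integral_misBound (a : (S → A) → ℝ) (p : Measure Θ) [IsProbabilityMeasure p] :
    ∫ θ, R.misBound a θ ∂p
      = 1 + ∑ π, a π ^ 2 - 2 * ∑ π, a π * p.real {θ | R.solve θ = π} := by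
  have h1 : ∀ θ, R.misBound a θ = 1 + ∑ π, a π ^ 2 - 2 * ∑ π, a π *
      {θ | R.solve θ = π}.indicator (fun _ => (1 : ℝ)) θ := fun θ => by
    classical
    simp [misBound, Set.indicator_apply]
  have hind : ∀ π, Integrable ({θ | R.solve θ = π}.indicator fun _ => (1 : ℝ)) p := fun π =>
    (integrable_const (1 : ℝ)).indicator (R.oracle.measurable π)
  simp only [h1]
  rw [integral_sub (integrable_const _) ((integrable_finsetSum _ fun π _ =>
    (hind π).const_mul _).const_mul _), integral_const_mul,
    integral_finsetSum _ fun π _ => (hind π).const_mul _]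
  congr 2
  · simp
  · refine Finset.sum_congr rfl fun π _ => ?_
    rw [integral_const_mul, integral_indicator (R.oracle.measurable π)]
    simp

/-- The mismatch probability does not increase from an episode to the next one. -/
lemma E_mis_le (n : ℕ) :
    R.E D (n := n) (fun _ => R.mis) ≤ R.E D (n := 0) (fun _ => R.mis) := by
  have hstart : ∀ n, R.IsStart n → ∀ a : (S → A) → ℝ, R.E D (n := n) (fun _ => R.mis) =
      ∑ h, (∫ θ, R.traj D h θ ∂(R.prior D)) *
        (1 - ∑ π, (R.post D (n := n) h).real {θ | R.solve θ = π} ^ 2) ∧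
      ∫ θ, R.misBound a θ ∂(R.prior D) = ∑ h, (∫ θ, R.traj D h θ ∂(R.prior D)) *
        (1 + ∑ π, a π ^ 2
          - 2 * ∑ π, a π * (R.post D (n := n) h).real {θ | R.solve θ = π}) := by
    intro n hn a
    constructor
    · rw [R.E_start hn (fun _ => R.bddMeas_mis) fun _ _ _ _ => rfl]
      simp only [integral_mis]
    · rw [← R.E_fst_const (R.bddMeas_misBound a) n, R.E_start hn
        (fun _ => (R.bddMeas_misBound a).comp measurable_fst) fun _ _ _ _ => rfl]
      refine Finset.sum_congr rfl fun h _ => ?_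
      rw [← R.integral_misBound a, integral_fun_fst]
      simp
  have hpost0 : ∀ h : Fin 1 → Rec S A, R.post D h
      = bayesUpdate R.μ₀ (offlineLik R.M R.ŝ R.β D) := fun h => by
    have : episodeAt R.sched 0 = 1 := episodeAt_eq R.sched_pos (by rw [episodeStart_one])
      (Nat.lt_of_lt_of_le Nat.zero_lt_one (le_episodeStart_succ R.sched_pos 1))
    rw [post, this]
    rfl
  induction n with
  | zero => exact le_rfl
  | succ n ih =>
    by_cases hn : R.IsStart (n + 1)
    -- Concavity in the form of a tangent plane at the initial belief a, which is fixed once the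
    -- offline data are given. The plane lies above 1 - ∑ p² with gap ∑ (a - p)²; its mean is that
    -- of `misBound a` at the true parameter, hence independent of time, and at time 0 the gap is
    -- zero.
    · set a : (S → A) → ℝ := fun π =>
        (bayesUpdate R.μ₀ (offlineLik R.M R.ŝ R.β D)).real {θ | R.solve θ = π}
      obtain ⟨h1, h2⟩ := hstart 0 R.isStart_zero a
      obtain ⟨h3, h4⟩ := hstart (n + 1) hn a
      have h5 : R.E D (n := 0) (fun _ => R.mis) = ∫ θ, R.misBound a θ ∂(R.prior D) := by
        rw [h1, h2]
        refine Finset.sum_congr rfl fun h _ => ?_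
        simp only [hpost0, a, ← sq]
        ring
      rw [h5, h3, h4]
      refine Finset.sum_le_sum fun h _ => mul_le_mul_of_nonneg_left ?_
        (integral_nonneg fun θ => R.traj_nonneg D h θ)
      have h6 : 0 ≤ ∑ π, (a π - (R.post D h).real {θ | R.solve θ = π}) ^ 2 :=
        Finset.sum_nonneg fun π _ => sq_nonneg _
      simp only [sub_sq, Finset.sum_add_distrib, Finset.sum_sub_distrib, mul_assoc,
        ← Finset.mul_sum] at h6
      linarith
    · rw [R.E_push hn (f := fun _ => R.mis) (fun _ => R.bddMeas_mis) fun _ _ => rfl]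
      exact ih

/-- Functions of the data available at the start of the episode and of the sampled parameter have
the same mean as for the true parameter. -/
lemma E_snd_eq_fst {f : ∀ n, (Fin (n + 1) → Rec S A) → Θ → ℝ} (hf : ∀ n h, BddMeas (f n h))
    (hstart : ∀ n h s π π', R.IsStart n → f n (push h (s, π)) = f n (push h (s, π')))
    (hpush : ∀ n h y, ¬ R.IsStart (n + 1) → f (n + 1) (push h y) = f n h) (n : ℕ) :
    R.E D (fun h z => f n h z.2) = R.E D (fun h z => f n h z.1) := by
  have hs : ∀ n, R.IsStart n →
      R.E D (fun h z => f n h z.2) = R.E D (fun h z => f n h z.1) := fun n hn =>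
    R.E_start_swap hn (F := fun h z => f n h z.1) (fun h => (hf n h).comp measurable_fst)
      fun h s π π' => by simp only [hstart n h s π π' hn]
  induction n with
  | zero => exact hs 0 R.isStart_zero
  | succ n ih =>
    by_cases hn : R.IsStart (n + 1)
    · exact hs _ hn
    · rw [R.E_push hn (f := fun h z => f n h z.2) (fun h => (hf n h).comp measurable_snd)
        fun h y => by simp only [hpush n h y hn], ih]
      exact (R.E_push hn (f := fun h z => f n h z.1) (fun h => (hf n h).comp measurable_fst)
        fun h y => by simp only [hpush n h y hn]).symm

/-- The potential argument for the visit counts. -/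
lemma sum_E_visits (φ : ℕ → ℝ) (h0 : φ 0 = 0) (T : ℕ) :
    ∑ t ∈ Finset.range T, R.E D (n := t) (fun h _ =>
      φ (visits t h (h (Fin.last t)).pair + 1) - φ (visits t h (h (Fin.last t)).pair))
      = R.E D (n := T) fun h _ => ∑ x, φ (visits T h x) := by
  induction T with
  | zero =>
    simp [visits, h0, E]
  | succ T ih =>
    rw [Finset.sum_range_succ, ih, ← R.E_add (fun _ => BddMeas.const _) (fun _ => BddMeas.const _),
      R.E_succ_fst (f := fun h _ _ => ∑ x, φ (visits T h x) +
        (φ (visits T h (h (Fin.last T)).pair + 1) - φ (visits T h (h (Fin.last T)).pair)))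
        (fun _ _ => BddMeas.const _) (g := fun h _ => ∑ x, φ (visits (T + 1) h x)) fun h s π => ?_]
    · simp only [← Finset.sum_mul, (R.M.P_mem _ _ _).2, one_mul]
    · funext _
      -- Only the count of the pair just visited changes.
      rw [← sub_eq_iff_eq_add', ← Finset.sum_sub_distrib,
        Finset.sum_eq_single (h (Fin.last T)).pair (fun x _ hx => ?_) (by simp)]
      · rw [visits_push_self, if_pos rfl]
      · rw [visits_push_self, if_neg hx.symm, add_zero, sub_self]

lemma sum_E_visits_le {φ : ℕ → ℝ} (h0 : φ 0 = 0) (hφ : Monotone φ) (T : ℕ) :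
    ∑ t ∈ Finset.range T, R.E D (n := t) (fun h _ =>
      φ (visits t h (h (Fin.last t)).pair + 1) - φ (visits t h (h (Fin.last t)).pair))
      ≤ Fintype.card S * Fintype.card A * φ T * R.mass D := by
  rw [R.sum_E_visits φ h0, ← R.E_const _ T]
  refine R.E_mono (fun _ => BddMeas.const _) (fun _ => BddMeas.const _) fun h _ _ _ => ?_
  calc ∑ x, φ (visits T h x) ≤ ∑ _x : S × A, φ T := Finset.sum_le_sum fun x _ =>
        hφ (visits_le h x)
    _ = _ := by simp

end Scenario

lemma BddMeas.exp {α : Type*} [MeasurableSpace α] {f : α → ℝ} (hf : BddMeas f) :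
    BddMeas fun x => Real.exp (f x) := by
  obtain ⟨C, hC⟩ := hf.2
  refine ⟨hf.1.exp, Real.exp C, fun x => ?_⟩
  rw [Real.abs_exp]
  exact Real.exp_le_exp.2 ((le_abs_self _).trans (hC x))

/-! ### Total variation between transition kernels. -/

section TotalVariation

variable {ι : Type*} [Fintype ι] {p p' w : ι → ℝ} {V : ℝ}

/-- Negative differences are dropped and the weights are bounded by V. For probability vectors the
sum that remains is the total variation distance. -/
lemma sum_sub_mul_le (hw0 : ∀ i, 0 ≤ w i) (hw : ∀ i, w i ≤ V) :
    ∑ i, (p' i - p i) * w i ≤ V * ∑ i with p i ≤ p' i, (p' i - p i) := by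
  rw [Finset.mul_sum, Finset.sum_filter]
  refine Finset.sum_le_sum fun i _ => ?_
  split_ifs with h
  · rw [mul_comm]
    exact mul_le_mul_of_nonneg_right (hw i) (sub_nonneg.2 h)
  · exact mul_nonpos_of_nonpos_of_nonneg (sub_nonpos.2 (not_le.1 h).le) (hw0 i)

lemma sum_filter_sub_le_one (hp : p ∈ stdSimplex ℝ ι) (hp' : p' ∈ stdSimplex ℝ ι) :
    ∑ i with p i ≤ p' i, (p' i - p i) ≤ 1 := by
  calc ∑ i with p i ≤ p' i, (p' i - p i) ≤ ∑ i with p i ≤ p' i, p' i :=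
        Finset.sum_le_sum fun i _ => by linarith [hp.1 i]
    _ ≤ ∑ i, p' i := Finset.sum_le_univ_sum_of_nonneg fun i => hp'.1 i
    _ = 1 := hp'.2

end TotalVariation

section Counts

variable {S A : Type*} [Fintype S] [DecidableEq S] [DecidableEq A] {n j : ℕ}

/-- Turns an upper deviation for the complement of B into a lower deviation for B, so that one-sided
confidence bounds suffice. -/
lemma hits_add_hits_compl (h : Fin (n + 1) → Rec S A) (x : S × A) (B : Finset S) :
    hits j h x B + hits j h x Bᶜ = visits j h x := by
  rw [hits, hits, visits, ← Finset.sum_add_distrib]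
  refine Finset.sum_congr rfl fun i _ => ?_
  simp only [Finset.mem_compl]
  by_cases h1 : i.1 < j <;> by_cases h2 : (h i.castSucc).pair = x <;>
    by_cases h3 : (h i.succ).1 ∈ B <;> simp [h1, h2, h3]

end Counts

/-! ### Confidence sets. -/

namespace Scenario

variable {S A Θ : Type*} [Fintype S] [DecidableEq S] [Fintype A] [DecidableEq A]
  [MeasurableSpace Θ] (R : Scenario S A Θ) {N : ℕ} {D : Offline S A N} {n : ℕ}

/-- The probability of moving into the set `B`. -/
def probInto (θ : Θ) (x : S × A) (B : Finset S) : ℝ := ∑ s ∈ B, R.M.P θ x.1 x.2 s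

lemma bddMeas_probInto (x : S × A) (B : Finset S) : BddMeas fun θ => R.probInto θ x B :=
  BddMeas.sum _ fun _ _ => R.bddMeas_P _ _ _

lemma probInto_compl (θ : Θ) (x : S × A) (B : Finset S) :
    R.probInto θ x Bᶜ = 1 - R.probInto θ x B := by
  rw [eq_sub_iff_add_eq', probInto, probInto, Finset.sum_add_sum_compl, (R.M.P_mem θ _ _).2]

/-- The exponential supermartingale of the deviations of the empirical frequencies. -/
noncomputable def expDev (l : ℝ) (x : S × A) (B : Finset S) (h : Fin (n + 1) → Rec S A) (θ : Θ) :
    ℝ :=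
  Real.exp (l * (hits n h x B - visits n h x * R.probInto θ x B) - visits n h x * (l ^ 2 / 8))

lemma bddMeas_expDev (l : ℝ) (x : S × A) (B : Finset S) (h : Fin (n + 1) → Rec S A) :
    BddMeas (R.expDev l x B h) :=
  ((((BddMeas.const _).sub ((R.bddMeas_probInto x B).const_mul _)).const_mul l).sub
    (BddMeas.const _)).exp

lemma expDev_push (l : ℝ) (x : S × A) (B : Finset S) (h : Fin (n + 1) → Rec S A) (y : Rec S A)
    (θ : Θ) : R.expDev l x B (push h y) θ = R.expDev l x B h θ *
      Real.exp (if (h (Fin.last n)).pair = x then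
        l * ((if y.1 ∈ B then 1 else 0) - R.probInto θ x B) - l ^ 2 / 8 else 0) := by
  rw [expDev, expDev, ← Real.exp_add, visits_push_self, hits_push_self]
  congr 1
  by_cases h1 : (h (Fin.last n)).pair = x <;> by_cases h2 : y.1 ∈ B <;> simp [h1, h2] <;> ring

/-- A step from a pair other than x leaves the exponent unchanged; from x the new factor has
conditional mean at most one by `stdSimplex_exp_le`. -/
lemma E_expDev_le (l : ℝ) (x : S × A) (B : Finset S) (n : ℕ) :
    R.E D (n := n) (fun h z => R.expDev l x B h z.1) ≤ R.mass D := by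
  induction n with
  | zero =>
    refine le_of_eq ?_
    rw [← one_mul (R.mass D), ← R.E_const 1 0]
    refine R.E_congr fun h θ θ' _ => ?_
    simp [expDev, hits, visits]
  | succ n ih =>
    have hb : ∀ (h : Fin (n + 1) → Rec S A) (s : S), BddMeas fun θ => R.expDev l x B h θ *
      Real.exp (if (h (Fin.last n)).pair = x then
        l * ((if s ∈ B then 1 else 0) - R.probInto θ x B) - l ^ 2 / 8 else 0) := fun h s => by
      refine (R.bddMeas_expDev l x B h).mul (BddMeas.exp ?_)
      split_ifs
      exacts [(((BddMeas.const _).sub (R.bddMeas_probInto x B)).const_mul l).sub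
        (BddMeas.const _), (((BddMeas.const _).sub (R.bddMeas_probInto x B)).const_mul l).sub
        (BddMeas.const _), BddMeas.const 0]
    rw [R.E_succ_fst hb (g := fun h θ => R.expDev l x B h θ)
      fun h s π => funext fun θ => R.expDev_push l x B h (s, π) θ]
    refine le_trans (R.E_mono (fun h => (BddMeas.sum _ fun s _ =>
      (R.bddMeas_P _ _ _).mul (hb h s)).comp measurable_fst)
      (fun h => (R.bddMeas_expDev l x B h).comp measurable_fst) fun h θ θ' _ => ?_) ih
    dsimp only
    simp only [mul_left_comm _ (R.expDev l x B h θ), ← Finset.mul_sum]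
    refine mul_le_of_le_one_right (Real.exp_pos _).le ?_
    split_ifs with h1
    · have := stdSimplex_exp_le (R.M.P_mem θ x.1 x.2) B l
      rw [← h1] at this ⊢
      exact this
    · simp [(R.M.P_mem _ _ _).2]

/-- The parameter `θ` is outside of the confidence set built at the start of the episode. -/
def Outside (L : ℝ) (h : Fin (n + 1) → Rec S A) (θ : Θ) : Prop :=
  ∃ (x : S × A) (B : Finset S),
    √(visits (episodeStart R.sched (episodeAt R.sched n)) h x * L) <
      hits (episodeStart R.sched (episodeAt R.sched n)) h x B -
        visits (episodeStart R.sched (episodeAt R.sched n)) h x * R.probInto θ x B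

open Classical in
/-- The indicator of `Outside`. -/
noncomputable def outside (L : ℝ) (h : Fin (n + 1) → Rec S A) (θ : Θ) : ℝ :=
  if R.Outside L h θ then 1 else 0

lemma outside_nonneg (L : ℝ) (h : Fin (n + 1) → Rec S A) (θ : Θ) : 0 ≤ R.outside L h θ := by
  rw [outside]
  split_ifs <;> norm_num

open Classical in
lemma bddMeas_outside (L : ℝ) (h : Fin (n + 1) → Rec S A) : BddMeas (R.outside L h) := by
  refine BddMeas.ite (p := R.Outside L h) ?_ (BddMeas.const 1) (BddMeas.const 0)
  simp only [Outside, Set.ofPred_exists]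
  exact MeasurableSet.iUnion fun x => MeasurableSet.iUnion fun B => measurableSet_lt
    measurable_const (((R.bddMeas_probInto x B).const_mul _).1.const_sub _)

lemma outside_push (L : ℝ) (hn : ¬ R.IsStart (n + 1)) (h : Fin (n + 1) → Rec S A) (y : Rec S A) :
    R.outside L (push h y) = R.outside L h := by
  ext θ
  have hle := episodeStart_episodeAt_le (sched := R.sched) n
  have : R.Outside L (push h y) θ ↔ R.Outside L h θ := by
    simp only [Outside, R.episodeAt_succ hn, visits_push hle, hits_push hle]
  classical exact if_congr this rfl rfl

lemma outside_push_congr (L : ℝ) (h : Fin n → Rec S A) (s : S) (π π' : S → A) :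
    R.outside L (push h (s, π)) = R.outside L (push h (s, π')) := by
  ext θ
  have : R.Outside L (push h (s, π)) θ ↔ R.Outside L (push h (s, π')) θ := by
    simp only [Outside, visits_push_congr h s π π', hits_push_congr h s π π']
  classical exact if_congr this rfl rfl

/-- Chernoff's method with l = 4 √(L / m), tuned to m visits: a violation makes the exponent of
`expDev` at least 4 L - 2 L = 2 L. The number of visits is random, hence the sum over m. -/
lemma outside_le_sum {L : ℝ} (hL : 0 < L) (hn : R.IsStart n) (h : Fin (n + 1) → Rec S A) (θ : Θ) :
    R.outside L h θ ≤ ∑ x : S × A, ∑ B : Finset S, ∑ m ∈ Finset.Icc 1 n,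
      Real.exp (-(2 * L)) * R.expDev (4 * √(L / m)) x B h θ := by
  have hnn : ∀ (x : S × A) (B : Finset S) (m : ℕ),
      0 ≤ Real.exp (-(2 * L)) * R.expDev (4 * √(L / m)) x B h θ := fun x B m =>
    mul_nonneg (Real.exp_pos _).le (Real.exp_pos _).le
  rw [outside]
  split_ifs with hO
  · obtain ⟨x, B, hx⟩ := hO
    rw [IsStart] at hn
    rw [hn] at hx
    have hhv : hits n h x B ≤ visits n h x := by
      rw [← hits_add_hits_compl (j := n) h x B]
      exact Nat.le_add_right _ _
    have hv : 1 ≤ visits n h x := by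
      by_contra! hv
      have h1 : visits n h x = 0 := by omega
      have h2 : hits n h x B = 0 := by omega
      simp [h1, h2] at hx
    have hmem : visits n h x ∈ Finset.Icc 1 n := Finset.mem_Icc.2 ⟨hv, visits_le h x⟩
    refine le_trans ?_ ((Finset.single_le_sum (f := fun m : ℕ =>
      Real.exp (-(2 * L)) * R.expDev (4 * √(L / m)) x B h θ) (fun m _ => hnn x B m) hmem).trans
      ((Finset.single_le_sum (f := fun B => ∑ m ∈ Finset.Icc 1 n,
      Real.exp (-(2 * L)) * R.expDev (4 * √(L / m)) x B h θ) (fun B _ =>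
        Finset.sum_nonneg fun m _ => hnn x B m) (Finset.mem_univ B)).trans
      (Finset.single_le_sum (f := fun x => ∑ B : Finset S, ∑ m ∈ Finset.Icc 1 n,
      Real.exp (-(2 * L)) * R.expDev (4 * √(L / m)) x B h θ) (fun x _ => Finset.sum_nonneg
        fun B _ => Finset.sum_nonneg fun m _ => hnn x B m) (Finset.mem_univ x))))
    rw [expDev, ← Real.exp_add]
    refine Real.one_le_exp ?_
    have hv' : (0 : ℝ) < visits n h x := by exact_mod_cast hv
    set v : ℝ := ((visits n h x : ℕ) : ℝ)
    have h1 : √(L / v) * √(v * L) = L := by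
      rw [← Real.sqrt_mul (by positivity), show L / v * (v * L) = L * L by field_simp,
        Real.sqrt_mul_self hL.le]
    have h2 : v * ((4 * √(L / v)) ^ 2 / 8) = 2 * L := by
      rw [mul_pow, Real.sq_sqrt (by positivity)]
      field_simp
      norm_num
    have h3 := mul_le_mul_of_nonneg_left hx.le (show 0 ≤ 4 * √(L / v) by positivity)
    rw [mul_assoc 4 (√(L / v)) (√(v * L)), h1] at h3
    linarith
  · exact Finset.sum_nonneg fun x _ => Finset.sum_nonneg fun B _ =>
      Finset.sum_nonneg fun m _ => hnn x B m

/-- A union bound over S A pairs, 2 ^ S sets and n values of the count, at episode starts. Inside an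
episode the event is frozen while the bound grows with n. -/
lemma E_outside_fst_le {L : ℝ} (hL : 0 < L) (n : ℕ) :
    R.E D (n := n) (fun h z => R.outside L h z.1) ≤
      Fintype.card S * Fintype.card A * 2 ^ Fintype.card S * n * Real.exp (-(2 * L))
        * R.mass D := by
  have hs : ∀ n, R.IsStart n → R.E D (n := n) (fun h z => R.outside L h z.1) ≤
      Fintype.card S * Fintype.card A * 2 ^ Fintype.card S * n * Real.exp (-(2 * L))
        * R.mass D := by
    intro n hn
    have hb : ∀ (x : S × A) (B : Finset S) (m : ℕ) (h : Fin (n + 1) → Rec S A),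
        BddMeas fun z : Θ × Θ => Real.exp (-(2 * L)) * R.expDev (4 * √(L / m)) x B h z.1 :=
      fun x B m h => ((R.bddMeas_expDev _ x B h).comp measurable_fst).const_mul _
    calc R.E D (n := n) (fun h z => R.outside L h z.1)
        ≤ R.E D (n := n) fun h z => ∑ x : S × A, ∑ B : Finset S, ∑ m ∈ Finset.Icc 1 n,
          Real.exp (-(2 * L)) * R.expDev (4 * √(L / m)) x B h z.1 :=
        R.E_mono (fun h => (R.bddMeas_outside L h).comp measurable_fst)
          (fun h => BddMeas.sum _ fun x _ => BddMeas.sum _ fun B _ => BddMeas.sum _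
            fun m _ => hb x B m h) fun h θ θ' _ => R.outside_le_sum hL hn h θ
      _ = ∑ x : S × A, ∑ B : Finset S, ∑ m ∈ Finset.Icc 1 n, Real.exp (-(2 * L)) *
          R.E D (n := n) (fun h z => R.expDev (4 * √(L / m)) x B h z.1) := by
        rw [R.E_sum _ fun x _ h => BddMeas.sum _ fun B _ => BddMeas.sum _ fun m _ => hb x B m h]
        refine Finset.sum_congr rfl fun x _ => ?_
        rw [R.E_sum _ fun B _ h => BddMeas.sum _ fun m _ => hb x B m h]
        refine Finset.sum_congr rfl fun B _ => ?_
        rw [R.E_sum _ fun m _ h => hb x B m h]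
        exact Finset.sum_congr rfl fun m _ => R.E_const_mul _
      _ ≤ ∑ x : S × A, ∑ B : Finset S, ∑ m ∈ Finset.Icc 1 n, Real.exp (-(2 * L)) * R.mass D :=
        Finset.sum_le_sum fun x _ => Finset.sum_le_sum fun B _ => Finset.sum_le_sum fun m _ =>
          mul_le_mul_of_nonneg_left (R.E_expDev_le _ x B n) (Real.exp_pos _).le
      _ = _ := by
        simp
        ring
  induction n with
  | zero => exact hs 0 R.isStart_zero
  | succ n ih =>
    by_cases hn : R.IsStart (n + 1)
    · exact hs _ hn
    · rw [R.E_push hn (f := fun h z => R.outside L h z.1)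
        (fun h => (R.bddMeas_outside L h).comp measurable_fst)
        fun h y => by simp only [R.outside_push L hn]]
      refine ih.trans ?_
      have := R.mass_nonneg (D := D)
      gcongr
      simp

/-- The confidence set depends only on data available when the parameter is sampled, so
exchangeability applies. -/
lemma E_outside_snd (L : ℝ) (n : ℕ) : R.E D (n := n) (fun h z => R.outside L h z.2)
    = R.E D (n := n) (fun h z => R.outside L h z.1) :=
  R.E_snd_eq_fst (f := fun _ h => R.outside L h) (fun _ h => R.bddMeas_outside L h)
    (fun _ h s π π' _ => R.outside_push_congr L h s π π')
    (fun _ h y hn => R.outside_push L hn h y) n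

/-- Two parameters in the confidence set have close transition probabilities. -/
lemma sum_sub_le_of_not_outside {L : ℝ} {h : Fin (n + 1) → Rec S A} {θ θ' : Θ}
    (hθ : ¬ R.Outside L h θ) (hθ' : ¬ R.Outside L h θ') (x : S × A)
    (hv : 0 < visits (episodeStart R.sched (episodeAt R.sched n)) h x) :
    ∑ s with R.M.P θ x.1 x.2 s ≤ R.M.P θ' x.1 x.2 s, (R.M.P θ' x.1 x.2 s - R.M.P θ x.1 x.2 s)
      ≤ 2 * √(L / visits (episodeStart R.sched (episodeAt R.sched n)) h x) := by
  simp only [Outside, not_exists, not_lt] at hθ hθ'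
  set j := episodeStart R.sched (episodeAt R.sched n)
  set B : Finset S := {s | R.M.P θ x.1 x.2 s ≤ R.M.P θ' x.1 x.2 s}
  have h1 := hθ x B
  -- For θ the bound is used on the set B where θ' has larger probabilities, and for θ' on its
  -- complement. In the sum of the two the empirical counts cancel.
  have h2 := hθ' x Bᶜ
  have h3 : (hits j h x Bᶜ : ℝ) = visits j h x - hits j h x B := by
    rw [← hits_add_hits_compl (j := j) h x B]
    push_cast
    ring
  rw [h3, R.probInto_compl] at h2
  have hv' : (0 : ℝ) < visits j h x := by exact_mod_cast hv
  rw [Finset.sum_sub_distrib]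
  change R.probInto θ' x B - R.probInto θ x B ≤ _
  set v : ℝ := ((visits j h x : ℕ) : ℝ)
  have h4 : √(v * L) = v * √(L / v) := by
    rw [show v * L = v ^ 2 * (L / v) by field_simp, Real.sqrt_mul (by positivity),
      Real.sqrt_sq hv'.le]
  rw [h4] at h1 h2
  have h5 : v * (R.probInto θ' x B - R.probInto θ x B) ≤ v * (2 * √(L / v)) := by linarith
  exact le_of_mul_le_mul_left h5 hv'

/-- The error term of a step is controlled by failures of the confidence sets, delayed updates,
mismatches and visit counts. -/
lemma mis_mul_sum_le {L η V : ℝ} (hL : 0 ≤ L) (hη : 0 < η) (hV : 0 ≤ V) {τ : ℕ}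
    (hτ : n < episodeStart R.sched (episodeAt R.sched n) + τ) (h : Fin (n + 1) → Rec S A)
    (θ θ' : Θ) {w : S → ℝ} (hw0 : ∀ s, 0 ≤ w s) (hw : ∀ s, w s ≤ V) :
    R.mis (θ, θ') * ∑ s, (R.M.P θ' (h (Fin.last n)).pair.1 (h (Fin.last n)).pair.2 s -
      R.M.P θ (h (Fin.last n)).pair.1 (h (Fin.last n)).pair.2 s) * w s ≤
    V * (R.outside L h θ + R.outside L h θ' +
      (if visits n h (h (Fin.last n)).pair < 2 * τ then 1 else 0) + η / 2 * R.mis (θ, θ') +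
      4 * L / η * (1 / (visits n h (h (Fin.last n)).pair + 1))) := by
  set x := (h (Fin.last n)).pair
  have h1 := sum_sub_mul_le (p := R.M.P θ x.1 x.2) (p' := R.M.P θ' x.1 x.2) hw0 hw
  have h2 := sum_filter_sub_le_one (R.M.P_mem θ x.1 x.2) (R.M.P_mem θ' x.1 x.2)
  have hm0 := R.mis_nonneg (θ, θ')
  have hm1 := R.mis_le_one (θ, θ')
  have hb := R.outside_nonneg L h θ
  have hb' := R.outside_nonneg L h θ'
  have hlag : (0 : ℝ) ≤ if visits n h x < 2 * τ then 1 else 0 := by split_ifs <;> norm_num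
  have hcnt : 0 ≤ 4 * L / η * (1 / ((visits n h x : ℝ) + 1)) := by positivity
  have hηm : 0 ≤ η / 2 * R.mis (θ, θ') := by positivity
  set σ := ∑ s with R.M.P θ x.1 x.2 s ≤ R.M.P θ' x.1 x.2 s,
    (R.M.P θ' x.1 x.2 s - R.M.P θ x.1 x.2 s)
  have hσ0 : 0 ≤ σ := Finset.sum_nonneg fun s hs => sub_nonneg.2 (Finset.mem_filter.1 hs).2
  refine (mul_le_mul_of_nonneg_left h1 hm0).trans ?_
  rw [mul_left_comm]
  refine mul_le_mul_of_nonneg_left ?_ hV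
  have hle : R.mis (θ, θ') * σ ≤ 1 := mul_le_one₀ hm1 hσ0 h2
  -- In the first three cases the crude bound `hle` is paid for by an indicator equal to one.
  by_cases c1 : R.Outside L h θ
  · rw [show R.outside L h θ = 1 from if_pos c1]
    linarith
  by_cases c2 : R.Outside L h θ'
  · rw [show R.outside L h θ' = 1 from if_pos c2]
    linarith
  by_cases c3 : visits n h x < 2 * τ
  · rw [if_pos c3] at hlag ⊢
    linarith
  have c4 := visits_le_add h x (episodeStart_episodeAt_le (sched := R.sched) n)
  have c4' := episodeStart_episodeAt_le (sched := R.sched) n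
  -- The frozen count lags by fewer than τ visits, so after 2 τ visits it is more than half of the
  -- current one.
  have c5 : visits n h x + 1 ≤ 2 * visits (episodeStart R.sched (episodeAt R.sched n)) h x := by
    omega
  have c6 := R.sum_sub_le_of_not_outside c1 c2 x (by omega)
  set v : ℝ := (visits (episodeStart R.sched (episodeAt R.sched n)) h x : ℝ) with hv
  have c7 : (visits n h x : ℝ) + 1 ≤ 2 * v := by
    rw [hv]
    exact_mod_cast c5
  have hvpos : 0 < v := by
    have : (0 : ℝ) ≤ visits n h x := Nat.cast_nonneg _
    linarith
  -- A weighted AM-GM inequality in place of Cauchy–Schwarz: the part η / 2 keeps the factor `mis`,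
  -- while the other part gives it up and becomes summable over visits.
  have c8 : 2 * √(L / v) ≤ η / 2 + 2 * (L / v) / η := by
    have := Real.sq_sqrt (show 0 ≤ L / v by positivity)
    have h8 : 0 ≤ (η / 2 - √(L / v)) ^ 2 * (2 / η) := by positivity
    have h9 : (η / 2 - √(L / v)) ^ 2 * (2 / η) = η / 2 + 2 * (√(L / v) ^ 2) / η - 2 * √(L / v) := by
      field_simp
      ring
    rw [this] at h9
    linarith
  have c9 : 2 * (L / v) / η ≤ 4 * L / η * (1 / ((visits n h x : ℝ) + 1)) := by
    have : 1 / v ≤ 2 * (1 / ((visits n h x : ℝ) + 1)) := by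
      rw [mul_one_div, div_le_div_iff₀ hvpos (by positivity)]
      linarith
    calc 2 * (L / v) / η = 2 * L / η * (1 / v) := by ring
      _ ≤ 2 * L / η * (2 * (1 / ((visits n h x : ℝ) + 1))) :=
        mul_le_mul_of_nonneg_left this (by positivity)
      _ = _ := by ring
  have c10 : R.mis (θ, θ') * σ ≤ R.mis (θ, θ') * (η / 2 +
      4 * L / η * (1 / ((visits n h x : ℝ) + 1))) :=
    mul_le_mul_of_nonneg_left (by linarith) hm0
  have c11 : R.mis (θ, θ') * (4 * L / η * (1 / ((visits n h x : ℝ) + 1)))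
      ≤ 4 * L / η * (1 / ((visits n h x : ℝ) + 1)) := mul_le_of_le_one_left hcnt hm1
  linarith

end Scenario

/-! ### Total mass of the paths, and telescoping with resets. -/

lemma sum_paths {S A : Type*} [Fintype S] [DecidableEq S] [Fintype A] (K : S → A → S → ℝ)
    (hK : ∀ s, ∑ a, ∑ s', K s a s' = 1) (s₀ : S) (N : ℕ) :
    ∑ D : Offline S A N, (if D.1 0 = s₀ then
      ∏ i : Fin N, K (D.1 i.castSucc) (D.2 i) (D.1 i.succ) else 0) = 1 := by
  induction N with
  | zero =>
    rw [Fintype.sum_prod_type, ← (Fin.snocEquiv fun _ : Fin 1 => S).sum_comp,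
      Fintype.sum_prod_type]
    simp [Fin.snocEquiv, Fin.snoc]
  | succ N ih =>
    rw [← ih, Fintype.sum_prod_type, Fintype.sum_prod_type,
      ← (Fin.snocEquiv fun _ : Fin (N + 2) => S).sum_comp, Fintype.sum_prod_type_right]
    refine Finset.sum_congr rfl fun σ _ => ?_
    have h1 : ∀ s, ∑ α : Fin (N + 1) → A, (if (Fin.snocEquiv fun _ : Fin (N + 2) => S) (s, σ) 0 = s₀ then
        ∏ i : Fin (N + 1), K ((Fin.snocEquiv fun _ : Fin (N + 2) => S) (s, σ) i.castSucc) (α i)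
          ((Fin.snocEquiv fun _ : Fin (N + 2) => S) (s, σ) i.succ) else 0)
        = ∑ α : Fin N → A, ∑ a, (if σ 0 = s₀ then
          (∏ i : Fin N, K (σ i.castSucc) (α i) (σ i.succ)) * K (σ (Fin.last N)) a s else 0) := by
      intro s
      rw [← (Fin.snocEquiv fun _ : Fin (N + 1) => A).sum_comp, Fintype.sum_prod_type_right]
      refine Finset.sum_congr rfl fun α _ => Finset.sum_congr rfl fun a _ => ?_
      have h2 : ∀ i, Fin.snoc (α := fun _ : Fin (N + 2) => S) σ s i.castSucc = σ i :=
        Fin.snoc_castSucc (α := fun _ => S) s σ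
      have h3 : ∀ i, Fin.snoc (α := fun _ : Fin (N + 1) => A) α a i.castSucc = α i :=
        Fin.snoc_castSucc (α := fun _ => A) a α
      have h4 : Fin.snoc (α := fun _ : Fin (N + 2) => S) σ s 0 = σ 0 := h2 0
      simp only [Fin.snocEquiv, Equiv.coe_fn_mk, Fin.prod_univ_castSucc, h4, h3, h2,
        Fin.snoc_last, Fin.succ_castSucc, Fin.succ_last]
    rw [Finset.sum_congr rfl fun s _ => h1 s, Finset.sum_comm]
    refine Finset.sum_congr rfl fun α _ => ?_
    rw [Finset.sum_comm]
    split_ifs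
    · simp only [← Finset.mul_sum, hK, mul_one]
    · simp

/-- Away from resets b (t + 1) cancels a t, so each block between resets leaves only its two ends,
worth at most 2 c. -/
lemma sum_sub_le_of_resets {a b : ℕ → ℝ} {c : ℝ} {p : ℕ → Prop} [DecidablePred p] (hp : p 0)
    (ha : ∀ t, a t ≤ c) (hb : ∀ t, -c ≤ b t) (hab : ∀ t, ¬ p (t + 1) → b (t + 1) = a t) (T : ℕ) :
    ∑ t ∈ Finset.range T, (a t - b t)
      ≤ 2 * c * ({t ∈ Finset.range T | p t} : Finset ℕ).card := by
  cases T with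
  | zero => simp
  | succ T =>
    -- The last term a T is kept, rather than bounded by c, so that the next step can still cancel
    -- it.
    suffices h : ∑ t ∈ Finset.range (T + 1), (a t - b t)
        ≤ a T + 2 * c * ({t ∈ Finset.range (T + 1) | p t} : Finset ℕ).card - c by
      linarith [ha T]
    induction T with
    | zero =>
      have := hb 0
      simp [Finset.filter_singleton, hp]
      linarith
    | succ T ih =>
      rw [Finset.sum_range_succ, Finset.range_add_one (n := T + 1), Finset.filter_insert]
      by_cases h : p (T + 1)
      · rw [if_pos h, Finset.card_insert_of_notMem (by simp)]
        push_cast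
        linarith [ha T, hb (T + 1)]
      · rw [if_neg h]
        linarith [hab T h]

/-! ### The regret decomposition and bounds for its terms. -/

namespace Scenario

variable {S A Θ : Type*} [Fintype S] [DecidableEq S] [Fintype A] [DecidableEq A]
  [MeasurableSpace Θ] (R : Scenario S A Θ) {N : ℕ} {D : Offline S A N} {n : ℕ}

/-- The relative value function normalized to have minimum zero. -/
noncomputable def bias (θ : Θ) (s : S) : ℝ :=
  relValue (R.M.P θ) R.M.r R.ŝ s +
    Finset.univ.sup' (Finset.univ_nonempty_iff.2 ⟨R.ŝ⟩) fun s' => -relValue (R.M.P θ) R.M.r R.ŝ s'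

/-- The optimal average reward. -/
noncomputable def gain (θ : Θ) : ℝ := optGain (R.M.P θ) R.M.r R.ŝ

lemma bddMeas_gain : BddMeas R.gain :=
  BddMeas.of_mem_Icc (measurable_optGain R.M R.communicating R.ŝ) fun θ =>
    (R.communicating θ).optGain_mem (R.M.P_mem θ) R.M.r_mem R.ŝ

/-- A greedy action attains equality in the average-reward Bellman equation, and this equation is
insensitive to the constant by which `bias` shifts the relative value. -/
lemma gain_eq {θ : Θ} {π : S → A} (hπ : R.solve θ = π) (s : S) :
    R.gain θ = R.M.r s (π s) + ∑ s', R.M.P θ s (π s) s' * R.bias θ s' - R.bias θ s := by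
  obtain ⟨h1, a, h2⟩ := (R.communicating θ).exists_qValue_eq (R.M.P_mem θ) R.M.r_mem R.ŝ s
  have h3 := R.oracle.greedy θ s a
  rw [hπ] at h3
  have h4 := h1 (π s)
  have h5 : qValue (R.M.P θ) R.M.r R.ŝ s (π s)
      = relValue (R.M.P θ) R.M.r R.ŝ s + R.gain θ := le_antisymm h4 (h2.trans h3)
  rw [qValue] at h5
  simp only [bias]
  rw [stdSimplex_sum_add_const (R.M.P_mem θ s (π s))]
  linarith

lemma bias_nonneg (θ : Θ) (s : S) : 0 ≤ R.bias θ s :=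
  neg_le_iff_add_nonneg'.1
    (Finset.le_sup' (fun s' => -relValue (R.M.P θ) R.M.r R.ŝ s') (Finset.mem_univ s))

/-- The parameter-dependent continuation value of the true environment. -/
noncomputable def drift (h : Fin (n + 1) → Rec S A) (θ : Θ) (f : S → ℝ) : ℝ :=
  ∑ s, R.M.P θ (h (Fin.last n)).1 ((h (Fin.last n)).2 (h (Fin.last n)).1) s * f s

/-- If the policies agree, the action is optimal for θ and only the increment of its own bias
remains. If they differ, the Bellman equation at this action is available for θ' only; replacing its
gain, bias and kernel by those of θ produces the other terms. -/
lemma gain_sub_reward (h : Fin (n + 1) → Rec S A) (θ θ' : Θ)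
    (hθ' : R.solve θ' = (h (Fin.last n)).2) :
    R.gain θ - R.M.r (h (Fin.last n)).1 ((h (Fin.last n)).2 (h (Fin.last n)).1) =
      R.mis (θ, θ') * (R.gain θ - R.gain θ') +
      (R.drift h θ (R.bias θ) - R.bias θ (h (Fin.last n)).1) +
      (R.drift h θ (fun s => R.mis (θ, θ') * (R.bias θ' s - R.bias θ s)) -
        R.mis (θ, θ') * (R.bias θ' (h (Fin.last n)).1 - R.bias θ (h (Fin.last n)).1)) +
      R.mis (θ, θ') * ∑ s, (R.M.P θ' (h (Fin.last n)).pair.1 (h (Fin.last n)).pair.2 s -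
        R.M.P θ (h (Fin.last n)).pair.1 (h (Fin.last n)).pair.2 s) * R.bias θ' s := by
  by_cases hm : R.solve θ = R.solve θ'
  · have h1 : R.mis (θ, θ') = 0 := if_pos hm
    simp only [h1, zero_mul, drift, mul_zero, Finset.sum_const_zero]
    rw [R.gain_eq (hm.trans hθ') (h (Fin.last n)).1]
    ring
  · have h1 : R.mis (θ, θ') = 1 := if_neg hm
    simp only [h1, one_mul, drift, mul_sub, sub_mul, Finset.sum_sub_distrib, Rec.pair]
    rw [R.gain_eq hθ' (h (Fin.last n)).1]
    ring

variable {V : ℝ}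
  (hv : ∀ θ s s', relValue (R.M.P θ) R.M.r R.ŝ s - relValue (R.M.P θ) R.M.r R.ŝ s' ≤ V)
include hv

lemma bias_le (θ : Θ) (s : S) : R.bias θ s ≤ V := by
  obtain ⟨s', -, hs'⟩ := Finset.exists_mem_eq_sup' (Finset.univ_nonempty_iff.2 ⟨R.ŝ⟩)
    fun s' => -relValue (R.M.P θ) R.M.r R.ŝ s'
  rw [bias, hs', ← sub_eq_add_neg]
  exact hv θ s s'

lemma bddMeas_bias (s : S) : BddMeas fun θ => R.bias θ s := by
  refine BddMeas.of_mem_Icc ?_ fun θ => ⟨R.bias_nonneg θ s, R.bias_le hv θ s⟩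
  refine (measurable_relValue R.M R.communicating R.ŝ s).add ?_
  have := Finset.measurable_sup' (Finset.univ_nonempty_iff.2 ⟨R.ŝ⟩)
    (f := fun s θ => -relValue (R.M.P θ) R.M.r R.ŝ s)
    fun s _ => (measurable_relValue R.M R.communicating R.ŝ s).neg
  convert this using 1
  ext θ
  rw [Finset.sup'_apply]

lemma bddMeas_drift_bias (h : Fin (n + 1) → Rec S A) :
    BddMeas fun θ => R.drift h θ (R.bias θ) :=
  BddMeas.sum _ fun s _ => (R.bddMeas_P _ _ _).mul (R.bddMeas_bias hv s)

lemma bddMeas_mis_mul_bias (s : S) :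
    BddMeas fun z : Θ × Θ => R.mis z * (R.bias z.2 s - R.bias z.1 s) :=
  R.bddMeas_mis.mul (((R.bddMeas_bias hv s).comp measurable_snd).sub
    ((R.bddMeas_bias hv s).comp measurable_fst))

lemma bddMeas_drift_mis (h : Fin (n + 1) → Rec S A) :
    BddMeas fun z : Θ × Θ =>
      R.drift h z.1 (fun s => R.mis z * (R.bias z.2 s - R.bias z.1 s)) :=
  BddMeas.sum _ fun s _ => ((R.bddMeas_P _ _ _).comp measurable_fst).mul
    (R.bddMeas_mis_mul_bias hv s)

lemma bddMeas_error (h : Fin (n + 1) → Rec S A) :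
    BddMeas fun z : Θ × Θ => R.mis z * ∑ s, (R.M.P z.2 (h (Fin.last n)).pair.1
      (h (Fin.last n)).pair.2 s - R.M.P z.1 (h (Fin.last n)).pair.1 (h (Fin.last n)).pair.2 s) *
        R.bias z.2 s :=
  R.bddMeas_mis.mul (BddMeas.sum _ fun s _ => (((R.bddMeas_P _ _ _).comp measurable_snd).sub
    ((R.bddMeas_P _ _ _).comp measurable_fst)).mul ((R.bddMeas_bias hv s).comp measurable_snd))

/-- The drift is the conditional mean of the bias at the next state, so the sum telescopes to its
two end values, which lie between 0 and V times the mass. -/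
lemma sum_E_drift_sub_bias_le (T : ℕ) :
    ∑ t ∈ Finset.range T, R.E D (n := t) (fun h z => R.drift h z.1 (R.bias z.1) -
      R.bias z.1 (h (Fin.last t)).1) ≤ V * R.mass D := by
  have h1 : ∀ t, R.E D (n := t) (fun h z => R.drift h z.1 (R.bias z.1) -
      R.bias z.1 (h (Fin.last t)).1) =
      R.E D (n := t + 1) (fun h z => R.bias z.1 (h (Fin.last (t + 1))).1) -
      R.E D (n := t) (fun h z => R.bias z.1 (h (Fin.last t)).1) := fun t => by
    rw [R.E_sub (fun h => (R.bddMeas_drift_bias hv h).comp measurable_fst)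
      (fun h => (R.bddMeas_bias hv _).comp measurable_fst),
      R.E_succ_fst (f := fun _ s θ => R.bias θ s) (fun _ s => R.bddMeas_bias hv s)
      (g := fun h θ => R.bias θ (h (Fin.last (t + 1))).1)
      fun h s π => by simp only [push_last]]
    rfl
  rw [Finset.sum_congr rfl fun t _ => h1 t, Finset.sum_range_sub
    (fun t => R.E D (n := t) (fun h z => R.bias z.1 (h (Fin.last t)).1))]
  have h2 : R.E D (n := T) (fun h z => R.bias z.1 (h (Fin.last T)).1) ≤ V * R.mass D := by
    rw [← R.E_const V T]
    exact R.E_mono (fun h => (R.bddMeas_bias hv _).comp measurable_fst)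
      (fun _ => BddMeas.const _) fun h θ _ _ => R.bias_le hv θ _
  have h3 : 0 ≤ R.E D (n := 0) (fun h z => R.bias z.1 (h (Fin.last 0)).1) := by
    rw [← zero_mul (R.mass D), ← R.E_const 0 0]
    exact R.E_mono (fun _ => BddMeas.const _)
      (fun h => (R.bddMeas_bias hv _).comp measurable_fst) fun h θ _ _ => R.bias_nonneg θ _
  linarith

/-- The same telescoping is available only while θ' is kept, so each episode start costs twice the
bound V times the mismatch probability. -/
lemma sum_E_mis_drift_le (hV : 0 ≤ V) (T : ℕ) :
    ∑ t ∈ Finset.range T, R.E D (n := t) (fun h z =>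
      R.drift h z.1 (fun s => R.mis z * (R.bias z.2 s - R.bias z.1 s)) -
        R.mis z * (R.bias z.2 (h (Fin.last t)).1 - R.bias z.1 (h (Fin.last t)).1)) ≤
      2 * (V * R.E D (n := 0) (fun _ => R.mis)) *
        ({t ∈ Finset.range T | R.IsStart t} : Finset ℕ).card := by
  have hd : ∀ z s, -(V * R.mis z) ≤ R.mis z * (R.bias z.2 s - R.bias z.1 s) ∧
      R.mis z * (R.bias z.2 s - R.bias z.1 s) ≤ V * R.mis z := fun z s => by
    have h1 := R.bias_le hv z.1 s
    have h2 := R.bias_le hv z.2 s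
    have h3 := R.bias_nonneg z.1 s
    have h4 := R.bias_nonneg z.2 s
    have h5 := R.mis_nonneg z
    constructor <;> nlinarith
  have hmis := fun t => mul_le_mul_of_nonneg_left (R.E_mis_le (D := D) t) hV
  have hb : ∀ (c : ℝ) t (_ : Fin (t + 1) → Rec S A), BddMeas fun z => c * R.mis z := fun c t _ =>
    R.bddMeas_mis.const_mul c
  rw [Finset.sum_congr rfl fun t _ => R.E_sub (fun h => R.bddMeas_drift_mis hv h)
    (fun h => R.bddMeas_mis_mul_bias hv _)]
  refine sum_sub_le_of_resets (p := R.IsStart) R.isStart_zero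
    (b := fun t => R.E D (n := t) fun h z => R.mis z * (R.bias z.2 (h (Fin.last t)).1 -
      R.bias z.1 (h (Fin.last t)).1))
    (fun t => ?_) (fun t => ?_) (fun t ht => ?_) T
  · refine le_trans ?_ (hmis t)
    rw [← R.E_const_mul]
    exact R.E_mono (fun h => R.bddMeas_drift_mis hv h) (hb V t) fun h θ θ' _ =>
      stdSimplex_sum_le (R.M.P_mem θ _ _) fun s => (hd (θ, θ') s).2
  · have h1 : R.E D (n := t) (fun _ z => (-V) * R.mis z) ≤ R.E D (n := t) fun h z =>
        R.mis z * (R.bias z.2 (h (Fin.last t)).1 - R.bias z.1 (h (Fin.last t)).1) :=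
      R.E_mono (hb (-V) t) (fun h => R.bddMeas_mis_mul_bias hv _) fun h θ θ' _ => by
        linarith [(hd (θ, θ') (h (Fin.last t)).1).1]
    rw [R.E_const_mul] at h1
    linarith [hmis t]
  · exact R.E_succ ht (f := fun _ s z => R.mis z * (R.bias z.2 s - R.bias z.1 s))
      (fun _ s => R.bddMeas_mis_mul_bias hv s)
      (g := fun h z => R.mis z * (R.bias z.2 (h (Fin.last (t + 1))).1 -
        R.bias z.1 (h (Fin.last (t + 1))).1)) (fun h s => by simp only [push_last])
      fun h => R.bddMeas_mis_mul_bias hv _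

/-- The error due to the difference of the true and of the sampled transition kernels. -/
noncomputable def error (D : Offline S A N) (T : ℕ) : ℝ :=
  ∑ t ∈ Finset.range T, R.E D (n := t) fun h z => R.mis z * ∑ s,
    (R.M.P z.2 (h (Fin.last t)).pair.1 (h (Fin.last t)).pair.2 s -
      R.M.P z.1 (h (Fin.last t)).pair.1 (h (Fin.last t)).pair.2 s) * R.bias z.2 s

lemma sum_E_regret_le (hV : 0 ≤ V) (T : ℕ) :
    ∑ t ∈ Finset.range T, R.E D (n := t) (fun h z => R.gain z.1 -
      R.M.r (h (Fin.last t)).1 ((h (Fin.last t)).2 (h (Fin.last t)).1)) ≤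
    V * R.mass D + 2 * (V * R.E D (n := 0) (fun _ => R.mis)) *
        ({t ∈ Finset.range T | R.IsStart t} : Finset ℕ).card + R.error D T := by
  have h1 : ∀ t, R.E D (n := t) (fun h z => R.gain z.1 -
      R.M.r (h (Fin.last t)).1 ((h (Fin.last t)).2 (h (Fin.last t)).1)) =
      R.E D (n := t) (fun h z => R.drift h z.1 (R.bias z.1) - R.bias z.1 (h (Fin.last t)).1) +
      R.E D (n := t) (fun h z =>
      R.drift h z.1 (fun s => R.mis z * (R.bias z.2 s - R.bias z.1 s)) -
        R.mis z * (R.bias z.2 (h (Fin.last t)).1 - R.bias z.1 (h (Fin.last t)).1)) +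
      R.E D (n := t) (fun h z => R.mis z * ∑ s,
        (R.M.P z.2 (h (Fin.last t)).pair.1 (h (Fin.last t)).pair.2 s -
        R.M.P z.1 (h (Fin.last t)).pair.1 (h (Fin.last t)).pair.2 s) * R.bias z.2 s) := by
    intro t
    have b1 : ∀ _ : Fin (t + 1) → Rec S A,
        BddMeas fun z : Θ × Θ => R.mis z * (R.gain z.1 - R.gain z.2) := fun _ =>
      R.bddMeas_mis.mul ((R.bddMeas_gain.comp measurable_fst).sub
        (R.bddMeas_gain.comp measurable_snd))
    have b2 := fun h : Fin (t + 1) → Rec S A => ((R.bddMeas_drift_bias hv h).sub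
      (R.bddMeas_bias hv (h (Fin.last t)).1)).comp (measurable_fst (α := Θ) (β := Θ))
    have b3 := fun h : Fin (t + 1) → Rec S A => (R.bddMeas_drift_mis hv h).sub
      (R.bddMeas_mis_mul_bias hv (h (Fin.last t)).1)
    refine (R.E_congr (G := fun h z => R.mis z * (R.gain z.1 - R.gain z.2) +
      (R.drift h z.1 (R.bias z.1) - R.bias z.1 (h (Fin.last t)).1) +
      (R.drift h z.1 (fun s => R.mis z * (R.bias z.2 s - R.bias z.1 s)) -
        R.mis z * (R.bias z.2 (h (Fin.last t)).1 - R.bias z.1 (h (Fin.last t)).1)) +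
      R.mis z * ∑ s, (R.M.P z.2 (h (Fin.last t)).pair.1 (h (Fin.last t)).pair.2 s -
        R.M.P z.1 (h (Fin.last t)).pair.1 (h (Fin.last t)).pair.2 s) * R.bias z.2 s)
      fun h θ θ' hθ' => R.gain_sub_reward h θ θ' hθ').trans ?_
    rw [R.E_add (fun h => ((b1 h).add (b2 h)).add (b3 h)) (fun h => R.bddMeas_error hv h),
      R.E_add (fun h => (b1 h).add (b2 h)) b3, R.E_add b1 b2, R.E_mis_mul_sub R.bddMeas_gain,
      zero_add]
  rw [Finset.sum_congr rfl fun t _ => h1 t, Finset.sum_add_distrib, Finset.sum_add_distrib]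
  exact add_le_add_left (add_le_add (R.sum_E_drift_sub_bias_le hv T)
    (R.sum_E_mis_drift_le hv hV T)) _

/-- A crude bound, total variation being at most one; it serves when the horizon is too short for
the confidence sets to help. -/
lemma error_le_mismatch (hV : 0 ≤ V) (T : ℕ) :
    R.error D T ≤ V * (T * R.E D (n := 0) (fun _ => R.mis)) := by
  have h1 : ∀ t ∈ Finset.range T, R.E D (n := t) (fun h z => R.mis z * ∑ s,
      (R.M.P z.2 (h (Fin.last t)).pair.1 (h (Fin.last t)).pair.2 s -
      R.M.P z.1 (h (Fin.last t)).pair.1 (h (Fin.last t)).pair.2 s) * R.bias z.2 s) ≤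
      V * R.E D (n := 0) (fun _ => R.mis) := fun t _ => by
    refine le_trans ?_ (mul_le_mul_of_nonneg_left (R.E_mis_le (D := D) t) hV)
    rw [← R.E_const_mul]
    refine R.E_mono (fun h => R.bddMeas_error hv h) (fun h => R.bddMeas_mis.const_mul V)
      fun h θ θ' _ => ?_
    rw [mul_comm V]
    refine mul_le_mul_of_nonneg_left ?_ (R.mis_nonneg _)
    refine (sum_sub_mul_le (R.bias_nonneg θ') (R.bias_le hv θ')).trans ?_
    exact mul_le_of_le_one_right hV (sum_filter_sub_le_one (R.M.P_mem _ _ _) (R.M.P_mem _ _ _))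
  refine (Finset.sum_le_sum h1).trans (le_of_eq ?_)
  rw [Finset.sum_const, Finset.card_range, nsmul_eq_mul]
  ring

/-- `mis_mul_sum_le` summed over time. The last two visit terms are increments of potentials: φ₁ m =
min m (2 τ) counts the early visits to a pair, and φ₂ is the harmonic sum, which yields 1 + log T.
-/
lemma error_le {L η : ℝ} (hL : 0 < L) (hη : 0 < η) (hV : 0 ≤ V) {T τ : ℕ}
    (hτ : ∀ t < T, t < episodeStart R.sched (episodeAt R.sched t) + τ) :
    R.error D T ≤ V * (2 * (T * (Fintype.card S * Fintype.card A * 2 ^ Fintype.card S * T *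
        Real.exp (-(2 * L)) * R.mass D)) +
      Fintype.card S * Fintype.card A * (2 * τ) * R.mass D +
      η / 2 * (T * R.E D (n := 0) (fun _ => R.mis)) +
      4 * L / η * (Fintype.card S * Fintype.card A * (1 + Real.log T) * R.mass D)) := by
  set φ₁ : ℕ → ℝ := fun m => ((min m (2 * τ) : ℕ) : ℝ) with hφ₁
  set φ₂ : ℕ → ℝ := fun m => ∑ i ∈ Finset.range m, 1 / ((i : ℝ) + 1) with hφ₂
  have hφ₁d : ∀ m : ℕ, φ₁ (m + 1) - φ₁ m = if m < 2 * τ then 1 else 0 := fun m => by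
    simp only [hφ₁]
    split_ifs with h
    · rw [min_eq_left h.le, min_eq_left (show m + 1 ≤ 2 * τ from h)]
      push_cast
      ring
    · rw [min_eq_right (by omega), min_eq_right (by omega), sub_self]
  have hφ₂d : ∀ m : ℕ, φ₂ (m + 1) - φ₂ m = 1 / ((m : ℝ) + 1) := fun m => by
    simp only [hφ₂, Finset.sum_range_succ]
    ring
  have hφ₁m : Monotone φ₁ := fun m m' h => by
    simp only [hφ₁]
    exact_mod_cast min_le_min_right _ h
  have hφ₂m : Monotone φ₂ := monotone_nat_of_le_succ fun m => by
    have := hφ₂d m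
    have h0 : 0 ≤ 1 / ((m : ℝ) + 1) := by positivity
    linarith
  have hφ₁T : φ₁ T ≤ 2 * τ := by
    simp only [hφ₁]
    exact_mod_cast min_le_right _ _
  have hφ₂T : φ₂ T ≤ 1 + Real.log T := by
    refine le_trans (le_of_eq ?_) (harmonic_le_one_add_log T)
    simp [hφ₂, harmonic]
  have hm := R.mass_nonneg (D := D)
  have h1 : ∀ t ∈ Finset.range T, R.E D (n := t) (fun h z => R.mis z * ∑ s,
      (R.M.P z.2 (h (Fin.last t)).pair.1 (h (Fin.last t)).pair.2 s -
      R.M.P z.1 (h (Fin.last t)).pair.1 (h (Fin.last t)).pair.2 s) * R.bias z.2 s) ≤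
      V * (2 * (Fintype.card S * Fintype.card A * 2 ^ Fintype.card S * T *
        Real.exp (-(2 * L)) * R.mass D) + R.E D (n := t) (fun h _ =>
          φ₁ (visits t h (h (Fin.last t)).pair + 1) - φ₁ (visits t h (h (Fin.last t)).pair)) +
        η / 2 * R.E D (n := 0) (fun _ => R.mis) +
        4 * L / η * R.E D (n := t) (fun h _ =>
          φ₂ (visits t h (h (Fin.last t)).pair + 1) - φ₂ (visits t h (h (Fin.last t)).pair))) := by
    intro t ht
    rw [Finset.mem_range] at ht
    have b1 := fun h : Fin (t + 1) → Rec S A =>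
      (R.bddMeas_outside L h).comp (measurable_fst (α := Θ) (β := Θ))
    have b2 := fun h : Fin (t + 1) → Rec S A =>
      (R.bddMeas_outside L h).comp (measurable_snd (α := Θ) (β := Θ))
    have b3 := fun h : Fin (t + 1) → Rec S A => BddMeas.const (α := Θ × Θ)
      (φ₁ (visits t h (h (Fin.last t)).pair + 1) - φ₁ (visits t h (h (Fin.last t)).pair))
    have b4 := fun _ : Fin (t + 1) → Rec S A => R.bddMeas_mis.const_mul (η / 2)
    have b5 := fun h : Fin (t + 1) → Rec S A => (BddMeas.const (α := Θ × Θ)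
      (φ₂ (visits t h (h (Fin.last t)).pair + 1) -
        φ₂ (visits t h (h (Fin.last t)).pair))).const_mul (4 * L / η)
    have h2 : R.E D (n := t) (fun h z => R.mis z * ∑ s,
        (R.M.P z.2 (h (Fin.last t)).pair.1 (h (Fin.last t)).pair.2 s -
        R.M.P z.1 (h (Fin.last t)).pair.1 (h (Fin.last t)).pair.2 s) * R.bias z.2 s) ≤
        R.E D (n := t) (fun h z => V * (R.outside L h z.1 + R.outside L h z.2 +
          (φ₁ (visits t h (h (Fin.last t)).pair + 1) - φ₁ (visits t h (h (Fin.last t)).pair)) +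
          η / 2 * R.mis z + 4 * L / η * (φ₂ (visits t h (h (Fin.last t)).pair + 1) -
            φ₂ (visits t h (h (Fin.last t)).pair)))) := by
      refine R.E_mono (fun h => R.bddMeas_error hv h)
        (fun h => (((((b1 h).add (b2 h)).add (b3 h)).add (b4 h)).add (b5 h)).const_mul V)
        fun h θ θ' _ => ?_
      rw [hφ₁d, hφ₂d]
      exact R.mis_mul_sum_le hL.le hη hV (hτ t ht) h θ θ' (R.bias_nonneg θ') (R.bias_le hv θ')
    refine h2.trans ?_
    rw [R.E_const_mul, R.E_add (fun h => (((b1 h).add (b2 h)).add (b3 h)).add (b4 h)) b5,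
      R.E_add (fun h => ((b1 h).add (b2 h)).add (b3 h)) b4,
      R.E_add (fun h => (b1 h).add (b2 h)) b3, R.E_add b1 b2, R.E_const_mul, R.E_const_mul,
      R.E_outside_snd]
    have h3 := R.E_outside_fst_le (D := D) hL t
    have h4 : (Fintype.card S : ℝ) * Fintype.card A * 2 ^ Fintype.card S * t *
        Real.exp (-(2 * L)) * R.mass D ≤ Fintype.card S * Fintype.card A * 2 ^ Fintype.card S * T *
        Real.exp (-(2 * L)) * R.mass D := by
      have : (t : ℝ) ≤ T := by exact_mod_cast ht.le
      gcongr
    have h5 := mul_le_mul_of_nonneg_left (R.E_mis_le (D := D) t) (show 0 ≤ η / 2 by positivity)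
    refine mul_le_mul_of_nonneg_left ?_ hV
    linarith
  refine (Finset.sum_le_sum h1).trans ?_
  rw [← Finset.mul_sum]
  refine mul_le_mul_of_nonneg_left ?_ hV
  simp only [Finset.sum_add_distrib, ← Finset.mul_sum, Finset.sum_const, Finset.card_range,
    nsmul_eq_mul]
  have h6 := R.sum_E_visits_le (D := D) (φ := φ₁) (by simp [hφ₁]) hφ₁m T
  have h7 := R.sum_E_visits_le (D := D) (φ := φ₂) (by simp [hφ₂]) hφ₂m T
  have h8 : (Fintype.card S : ℝ) * Fintype.card A * φ₁ T * R.mass D ≤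
      Fintype.card S * Fintype.card A * (2 * τ) * R.mass D := by gcongr
  have h9 : (Fintype.card S : ℝ) * Fintype.card A * φ₂ T * R.mass D ≤
      Fintype.card S * Fintype.card A * (1 + Real.log T) * R.mass D := by gcongr
  have h10 := mul_le_mul_of_nonneg_left (h7.trans h9) (show 0 ≤ 4 * L / η by positivity)
  linarith [h6.trans h8]

end Scenario

/-! ### Summation over the offline data. -/

namespace Scenario

variable {S A Θ : Type*} [Fintype S] [DecidableEq S] [Fintype A] [DecidableEq A]
  [MeasurableSpace Θ] (R : Scenario S A Θ) (N : ℕ) (D : Offline S A N)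

lemma sum_offlineProb (θ : Θ) :
    ∑ D : Offline S A N, offlineProb R.M R.ŝ R.β R.s₀ θ D = 1 :=
  sum_paths (fun s a s' => R.M.P θ s a s' * expertPolicy (R.M.P θ) R.M.r R.ŝ R.β s a)
    (fun s => by simp only [← Finset.sum_mul, (R.M.P_mem _ _ _).2, one_mul,
      (R.expertPolicy_mem θ s).2]) R.s₀ N

lemma mass_eq : R.mass D = ∫ θ, offlineProb R.M R.ŝ R.β R.s₀ θ D ∂(R.μ₀) := by
  have := R.integral_prior D fun _ => 1
  simpa [mass] using this

lemma sum_mass : ∑ D : Offline S A N, R.mass D = 1 := by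
  simp only [mass_eq]
  rw [← integral_finsetSum _ fun D _ => (R.bddMeas_offlineProb D).integrable _]
  simp [R.sum_offlineProb]

/-- At time 0 the belief is the posterior given the offline data, whatever the first online record
is. -/
lemma E_mis_zero : R.E D (n := 0) (fun _ => R.mis) =
    ∫ θ, offlineProb R.M R.ŝ R.β R.s₀ θ D *
      (bayesUpdate R.μ₀ (offlineLik R.M R.ŝ R.β D)).real {θ' | R.solve θ' ≠ R.solve θ}
        ∂(R.μ₀) := by
  set p := bayesUpdate R.μ₀ (offlineLik R.M R.ŝ R.β D) with hp
  have hprob : IsProbabilityMeasure p :=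
    isProbabilityMeasure_bayesUpdate (R.bddMeas_offlineLik D)
  have hpost : ∀ h : Fin 1 → Rec S A, R.post D h = p := fun h => by
    have : episodeAt R.sched 0 = 1 := episodeAt_eq R.sched_pos (by rw [episodeStart_one])
      (Nat.lt_of_lt_of_le Nat.zero_lt_one (le_episodeStart_succ R.sched_pos 1))
    rw [post, this]
    rfl
  have hg : ∀ θ, p.real {θ' | R.solve θ' ≠ R.solve θ} = ∫ θ', R.mis (θ, θ') ∂p := fun θ => by
    have h1 : ∀ θ', R.mis (θ, θ') = {θ' | R.solve θ' ≠ R.solve θ}.indicator (fun _ => 1) θ' := by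
      intro θ'
      simp only [mis, Set.indicator_apply, Set.mem_ofPred_eq, ne_eq, ite_not,
        eq_comm (a := R.solve θ)]
    simp only [h1]
    have hm : MeasurableSet {θ' | R.solve θ' ≠ R.solve θ} :=
      (R.oracle.measurable (R.solve θ)).compl
    rw [integral_indicator hm]
    simp
  have hb := R.bddMeas_mis.integral_right p
  rw [← R.integral_prior D fun θ => p.real {θ' | R.solve θ' ≠ R.solve θ}]
  simp only [hg]
  rw [← R.E_fst_const hb 0, R.E_start R.isStart_zero
    (fun _ => hb.comp measurable_fst) fun _ _ _ _ => rfl, R.E_start R.isStart_zero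
    (fun _ => R.bddMeas_mis) fun _ _ _ _ => rfl]
  refine Finset.sum_congr rfl fun h _ => ?_
  rw [hpost, integral_prod _ (R.bddMeas_mis.integrable _),
    integral_fun_fst (fun θ => ∫ θ', R.mis (θ, θ') ∂p)]
  simp

lemma sum_E_mis_zero : ∑ D : Offline S A N, R.E D (n := 0) (fun _ => R.mis) =
    initialMismatch R.M R.ŝ R.β R.μ₀ R.solve N R.s₀ := by
  have hb : ∀ D : Offline S A N, BddMeas fun θ =>
      (bayesUpdate R.μ₀ (offlineLik R.M R.ŝ R.β D)).real {θ' | R.solve θ' ≠ R.solve θ} := by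
    intro D
    let _ : MeasurableSpace (S → A) := ⊤
    have hm : Measurable R.solve := measurable_to_countable' fun π => R.oracle.measurable π
    have hprob : IsProbabilityMeasure (bayesUpdate R.μ₀ (offlineLik R.M R.ŝ R.β D)) :=
      isProbabilityMeasure_bayesUpdate (R.bddMeas_offlineLik D)
    exact BddMeas.of_mem_Icc (a := 0) (b := 1) ((measurable_from_top (f := fun π =>
      (bayesUpdate R.μ₀ (offlineLik R.M R.ŝ R.β D)).real {θ' | R.solve θ' ≠ π})).comp hm)
      fun θ => ⟨measureReal_nonneg, measureReal_le_one⟩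
  rw [initialMismatch, integral_finsetSum _ fun D _ =>
    ((R.bddMeas_offlineProb D).mul (hb D)).integrable _]
  exact Finset.sum_congr rfl fun D _ => R.E_mis_zero N D

/-- The trajectory and offline probabilities both have total mass one, which allows the gain to be
moved under the sums. -/
lemma regret_eq (T : ℕ) (θ : Θ) : regret R.M R.ŝ R.β R.μ₀ R.solve R.sched N R.s₀ T θ =
    ∑ D : Offline S A N, ∑ t ∈ Finset.range T, ∑ h : Fin (t + 1) → Rec S A,
      offlineProb R.M R.ŝ R.β R.s₀ θ D * (R.traj D h θ * (R.gain θ -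
        R.M.r (h (Fin.last t)).1 ((h (Fin.last t)).2 (h (Fin.last t)).1))) := by
  rw [Finset.sum_comm]
  simp only [mul_sub, Finset.sum_sub_distrib, ← Finset.mul_sum, ← Finset.sum_mul, R.sum_traj,
    one_mul, R.sum_offlineProb, Finset.sum_const, Finset.card_range, nsmul_eq_mul]
  rfl

lemma bddMeas_regret_term {t : ℕ} (h : Fin (t + 1) → Rec S A) :
    BddMeas fun θ => R.traj D h θ * (R.gain θ -
      R.M.r (h (Fin.last t)).1 ((h (Fin.last t)).2 (h (Fin.last t)).1)) :=
  (R.bddMeas_traj D h).mul (R.bddMeas_gain.sub (BddMeas.const _))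

lemma integrable_regret (T : ℕ) :
    Integrable (regret R.M R.ŝ R.β R.μ₀ R.solve R.sched N R.s₀ T) R.μ₀ := by
  rw [funext (R.regret_eq N T)]
  exact (BddMeas.sum _ fun D _ => BddMeas.sum _ fun t _ => BddMeas.sum _ fun h _ =>
    (R.bddMeas_offlineProb D).mul (R.bddMeas_regret_term N D h)).integrable _

lemma bayesRegret_eq (T : ℕ) : bayesRegret R.M R.ŝ R.β R.μ₀ R.solve R.sched N R.s₀ T =
    ∑ D : Offline S A N, ∑ t ∈ Finset.range T, R.E D (n := t) (fun h z => R.gain z.1 -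
      R.M.r (h (Fin.last t)).1 ((h (Fin.last t)).2 (h (Fin.last t)).1)) := by
  have hb := fun (D : Offline S A N) (t : ℕ) (h : Fin (t + 1) → Rec S A) =>
    (R.bddMeas_offlineProb D).mul (R.bddMeas_regret_term N D h)
  rw [bayesRegret, funext (R.regret_eq N T), integral_finsetSum _ fun D _ =>
    (BddMeas.sum _ fun t _ => BddMeas.sum _ fun h _ => hb D t h).integrable _]
  refine Finset.sum_congr rfl fun D _ => ?_
  rw [integral_finsetSum _ fun t _ => (BddMeas.sum _ fun h _ => hb D t h).integrable _]
  refine Finset.sum_congr rfl fun t _ => ?_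
  rw [integral_finsetSum _ fun h _ => (hb D t h).integrable _,
    R.E_fst (f := fun h θ => R.gain θ -
      R.M.r (h (Fin.last t)).1 ((h (Fin.last t)).2 (h (Fin.last t)).1))
      fun h => R.bddMeas_gain.sub (BddMeas.const _)]
  exact Finset.sum_congr rfl fun h _ => (R.integral_prior D _).symm

variable {V : ℝ}
  (hv : ∀ θ s s', relValue (R.M.P θ) R.M.r R.ŝ s - relValue (R.M.P θ) R.M.r R.ŝ s' ≤ V)
include hv

lemma bayesRegret_le (hV : 0 ≤ V) (T : ℕ) :
    bayesRegret R.M R.ŝ R.β R.μ₀ R.solve R.sched N R.s₀ T ≤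
      V + 2 * (V * initialMismatch R.M R.ŝ R.β R.μ₀ R.solve N R.s₀) *
        ({t ∈ Finset.range T | R.IsStart t} : Finset ℕ).card +
        ∑ D : Offline S A N, R.error D T := by
  rw [bayesRegret_eq]
  refine (Finset.sum_le_sum fun D _ => R.sum_E_regret_le hv hV T).trans (le_of_eq ?_)
  rw [Finset.sum_add_distrib, Finset.sum_add_distrib, ← Finset.mul_sum, R.sum_mass, mul_one,
    ← Finset.sum_mul, ← Finset.mul_sum, ← Finset.mul_sum, R.sum_E_mis_zero]

lemma sum_error_le_mismatch (hV : 0 ≤ V) (T : ℕ) : ∑ D : Offline S A N, R.error D T ≤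
    V * (T * initialMismatch R.M R.ŝ R.β R.μ₀ R.solve N R.s₀) := by
  refine (Finset.sum_le_sum fun D _ => R.error_le_mismatch hv hV T).trans (le_of_eq ?_)
  rw [← Finset.mul_sum, ← Finset.mul_sum, R.sum_E_mis_zero]

lemma sum_error_le {L η : ℝ} (hL : 0 < L) (hη : 0 < η) (hV : 0 ≤ V) {T τ : ℕ}
    (hτ : ∀ t < T, t < episodeStart R.sched (episodeAt R.sched t) + τ) :
    ∑ D : Offline S A N, R.error D T ≤ V *
      (2 * (T * (Fintype.card S * Fintype.card A * 2 ^ Fintype.card S * T * Real.exp (-(2 * L)))) +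
      Fintype.card S * Fintype.card A * (2 * τ) +
      η / 2 * (T * initialMismatch R.M R.ŝ R.β R.μ₀ R.solve N R.s₀) +
      4 * L / η * (Fintype.card S * Fintype.card A * (1 + Real.log T))) := by
  refine (Finset.sum_le_sum fun D _ => R.error_le hv hL hη hV hτ).trans (le_of_eq ?_)
  simp only [← Finset.mul_sum, Finset.sum_add_distrib, R.sum_E_mis_zero, R.sum_mass, mul_one]

end Scenario

/-! ### Estimates for the schedule and the confidence level. -/

section Numerics

variable {e : ℝ}

/-- The sum of e j over j < k is e k (k - 1) / 2; the weaker square is easier to invert. -/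
lemma le_episodeStart_ceil (he : 0 < e) {k : ℕ} (hk : 1 ≤ k) :
    e * ((k : ℝ) - 1) ^ 2 ≤ 2 * episodeStart (fun j => ⌈e * j⌉₊) k := by
  suffices h : e * ((k : ℝ) * (k - 1)) ≤ 2 * episodeStart (fun j => ⌈e * j⌉₊) k by
    have hk' : (1 : ℝ) ≤ k := by exact_mod_cast hk
    nlinarith [mul_nonneg he.le (sub_nonneg.2 hk')]
  induction k, hk using Nat.le_induction with
  | base => simp
  | succ k hk ih =>
    rw [episodeStart_succ hk]
    have := Nat.le_ceil (e * (k : ℝ))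
    push_cast
    linarith

/-- Bound for the index of an episode. -/
lemma episodeAt_ceil_le (he : 0 < e) {t T : ℕ} (ht : t < T) :
    (episodeAt (fun j => ⌈e * j⌉₊) t : ℝ) ≤ 1 + √(2 * T / e) := by
  have h1 := le_episodeStart_ceil he (one_le_episodeAt (sched := fun j => ⌈e * j⌉₊) t)
  have h2 : (episodeStart (fun j => ⌈e * j⌉₊) (episodeAt (fun j => ⌈e * j⌉₊) t) : ℝ) ≤ T := by
    exact_mod_cast (episodeStart_episodeAt_le t).trans ht.le
  rw [← sub_le_iff_le_add']
  refine Real.le_sqrt_of_sq_le ?_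
  rw [le_div_iff₀ he]
  linarith

/-- The choice L = s + log (s a T): the factor exp (-2 s) absorbs the 2 ^ s sets, and (s a T) ^ (-2)
absorbs the pairs and both factors T. -/
lemma exp_neg_mul_le {s a T : ℕ} (hs : 1 ≤ s) (ha : 1 ≤ a) (hT : 1 ≤ T) :
    (T : ℝ) * (s * a * 2 ^ s * T * Real.exp (-(2 * (s + Real.log (s * a * T))))) ≤ 1 := by
  have hs' : (1 : ℝ) ≤ s := by exact_mod_cast hs
  have ha' : (1 : ℝ) ≤ a := by exact_mod_cast ha
  have hT' : (1 : ℝ) ≤ T := by exact_mod_cast hT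
  have h1 : Real.exp (2 * (s + Real.log (s * a * T))) = Real.exp 2 ^ s * (s * a * T) ^ 2 := by
    rw [mul_add, Real.exp_add, ← Real.exp_nat_mul, mul_comm (s : ℝ) 2, mul_comm 2 (Real.log _),
      ← Real.rpow_two, Real.rpow_def_of_pos (by positivity)]
  rw [Real.exp_neg, h1, ← mul_assoc, ← div_eq_mul_inv, div_le_one (by positivity)]
  have h2 : (2 : ℝ) ^ s ≤ Real.exp 2 ^ s :=
    pow_le_pow_left₀ (by norm_num) (by linarith [Real.add_one_le_exp (2 : ℝ)]) s
  have h3 : (1 : ℝ) ≤ s * a := one_le_mul_of_one_le_of_one_le hs' ha'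
  calc (T : ℝ) * (s * a * 2 ^ s * T) = 2 ^ s * ((s * a) * T ^ 2 * 1) := by ring
    _ ≤ Real.exp 2 ^ s * ((s * a) * T ^ 2 * (s * a)) := by gcongr
    _ = Real.exp 2 ^ s * (s * a * T) ^ 2 := by ring

end Numerics

/-! ### The final bound. -/

namespace Scenario

variable {S A Θ : Type*} [Fintype S] [DecidableEq S] [Fintype A] [DecidableEq A]
  [MeasurableSpace Θ] (R : Scenario S A Θ) (N : ℕ)

lemma card_isStart_le {k T : ℕ} (hk : ∀ t < T, episodeAt R.sched t ≤ k) :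
    ({t ∈ Finset.range T | R.IsStart t} : Finset ℕ).card ≤ k := by
  have h1 : ({t ∈ Finset.range T | R.IsStart t} : Finset ℕ).card ≤ (Finset.Icc 1 k).card := by
    refine Finset.card_le_card_of_injOn (episodeAt R.sched) (fun t ht => ?_)
      fun t ht t' ht' h => ?_
    · have ht := Finset.mem_filter.1 (Finset.mem_coe.1 ht)
      exact Finset.mem_coe.2 (Finset.mem_Icc.2
        ⟨one_le_episodeAt t, hk t (Finset.mem_range.1 ht.1)⟩)
    · have h2 : R.IsStart t := (Finset.mem_filter.1 (Finset.mem_coe.1 ht)).2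
      have h3 : R.IsStart t' := (Finset.mem_filter.1 (Finset.mem_coe.1 ht')).2
      rw [IsStart] at h2 h3
      rw [← h2, ← h3, h]
  simpa using h1

lemma initialMismatch_le_one : initialMismatch R.M R.ŝ R.β R.μ₀ R.solve N R.s₀ ≤ 1 := by
  rw [← R.sum_E_mis_zero, ← R.sum_mass N]
  refine Finset.sum_le_sum fun D _ => ?_
  rw [← one_mul (R.mass D), ← R.E_const 1 0]
  exact R.E_mono (fun _ => R.bddMeas_mis) (fun _ => BddMeas.const _)
    fun h θ θ' _ => R.mis_le_one _

lemma initialMismatch_nonneg : 0 ≤ initialMismatch R.M R.ŝ R.β R.μ₀ R.solve N R.s₀ := by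
  rw [← R.sum_E_mis_zero]
  refine Finset.sum_nonneg fun D _ => ?_
  rw [← zero_mul (R.mass D), ← R.E_const 0 0]
  exact R.E_mono (fun _ => BddMeas.const _) (fun _ => R.bddMeas_mis)
    fun h θ θ' _ => R.mis_nonneg _

variable {V e : ℝ}
  (hv : ∀ θ s s', relValue (R.M.P θ) R.M.r R.ŝ s - relValue (R.M.P θ) R.M.r R.ŝ s' ≤ V)
include hv

/-- The regret bound for the schedule `T_k = ⌈e k⌉`. -/
lemma bayesRegret_le_of_ceil_sched (hV : 0 ≤ V) (he : 0 < e)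
    (hsched : R.sched = fun k : ℕ => ⌈e * k⌉₊)
    (hmis : initialMismatch R.M R.ŝ R.β R.μ₀ R.solve N R.s₀ ≤ e) {T : ℕ} (hT : 1 ≤ T) :
    bayesRegret R.M R.ŝ R.β R.μ₀ R.solve R.sched N R.s₀ T ≤ 3 * V +
      20 * (V * Fintype.card S * Fintype.card A * √(e * T)) *
        (1 + Real.log (Fintype.card S * Fintype.card A * T)) := by
  have hA := R.nonempty_action
  have hS : Nonempty S := ⟨R.ŝ⟩
  have hs1 : 1 ≤ Fintype.card S := Fintype.card_pos
  have ha1 : 1 ≤ Fintype.card A := Fintype.card_pos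
  have hexp := exp_neg_mul_le hs1 ha1 hT
  have hreg := R.bayesRegret_le N hv hV T
  have herr := R.sum_error_le_mismatch N hv hV T
  have hε0 := R.initialMismatch_nonneg N
  have hε1 := R.initialMismatch_le_one N
  set ε := initialMismatch R.M R.ŝ R.β R.μ₀ R.solve N R.s₀
  have hs1' : (1 : ℝ) ≤ Fintype.card S := by exact_mod_cast hs1
  have ha1' : (1 : ℝ) ≤ Fintype.card A := by exact_mod_cast ha1
  have hT' : (1 : ℝ) ≤ T := by exact_mod_cast hT
  set s : ℝ := (Fintype.card S : ℝ) with hs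
  set a : ℝ := (Fintype.card A : ℝ) with ha
  have hsa : 1 ≤ s * a := one_le_mul_of_one_le_of_one_le hs1' ha1'
  have hlog : Real.log T ≤ Real.log (s * a * T) :=
    Real.log_le_log (by linarith) (le_mul_of_one_le_left (by linarith) hsa)
  have hlogT : 0 ≤ Real.log T := Real.log_nonneg hT'
  set Q := 1 + Real.log (s * a * T) with hQ
  have hQ1 : 1 ≤ Q := by linarith
  set z := √(e * T) with hz
  have hz0 : 0 < z := Real.sqrt_pos.2 (by positivity)
  have hz2 : z ^ 2 = e * T := Real.sq_sqrt (by positivity)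
  -- the number of episodes
  have hroot : e * √(2 * T / e) ≤ 2 * z := by
    have h1 : e * √(2 * T / e) = √(2 * (e * T)) := by
      rw [← Real.sqrt_sq he.le, ← Real.sqrt_mul (by positivity), Real.sqrt_sq he.le]
      congr 1
      field_simp
    rw [h1]
    refine Real.sqrt_le_iff.2 ⟨by positivity, ?_⟩
    rw [mul_pow, hz2]
    nlinarith [mul_pos he (show (0 : ℝ) < T by linarith)]
  have hepi : ∀ t < T, (episodeAt R.sched t : ℝ) ≤ 1 + √(2 * T / e) := fun t ht => by
    rw [hsched]
    exact episodeAt_ceil_le he ht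
  have hcard : (({t ∈ Finset.range T | R.IsStart t} : Finset ℕ).card : ℝ)
      ≤ 1 + √(2 * T / e) := by
    have h1 := R.card_isStart_le (T := T) (k := ⌊1 + √(2 * T / e)⌋₊)
      fun t ht => Nat.le_floor (hepi t ht)
    exact le_trans (by exact_mod_cast h1) (Nat.floor_le (by positivity))
  -- The first summand uses ε ≤ 1 and becomes the 2V that completes 3V; the second uses ε ≤ e.
  have hstarts : ε * ({t ∈ Finset.range T | R.IsStart t} : Finset ℕ).card ≤ 1 + 2 * z := by
    calc ε * ({t ∈ Finset.range T | R.IsStart t} : Finset ℕ).card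
        ≤ ε * (1 + √(2 * T / e)) := mul_le_mul_of_nonneg_left hcard hε0
      _ = ε + ε * √(2 * T / e) := by ring
      _ ≤ 1 + e * √(2 * T / e) :=
        add_le_add hε1 (mul_le_mul_of_nonneg_right hmis (Real.sqrt_nonneg _))
      _ ≤ 1 + 2 * z := by linarith
  -- the error due to the unknown transitions
  have hzQ : z ≤ s * a * z * Q := by
    calc z = 1 * z * 1 := by ring
      _ ≤ s * a * z * Q := by gcongr
  have herr' : ∑ D : Offline S A N, R.error D T ≤ V * (15 * (s * a * z * Q)) := by
    -- If e T ≤ 1 or T ≤ e, then T ε ≤ z and the crude bound is enough. Otherwise both 1 ≤ z and e ≤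
    -- z are available.
    have hsmall : T * ε ≤ z → ∑ D : Offline S A N, R.error D T ≤ V * (15 * (s * a * z * Q)) := by
      intro h
      exact herr.trans (mul_le_mul_of_nonneg_left (by linarith) hV)
    rcases le_or_gt (e * T) 1 with h1 | h1
    · refine hsmall ?_
      have h2 : z ≤ 1 := Real.sqrt_le_one.2 h1
      have h3 : T * ε ≤ z ^ 2 := by
        rw [hz2]
        nlinarith
      nlinarith
    rcases le_or_gt (T : ℝ) e with h2 | h2
    · refine hsmall ?_
      have h3 : (T : ℝ) ≤ z := Real.le_sqrt_of_sq_le (by nlinarith)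
      nlinarith
    have hz1 : 1 ≤ z := Real.one_le_sqrt.2 h1.le
    have hez : e ≤ z := Real.le_sqrt_of_sq_le (by nlinarith)
    -- An upper bound for the length of every episode that starts before T.
    set τ : ℕ := ⌈e * (1 + √(2 * T / e))⌉₊ with hτ
    have hτz : (τ : ℝ) ≤ 4 * z := by
      have := (Nat.ceil_lt_add_one (show 0 ≤ e * (1 + √(2 * T / e)) by positivity)).le
      rw [← hτ] at this
      linarith
    have hτt : ∀ t < T, t < episodeStart R.sched (episodeAt R.sched t) + τ := fun t ht => by
      have h3 := lt_episodeStart_episodeAt_succ R.sched_pos t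
      rw [episodeStart_succ (one_le_episodeAt t)] at h3
      have h4 : R.sched (episodeAt R.sched t) ≤ τ := by
        have h5 := hepi t ht
        generalize episodeAt R.sched t = m at h5
        rw [hsched]
        exact Nat.ceil_mono (mul_le_mul_of_nonneg_left h5 he.le)
      omega
    have hL : 0 < s + Real.log (s * a * T) := by linarith
    -- With η = s a Q / z, the mismatch term η e T / 2 equals s a z Q / 2, and the count term, with
    -- L at most s Q, is at most 4 s z Q.
    have hη : 0 < s * a * Q / z := by positivity
    refine (R.sum_error_le N hv hL hη hV hτt).trans (mul_le_mul_of_nonneg_left ?_ hV)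
    have hLQ : s + Real.log (s * a * T) ≤ s * Q := by
      rw [hQ, mul_add, mul_one]
      have : Real.log (s * a * T) ≤ s * Real.log (s * a * T) :=
        le_mul_of_one_le_left (by linarith) hs1'
      linarith
    have e1 : s * a * (2 * (τ : ℝ)) ≤ 8 * (s * a * z * Q) := by
      calc s * a * (2 * (τ : ℝ)) ≤ s * a * (2 * (4 * z)) := by gcongr
        _ = 8 * (s * a * z * 1) := by ring
        _ ≤ 8 * (s * a * z * Q) := by gcongr
    have e2 : s * a * Q / z / 2 * (T * ε) ≤ s * a * z * Q := by
      calc s * a * Q / z / 2 * (T * ε) ≤ s * a * Q / z / 2 * (T * e) := by gcongr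
        _ = s * a * Q / z / 2 * z ^ 2 := by rw [hz2, mul_comm e]
        _ = s * a * z * Q / 2 := by field_simp
        _ ≤ s * a * z * Q := half_le_self (by positivity)
    have e3 : 4 * (s + Real.log (s * a * T)) / (s * a * Q / z) *
        (s * a * (1 + Real.log T)) ≤ 4 * (s * a * z * Q) := by
      calc 4 * (s + Real.log (s * a * T)) / (s * a * Q / z) * (s * a * (1 + Real.log T))
          ≤ 4 * (s * Q) / (s * a * Q / z) * (s * a * Q) := by
            gcongr
            linarith
        _ = 4 * (s * 1 * z * Q) := by field_simp
        _ ≤ 4 * (s * a * z * Q) := by gcongr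
    -- The constant is 15 = 2 + 8 + 1 + 4: failures of the confidence sets, delayed counts,
    -- mismatch, harmonic sums.
    linarith
  have hfin : bayesRegret R.M R.ŝ R.β R.μ₀ R.solve R.sched N R.s₀ T ≤
      V + 2 * (V * (1 + 2 * z)) + V * (15 * (s * a * z * Q)) := by
    have := mul_le_mul_of_nonneg_left hstarts hV
    linarith
  have := mul_le_mul_of_nonneg_left hzQ hV
  have hpos : 0 ≤ V * (s * a * z * Q) := by positivity
  calc _ ≤ _ := hfin
    -- The remaining 4 V z from the episode starts is at most 4 V s a z Q, and 4 + 15 ≤ 20.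
    _ ≤ 3 * V + 20 * (V * (s * a * z * Q)) := by linarith
    _ = _ := by ring

end Scenario

end InfIPSRL

theorem corollary2 :
    ∃ (C : ℝ) (p : ℕ), ∀ (S A Θ : Type*) [Fintype S] [DecidableEq S] [Fintype A] [DecidableEq A]
      [MeasurableSpace Θ]
      (M : InfIPSRL.MDPFamily S A Θ)
      (_ : ∀ θ, InfIPSRL.Communicating (M.P θ))
      (ŝ : S) (vbar : ℝ) (_ : 0 ≤ vbar)
      (_ : ∀ θ s s', InfIPSRL.relValue (M.P θ) M.r ŝ s - InfIPSRL.relValue (M.P θ) M.r ŝ s' ≤ vbar)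
      (μ₀ : Measure Θ) [IsProbabilityMeasure μ₀]
      (β : ℝ) (_ : 0 < β) (N : ℕ) (s₀ : S)
      (solve : Θ → S → A) (_ : InfIPSRL.IsPlanningOracle M ŝ solve)
      (εhat : ℝ) (_ : 0 < εhat)
      (_ : InfIPSRL.initialMismatch M ŝ β μ₀ solve N s₀ ≤ εhat) (T : ℕ),
      Integrable (InfIPSRL.regret M ŝ β μ₀ solve (fun k => ⌈εhat * k⌉₊) N s₀ T) μ₀ ∧
      InfIPSRL.bayesRegret M ŝ β μ₀ solve (fun k => ⌈εhat * k⌉₊) N s₀ T ≤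
        3 * vbar +
          C * (vbar * Fintype.card S * Fintype.card A * Real.sqrt (εhat * T)) *
            (1 + Real.log (Fintype.card S * Fintype.card A * T)) ^ p := by
  refine ⟨20, 1, ?_⟩
  intro S A Θ _ _ _ _ _ M hc ŝ vbar hV hv μ₀ hμ₀ β _ N s₀ solve hsolve e he hmis T
  let R : InfIPSRL.Scenario S A Θ :=
    { M := M
      communicating := hc
      ŝ := ŝ
      β := β
      μ₀ := μ₀
      isProbabilityMeasure := hμ₀
      s₀ := s₀
      solve := solve
      oracle := hsolve
      sched := fun k => ⌈e * k⌉₊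
      sched_pos := fun k hk => Nat.one_le_ceil_iff.2
        (mul_pos he (Nat.cast_pos.2 hk)) }
  refine ⟨R.integrable_regret N T, ?_⟩
  -- At T = 0 the regret and the square root both vanish, so the logarithm of zero plays no role.
  rcases Nat.eq_zero_or_pos T with rfl | hT
  · simp [InfIPSRL.bayesRegret, InfIPSRL.regret, hV]
  · rw [pow_one]
    exact R.bayesRegret_le_of_ceil_sched N hv hV he rfl hmis hT
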